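/- Let $G=(V,E)$ be a finite connected simple graph with $n=|V|$, $m=|E|\ge 1$, maximum degree $\Delta$ and graph distance $d(\cdot,\cdot)$; let $\beta>0$ and $x=\tanh\beta\in(0,1)$. Write $\mathbb E_\beta$ for expectation under the zero-field ferromagnetic Ising measure $\mathbb P_\beta(\sigma)\propto\exp(\beta\sum_{ij\in E}\sigma_i\sigma_j)$ on $\{-1,1\}^V$. For $A\subseteq E$ let $\partial A$ be the set of vertices of odd degree in $(V,A)$, let $\mathcal C_0=\{A:\partial A=\emptyset\}$, $\mathcal C_2=\{A:|\partial A|=2\}$, $\mathcal C_{uv}=\{A:\partial A=\{u,v\}\}$ and $\mathcal W=\mathcal C_0\cup\mathcal C_2$. The worm process is the Markov chain $(X_t)_{t\ge0}$ on $\mathcal W$ with $X_0=\emptyset$ whose transition probabilities are, for $uv\in E$ (with $d(u)$ the degree of $u$ in $G$), $$P_x(A,A\triangle uv)=\begin{cases}x^{\mathbf 1(uv\notin A)}\frac1{2n}\left(\frac1{d(u)}+\frac1{d(v)}\right),&A\in\mathcal C_0,\\ x^{\mathbf 1(uv\notin A)}\frac14\left(\frac1{d(u)}+\frac1{d(v)}\right),&A\triangle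 uv\in\mathcal C_0,\\ \min\left(\frac{d(u)}{d(v)}x^{\mathbf 1(uv\notin A)-\mathbf 1(uv\in A)},1\right)\frac1{4d(u)},&A,\,A\triangle uv\in\mathcal C_2,\ u\in\partial A,\end{cases}$$ all other off-diagonal entries being $0$. For $k\in\mathbb N$ and $\epsilon,\delta\in(0,1]$ put $$\tau=\left\lceil4\left(\log2+\frac{\log(4\delta^{-1})}{m}\right)\Delta\,m^2n^4\right\rceil,\qquad N=\left\lceil16\,\epsilon^{-2}(2+\epsilon)^2\delta^{-1}\Delta\,m\,n^6x^{-k}\right\rceil,$$ $$\hat S_0=\frac1N\sum_{t=\tau+1}^{\tau+N}\mathbf 1_{\mathcal C_0}(X_t),\qquad \hat S_{uv}=\frac1N\sum_{t=\tau+1}^{\tau+N}\mathbf 1_{\mathcal C_{uv}}(X_t).$$ 1. For all $u\ne v$ with $d(u,v)\le k$, the estimator $\frac n2\hat S_{uv}/\hat S_0$ is an $(\epsilon,\delta)$-approximation of $\mathbb E_\beta(\sigma_u\sigma_v)$: with probability at least $1-\delta$, $$\left|\frac n2\frac{\hat S_{uv}}{\hat S_0}-\mathbb E_\beta(\sigma_u\sigma_v)\right|\le\epsilon\,\mathbb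 E_\beta(\sigma_u\sigma_v).$$ 2. The number of transitions used satisfies $N+\tau\le C\,\epsilon^{-2}\delta^{-1}\Delta\,m\,n^6x^{-k}$ with an absolute constant $C$. 3. Consider the algorithm that answers $1$ if $u=v$, and otherwise simulates the worm process (at each transition: with probability $1/2$ do nothing; otherwise choose a uniformly random vertex $v$ if $A\in\mathcal C_0$, or a uniformly random $v\in\partial A$ if $A\in\mathcal C_2$, choose a uniformly random neighbour $u$ of $v$, propose $A\triangle uv$, and accept it with the Metropolis probability) and outputs $\frac n2\hat S_{uv}/\hat S_0$. Count one step for each random choice, graph or memory access, real arithmetic operation, or evaluation of a fixed closed formula, $n+m$ steps for reading the graph, and $k$ steps for computing $x^k$. Then, for every fixed $k$ and all $u,v$ with $d(u,v)\le k$, the algorithm takes at most $C_k\,\epsilon^{-2}\delta^{-1}\Delta\,m\,n^6x^{-k}$ steps, where $C_k$ depends only on $k$. 4. For every fixed $k$ and $\beta_0>0$, this algorithm is a fully-polynomial randomized approximation scheme for the $k$-restricted two-point correlation function $g_k(u,v)=\mathbb E_\beta(\sigma_u\sigma_v)$, $d(u,v)\le k$, on all instances $(G,\beta,u,v)$ with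 $\beta\ge\beta_0$: for all $\epsilon,\delta\in(0,1]$ its output is an $(\epsilon,\delta)$-approximation of $g_k(u,v)$, and its number of steps is at most a polynomial (depending only on $k$ and $\beta_0$) in $n$, $\epsilon^{-1}$ and $\delta^{-1}$. -/

import Mathlib

noncomputable section WormDefinitions

open Finset
open scoped Classical ENNReal symmDiff

namespace Worm

section Graphs

variable {V : Type*} [Fintype V]

/-! ## The zero-field ferromagnetic Ising model -/

/-- The value `±1` of a spin, as a real number. -/
def spin (σ : V → ℤˣ) (v : V) : ℝ := ((σ v : ℤ) : ℝ)

/-- The unnormalised Boltzmann weight `exp (β ∑_{ij ∈ E} σ_i σ_j)`. -/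
def isingWeight (G : SimpleGraph V) (β : ℝ) (σ : V → ℤˣ) : ℝ :=
  Real.exp (β * ∑ e ∈ G.edgeFinset, (e.map (spin σ)).mul)

/-- The partition function. -/
def isingZ (G : SimpleGraph V) (β : ℝ) : ℝ := ∑ σ : V → ℤˣ, isingWeight G β σ

/-- The two-point correlation `𝔼_β (σ_u σ_v)`. -/
def correlation (G : SimpleGraph V) (β : ℝ) (u v : V) : ℝ :=
  (∑ σ : V → ℤˣ, spin σ u * spin σ v * isingWeight G β σ) / isingZ G β

/-- The `k`-restricted two-point correlation function, on pairs at distance at most `k`. -/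
def restrictedCorrelation (G : SimpleGraph V) (β : ℝ) (k : ℕ)
    (p : {p : V × V // G.dist p.1 p.2 ≤ k}) : ℝ :=
  correlation G β p.1.1 p.1.2

/-! ## The worm chain -/

/-- `∂A`: the vertices of odd degree in the spanning subgraph `(V, A)`. -/
def oddVertices (A : Finset (Sym2 V)) : Finset V :=
  univ.filter fun v => Odd (#(univ.filter fun u => s(u, v) ∈ A))

/-- The state space: edge sets with no odd vertex or with exactly two odd vertices. -/
def WormSpace (G : SimpleGraph V) : Type _ :=
  {A : Finset (Sym2 V) //
    A ⊆ G.edgeFinset ∧ (oddVertices A = ∅ ∨ #(oddVertices A) = 2)}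

instance (G : SimpleGraph V) : Fintype (WormSpace G) := by
  unfold WormSpace; infer_instance

/-- The empty edge set, the initial state of the chain. -/
def emptyState (G : SimpleGraph V) : WormSpace G :=
  ⟨∅, by simp, by left; ext v; simp [oddVertices]⟩

/-- The probability of the transition `A ↦ A ∆ {e}`. The three cases are: `A` has no odd vertex;
`A ∆ {e}` has no odd vertex; both have two. In the last case exactly one endpoint `u` of `e = uv`
is odd in `A`, so the double sum has a single term. -/
def edgeRate (G : SimpleGraph V) (x : ℝ) (A : Finset (Sym2 V)) (e : Sym2 V) : ℝ :=
  if oddVertices A = ∅ then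
    (if e ∈ A then 1 else x) * (1 / (2 * (Fintype.card V : ℝ))) *
      ∑ w ∈ e.toFinset, 1 / (G.degree w : ℝ)
  else if oddVertices (A ∆ {e}) = ∅ then
    (if e ∈ A then 1 else x) * (1 / 4) * ∑ w ∈ e.toFinset, 1 / (G.degree w : ℝ)
  else
    ∑ u ∈ e.toFinset ∩ oddVertices A, ∑ v ∈ e.toFinset \ oddVertices A,
      min ((G.degree u : ℝ) / (G.degree v : ℝ) * (if e ∈ A then x⁻¹ else x)) 1 *
        (1 / (4 * (G.degree u : ℝ)))

/-- The off-diagonal entries of the transition matrix: nonzero only if `B = A ∆ {e}` for an edge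
`e`, which is then unique. -/
def moveProb (G : SimpleGraph V) (x : ℝ) (A B : WormSpace G) : ℝ :=
  ∑ e ∈ G.edgeFinset.filter (fun e => B.1 = A.1 ∆ {e}), edgeRate G x A.1 e

/-- The worm transition matrix `P_x`. -/
def wormMatrix (G : SimpleGraph V) (x : ℝ) (A B : WormSpace G) : ℝ :=
  if A = B then 1 - ∑ C ∈ univ.erase A, moveProb G x A C else moveProb G x A B

/-- `X` is a Markov chain with transition matrix `P_x` and `X 0` the empty edge set: its
finite-dimensional distributions are products of matrix entries. -/
structure IsWormChain (G : SimpleGraph V) (x : ℝ) {Ω : Type*} [MeasurableSpace Ω]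
    (μ : MeasureTheory.Measure Ω) (X : ℕ → Ω → WormSpace G) : Prop where
  measurable : ∀ t A, MeasurableSet {ω | X t ω = A}
  path_law : ∀ (t : ℕ) (a : ℕ → WormSpace G),
    μ {ω | ∀ i ≤ t, X i ω = a i} =
      ENNReal.ofReal ((if a 0 = emptyState G then 1 else 0) *
        ∏ i ∈ range t, wormMatrix G x (a i) (a (i + 1)))

/-! ## Burn-in time, sample size and estimators -/

/-- The scale `⌈4 (log 2 + log (2 / δ) / m) Δ m² n⁴⌉` of the burn-in time. -/
def burnIn (G : SimpleGraph V) (δ : ℝ) : ℕ :=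
  ⌈4 * (Real.log 2 + Real.log (2 * δ⁻¹) / (#G.edgeFinset : ℝ)) * (G.maxDegree : ℝ) *
    (#G.edgeFinset : ℝ) ^ 2 * (Fintype.card V : ℝ) ^ 4⌉₊

/-- The sample size `⌈16 ε⁻² (2 + ε)² δ⁻¹ Δ m n⁶ x⁻ᵏ⌉`. -/
def sampleSize (G : SimpleGraph V) (x : ℝ) (k : ℕ) (ε δ : ℝ) : ℕ :=
  ⌈16 * (ε ^ 2)⁻¹ * (2 + ε) ^ 2 * δ⁻¹ * (G.maxDegree : ℝ) * (#G.edgeFinset : ℝ) *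
    (Fintype.card V : ℝ) ^ 6 * (x ^ k)⁻¹⌉₊

/-- The fraction of the `N` states at times `τ + 1, …, τ + N` of a trajectory whose set of odd
vertices is `W`. -/
def visitFraction {G : SimpleGraph V} (τ N : ℕ) (a : ℕ → WormSpace G) (W : Finset V) : ℝ :=
  (1 / (N : ℝ)) * ∑ t ∈ Icc (τ + 1) (τ + N), if oddVertices (a t).1 = W then 1 else 0

/-- The estimator `(n / 2) Ŝ_uv / Ŝ_0`, both sample means from the same trajectory. -/
def correlationEstimator {G : SimpleGraph V} (τ N : ℕ) (a : ℕ → WormSpace G) (u v : V) : ℝ :=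
  (Fintype.card V : ℝ) / 2 * (visitFraction τ N a {u, v} / visitFraction τ N a ∅)

end Graphs

/-! ## Randomized computations with a step count -/

/-- A randomized computation: the joint law of its output and the number of elementary steps. -/
def Comp (α : Type) : Type := PMF (α × ℕ)

namespace Comp

variable {α : Type}

/-- Steps of consecutive computations add up; returning a value is free. -/
instance : Monad Comp where
  pure a := PMF.pure (a, 0)
  bind c f := PMF.bind c fun r => PMF.map (fun s => (s.1, r.2 + s.2)) (f r.1)

/-- A deterministic computation that costs `t` steps. -/
def tick (t : ℕ) : Comp Unit := PMF.pure ((), t)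

/-- An elementary deterministic operation: one step. -/
def op (a : α) : Comp α := PMF.pure (a, 1)

/-- A coin with success probability `p` (clamped to `[0, 1]`): one step. -/
def coin (p : ℝ) : Comp Bool :=
  PMF.map (fun b => (b, 1)) <|
    PMF.ofFintype (fun b => cond b (min (ENNReal.ofReal p) 1) (1 - min (ENNReal.ofReal p) 1))
      (by simp)

/-- A uniformly random element of `S` (an arbitrary element if `S` is empty): one step. -/
def uniform [Nonempty α] (S : Finset α) : Comp α :=
  PMF.map (fun a => (a, 1)) <|
    if h : S.Nonempty then PMF.uniformOfFinset S h else PMF.pure (Classical.arbitrary α)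

/-- The probability that the output lies in `S`. -/
def prob (c : Comp α) (S : Set α) : ℝ≥0∞ := PMF.toOuterMeasure c {r | r.1 ∈ S}

/-- `c` uses at most `B` steps, whatever the outcome of its random choices. -/
def StepsLE (c : Comp α) (B : ℝ) : Prop := ∀ r ∈ PMF.support c, (r.2 : ℝ) ≤ B

/-- The output of `c` has relative error at most `ε` for `y`, with probability at least
`1 - δ`. -/
def Approximates (c : Comp ℝ) (y ε δ : ℝ) : Prop :=
  ENNReal.ofReal (1 - δ) ≤ c.prob {z | |z - y| ≤ ε * y}

end Comp

/-- The algorithm `alg` is a fully-polynomial randomized approximation scheme for the function `f`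
on the problem instances `I`. -/
def IsFPRAS {I : Type} (size : I → ℕ) (f : I → ℝ) (alg : I → ℝ → ℝ → Comp ℝ) : Prop :=
  (∀ i, ∀ ε ∈ Set.Ioc (0 : ℝ) 1, ∀ δ ∈ Set.Ioc (0 : ℝ) 1,
    (alg i ε δ).Approximates (f i) ε δ) ∧
  ∃ p : MvPolynomial (Fin 3) ℝ,
    ∀ i, ∀ ε ∈ Set.Ioc (0 : ℝ) 1, ∀ δ ∈ Set.Ioc (0 : ℝ) 1,
      (alg i ε δ).StepsLE (MvPolynomial.eval ![(size i : ℝ), ε⁻¹, δ⁻¹] p)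

/-! ## The worm algorithm -/

section Algorithm

variable {V : Type}

/-- The memory of the algorithm: the current edge set, and its two odd vertices, if any. -/
structure Memory (V : Type) where
  edges : Finset (Sym2 V)
  defects : Option (V × V)

variable [Fintype V] [Nonempty V]

/-- Choose the vertex from which to move, uniformly among all vertices or among the two odd
vertices; in the latter case also report the other odd vertex. -/
def chooseVertex : Option (V × V) → Comp (V × Option V)
  | none => do
      let v ← Comp.uniform (univ : Finset V)
      pure (v, none)
  | some (a, b) => do
      let c ← Comp.coin (1 / 2)
      pure (if c then (a, some b) else (b, some a))

/-- The new odd vertices after toggling the edge `vu`, where `v` is the chosen vertex and `other`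
is the other odd vertex before the move. -/
def newDefects (v u : V) : Option V → Option (V × V)
  | none => some (v, u)
  | some w => if u = w then none else some (u, w)

/-- One transition: a lazy coin, then a random vertex and a random neighbour are proposed and
accepted with the Metropolis probability. -/
def wormStep (G : SimpleGraph V) (x : ℝ) (s : Memory V) : Comp (Memory V) := do
  let move ← Comp.coin (1 / 2)
  if move then
    let p ← chooseVertex s.defects
    let v := p.1
    let u ← Comp.uniform (G.neighborFinset v)
    let present ← Comp.op (decide (s(v, u) ∈ s.edges))
    let d ← Comp.op (newDefects v u p.2)
    let ratio ← Comp.op (if present then x⁻¹ else x)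
    let dv ← Comp.op (G.degree v : ℝ)
    let du ← Comp.op (G.degree u : ℝ)
    let a ← Comp.op (if p.2.isSome ∧ d.isSome then dv / du * ratio else ratio)
    let accept ← Comp.coin a
    if accept then Comp.op ⟨s.edges ∆ {s(v, u)}, d⟩ else pure s
  else pure s

/-- Perform a given number of transitions. -/
def burn (G : SimpleGraph V) (x : ℝ) : ℕ → Memory V → Comp (Memory V)
  | 0, s => pure s
  | t + 1, s => do
      Comp.tick 1
      let s' ← wormStep G x s
      burn G x t s'

/-- Perform a given number of transitions, and count the visited states with no odd vertex (`c₀`)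
and those with odd vertices `u, v` (`c₂`). -/
def sample (G : SimpleGraph V) (x : ℝ) (u v : V) : ℕ → Memory V → ℕ → ℕ → Comp (ℕ × ℕ)
  | 0, _, c₀, c₂ => pure (c₀, c₂)
  | t + 1, s, c₀, c₂ => do
      Comp.tick 1
      let s' ← wormStep G x s
      let h₀ ← Comp.op (decide (s'.defects = none))
      let h₂ ← Comp.op (decide (s'.defects = some (u, v) ∨ s'.defects = some (v, u)))
      let c₀' ← Comp.op (c₀ + h₀.toNat)
      let c₂' ← Comp.op (c₂ + h₂.toNat)
      sample G x u v t s' c₀' c₂'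

/-- The worm algorithm for the correlation of `u` and `v`. Reading the graph to find `n`, `m`, `Δ`
costs `n + m` steps and computing `x ^ k` costs `k` steps. If `u = v` the answer is `1`. -/
def wormAlgorithm (G : SimpleGraph V) (β : ℝ) (k : ℕ) (u v : V) (ε δ : ℝ) : Comp ℝ :=
  if u = v then Comp.op 1 else do
    Comp.tick (Fintype.card V + #G.edgeFinset)
    let x ← Comp.op (Real.tanh β)
    Comp.tick k
    let τ ← Comp.op (burnIn G (δ / 2))
    let N ← Comp.op (sampleSize G x k ε δ)
    let s ← burn G x τ ⟨∅, none⟩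
    let c ← sample G x u v N s 0 0
    let S₀ ← Comp.op ((c.1 : ℝ) / N)
    let S₂ ← Comp.op ((c.2 : ℝ) / N)
    Comp.op ((Fintype.card V : ℝ) / 2 * (S₂ / S₀))

end Algorithm

/-- A problem instance: a finite connected graph with at least one edge, an inverse temperature
`β ≥ β₀`, and a pair of vertices at distance at most `k`. -/
structure CorrelationInstance (k : ℕ) (β₀ : ℝ) where
  n : ℕ
  graph : SimpleGraph (Fin n)
  connected : graph.Connected
  edge_nonempty : graph.edgeSet.Nonempty
  β : ℝ
  le_β : β₀ ≤ β
  pair : {p : Fin n × Fin n // graph.dist p.1 p.2 ≤ k}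

/-- The value to be computed on an instance. -/
def CorrelationInstance.value {k : ℕ} {β₀ : ℝ} (i : CorrelationInstance k β₀) : ℝ :=
  restrictedCorrelation i.graph i.β k i.pair

/-- The worm algorithm, run on an instance. -/
def CorrelationInstance.run {k : ℕ} {β₀ : ℝ} (i : CorrelationInstance k β₀) (ε δ : ℝ) :
    Comp ℝ :=
  haveI : Nonempty (Fin i.n) := i.connected.nonempty
  wormAlgorithm i.graph i.β k i.pair.1.1 i.pair.1.2 ε δ

end Worm

end WormDefinitions

/-! Expanding each Boltzmann factor as `cosh β (1 + x σ_i σ_j)` and summing over spins gives the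
correlation as `Z_uv / Z_∅`, where `Z_S` (`paritySum`) sums `x ^ #A` over the edge sets `A` with
boundary `S`. The worm chain is reversible for the weights `n x ^ #A` on even sets and `2 x ^ #A` on
sets with two odd vertices. Hence its stationary law gives `C_uv` and `C_0` probabilities whose
ratio is `2 / n` times the correlation, and the task is to estimate two probabilities by time
averages with small relative error.

The probabilities are not small. The spin representation shows `Z_S ≤ Z_∅` for every `S`
(`paritySum_le`), so the normalising constant is at most `(n + 2 (n choose 2)) Z_∅ = n² Z_∅`. Adding
the edges of a geodesic to even sets shows `Z_uv ≥ x ^ k Z_∅` (`pow_mul_paritySum_le`). Both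
probabilities are therefore at least `x ^ k / n²`.

The spectral gap is at least `1 / (4 Δ m n²)` (`hasGap_wormMatrix`), by canonical paths from every
state `I` to every even state `F`. The difference `D = I ∆ F` is dismantled edge by edge
(`exists_dismantling`), each intermediate remainder being shifted by `F`. Given `D` and the edge
being removed, the state on the path determines `F`, and the weight of the pair factors into a
function of the transition and a sum over `D` that is again bounded by `n² Z_∅` (`canonical_paths`).
Restricting the targets to even states is enough to dominate the variance.

Laziness turns the gap into L² contraction (`mean_act_sq_le_mean_mul_act`). Contraction gives
convergence from the empty state, whose stationary probability is at least `2 ^ (-m)`. It also gives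
a variance linear in `N` for sums along the stationary chain, hence Chebyshev bounds. The failure
budget is `5 δ / 16` for each of the two counts and `δ / 4` for the burn-in, in total `7 δ / 8`
(`one_sub_le_success`).

Finally the abstract chain (`measure_burnIn_walk`) and the program (`prob_wormAlgorithm`) are both
reduced to the same real number, an iterate of the transition matrix applied to `walkMean`. The
single estimate thus serves both, and the step bounds follow by adding costs along the program. -/

noncomputable section WormProof

open Finset
open scoped Classical ENNReal symmDiff

namespace Worm

/-! ### Lazy reversible chains with a spectral gap -/

section Markov

variable {S : Type*} [Fintype S]

/-- The action of a matrix on functions. -/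
def act (P : S → S → ℝ) (f : S → ℝ) (s : S) : ℝ := ∑ t, P s t * f t

/-- The integral of `f` against the weights `p`. -/
def mean (p f : S → ℝ) : ℝ := ∑ s, p s * f s

/-- `P` is a stochastic matrix with holding probabilities at least `1 / 2`, reversible with respect
to the positive probability weights `p`. -/
structure IsLazyReversible (P : S → S → ℝ) (p : S → ℝ) : Prop where
  nonneg : ∀ s t, 0 ≤ P s t
  row_sum : ∀ s, ∑ t, P s t = 1
  lazy : ∀ s, 1 / 2 ≤ P s s
  pos : ∀ s, 0 < p s
  total : ∑ s, p s = 1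
  reversible : ∀ s t, p s * P s t = p t * P t s

/-- A spectral gap `γ`, expressed by the Rayleigh quotients of centred functions. -/
def HasGap (P : S → S → ℝ) (p : S → ℝ) (γ : ℝ) : Prop :=
  ∀ f, mean p f = 0 → mean p (fun s => f s * act P f s) ≤ (1 - γ) * mean p (fun s => f s ^ 2)

/-- The expectation of `φ (y + f (X 1) + ⋯ + f (X N))` for the chain started from `s`. -/
def walkMean {M : Type*} [Add M] (P : S → S → ℝ) (f : S → M) (φ : M → ℝ) : ℕ → S → M → ℝ
  | 0, _, y => φ y
  | N + 1, s, y => ∑ t, P s t * walkMean P f φ N t (y + f t)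

variable {P : S → S → ℝ} {p : S → ℝ} {γ : ℝ}

lemma mean_add (f g : S → ℝ) : mean p (fun s => f s + g s) = mean p f + mean p g := by
  simp [mean, mul_add, sum_add_distrib]

lemma mean_const_mul (c : ℝ) (f : S → ℝ) : mean p (fun s => c * f s) = c * mean p f := by
  simp only [mean, mul_sum]; exact sum_congr rfl fun s _ => by ring

lemma mean_mono (h : IsLazyReversible P p) {f g : S → ℝ} (hfg : ∀ s, f s ≤ g s) :
    mean p f ≤ mean p g :=
  sum_le_sum fun s _ => mul_le_mul_of_nonneg_left (hfg s) (h.pos s).le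

lemma mean_const (h : IsLazyReversible P p) (c : ℝ) : mean p (fun _ => c) = c := by
  simp [mean, ← sum_mul, h.total]

lemma mean_nonneg (h : IsLazyReversible P p) {f : S → ℝ} (hf : ∀ s, 0 ≤ f s) : 0 ≤ mean p f :=
  sum_nonneg fun s _ => mul_nonneg (h.pos s).le (hf s)

lemma act_add (f g : S → ℝ) : act P (fun s => f s + g s) = fun s => act P f s + act P g s := by
  funext s; simp [act, mul_add, sum_add_distrib]

lemma act_const (h : IsLazyReversible P p) (c : ℝ) : act P (fun _ => c) = fun _ => c := by
  funext s; simp [act, ← sum_mul, h.row_sum]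

lemma mean_act (h : IsLazyReversible P p) (f : S → ℝ) : mean p (act P f) = mean p f := by
  simp only [mean, act, mul_sum]
  rw [sum_comm]
  refine sum_congr rfl fun t _ => ?_
  calc ∑ s, p s * (P s t * f t) = ∑ s, p t * f t * P t s :=
        sum_congr rfl fun s _ => by rw [← mul_assoc, h.reversible]; ring
    _ = p t * f t := by rw [← mul_sum, h.row_sum, mul_one]

/-- The Dirichlet form. -/
lemma mean_sq_sub_mean_mul_act (h : IsLazyReversible P p) (f : S → ℝ) :
    ∑ s, ∑ t, p s * P s t * (f s - f t) ^ 2 =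
      2 * (mean p (fun s => f s ^ 2) - mean p (fun s => f s * act P f s)) := by
  have h1 : ∑ s, ∑ t, p s * P s t * f s ^ 2 = mean p (fun s => f s ^ 2) := by
    refine sum_congr rfl fun s _ => ?_
    rw [← sum_mul, ← mul_sum, h.row_sum, mul_one]
  have h2 : ∑ s, ∑ t, p s * P s t * f t ^ 2 = mean p (fun s => f s ^ 2) := by
    rw [← mean_act h]
    simp only [mean, act, mul_sum, mul_assoc]
  have h3 : ∑ s, ∑ t, p s * P s t * (f s * f t) = mean p (fun s => f s * act P f s) := by
    simp only [mean, act, mul_sum]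
    exact sum_congr rfl fun s _ => sum_congr rfl fun t _ => by ring
  have : ∀ s t, p s * P s t * (f s - f t) ^ 2 =
      p s * P s t * f s ^ 2 + p s * P s t * f t ^ 2 - 2 * (p s * P s t * (f s * f t)) :=
    fun s t => by ring
  simp only [this, sum_add_distrib, sum_sub_distrib, ← mul_sum, h1, h2]
  rw [h3]; ring

/-- Laziness makes `2P - 1` a stochastic operator preserving `p`, hence a contraction of L²(p).
Expanding the square of `(2P - 1) f` gives the inequality. It makes a one-sided gap sufficient:
negative eigenvalues need no separate control. -/
lemma mean_act_sq_le_mean_mul_act (h : IsLazyReversible P p) (f : S → ℝ) :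
    mean p (fun s => act P f s ^ 2) ≤ mean p (fun s => f s * act P f s) := by
  set k : S → ℝ := fun s => 2 * act P f s - f s with hk
  have hjensen : ∀ s, k s ^ 2 ≤ 2 * act P (fun t => f t ^ 2) s - f s ^ 2 := by
    intro s
    -- Row `s` of `2P - 1` is a probability vector under which `f` has mean `k s`. The claim is that
    -- its variance is nonnegative.
    set K : S → ℝ := fun t => 2 * P s t - if t = s then 1 else 0 with hK
    have hK0 : ∀ t, 0 ≤ K t := by
      intro t
      by_cases hts : t = s
      · subst hts; have := h.lazy t; simp only [hK, if_true]; linarith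
      · simp only [hK, if_neg hts, sub_zero]; linarith [h.nonneg s t]
    have hKsum : ∀ g : S → ℝ, ∑ t, K t * g t = 2 * act P g s - g s := by
      intro g
      simp [hK, sub_mul, sum_sub_distrib, act, mul_sum, mul_assoc]
    have h0 : 0 ≤ ∑ t, K t * (f t - k s) ^ 2 :=
      sum_nonneg fun t _ => mul_nonneg (hK0 t) (sq_nonneg _)
    have h1 : ∑ t, K t * (f t - k s) ^ 2 =
        ∑ t, K t * f t ^ 2 - 2 * k s * ∑ t, K t * f t + k s ^ 2 * ∑ t, K t * 1 := by
      simp only [mul_sum, ← sum_sub_distrib, ← sum_add_distrib]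
      exact sum_congr rfl fun t _ => by ring
    rw [h1, hKsum (fun t => f t ^ 2), hKsum f, hKsum (fun _ => 1), act_const h] at h0
    simp only [hk] at h0 ⊢
    nlinarith
  have h2 : mean p (fun s => k s ^ 2) ≤ mean p (fun s => f s ^ 2) := by
    refine (mean_mono h hjensen).trans (le_of_eq ?_)
    have : mean p (fun s => 2 * act P (fun t => f t ^ 2) s - f s ^ 2) =
        2 * mean p (act P (fun t => f t ^ 2)) - mean p (fun s => f s ^ 2) := by
      simp only [mean, mul_sum, ← sum_sub_distrib]
      exact sum_congr rfl fun t _ => by ring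
    rw [this, mean_act h]; ring
  have h3 : mean p (fun s => act P f s ^ 2) - mean p (fun s => f s * act P f s) =
      1 / 4 * (mean p (fun s => k s ^ 2) - mean p (fun s => f s ^ 2)) := by
    simp only [mean, mul_sum, ← sum_sub_distrib]
    exact sum_congr rfl fun t _ => by simp only [hk]; ring
  linarith

lemma mean_act_sq_le (h : IsLazyReversible P p) (hγ : HasGap P p γ) {f : S → ℝ}
    (hf : mean p f = 0) :
    mean p (fun s => act P f s ^ 2) ≤ (1 - γ) * mean p (fun s => f s ^ 2) :=
  (mean_act_sq_le_mean_mul_act h f).trans (hγ f hf)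

lemma mean_iterate_act (h : IsLazyReversible P p) (f : S → ℝ) (n : ℕ) :
    mean p ((act P)^[n] f) = mean p f := by
  induction n with
  | zero => rfl
  | succ n ih => rw [Function.iterate_succ_apply', mean_act h, ih]

lemma mean_iterate_act_sq_le (h : IsLazyReversible P p) (hγ : HasGap P p γ) (h1 : γ ≤ 1)
    {f : S → ℝ} (hf : mean p f = 0) (n : ℕ) :
    mean p (fun s => (act P)^[n] f s ^ 2) ≤ (1 - γ) ^ n * mean p (fun s => f s ^ 2) := by
  induction n with
  | zero => simp
  | succ n ih =>
    rw [Function.iterate_succ_apply', pow_succ', mul_assoc]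
    exact (mean_act_sq_le h hγ (by rw [mean_iterate_act h, hf])).trans
      (mul_le_mul_of_nonneg_left ih (by linarith))

lemma iterate_act_sub_const (h : IsLazyReversible P p) (f : S → ℝ) (c : ℝ) (n : ℕ) :
    (act P)^[n] (fun s => f s - c) = fun s => (act P)^[n] f s - c := by
  induction n with
  | zero => rfl
  | succ n ih =>
    rw [Function.iterate_succ_apply', ih, Function.iterate_succ_apply']
    simp only [sub_eq_add_neg, act_add, act_const h]

/-- Convergence to equilibrium from the state `s`. -/
lemma sq_iterate_act_sub_mean_le (h : IsLazyReversible P p) (hγ : HasGap P p γ) (h1 : γ ≤ 1)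
    {f : S → ℝ} (hf0 : ∀ s, 0 ≤ f s) (hf1 : ∀ s, f s ≤ 1) (n : ℕ) (s : S) :
    p s * ((act P)^[n] f s - mean p f) ^ 2 ≤ (1 - γ) ^ n := by
  have hmean : mean p (fun s => f s - mean p f) = 0 := by
    simp only [sub_eq_add_neg]
    rw [mean_add, mean_const h]; ring
  have h2 := mean_iterate_act_sq_le h hγ h1 hmean n
  rw [iterate_act_sub_const h] at h2
  have m0 : 0 ≤ mean p f := mean_nonneg h hf0
  have m1 : mean p f ≤ 1 := (mean_mono h hf1).trans_eq (mean_const h 1)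
  have h3 : mean p (fun s => (f s - mean p f) ^ 2) ≤ 1 := by
    rw [← mean_const h 1]
    refine mean_mono h fun t => ?_
    rw [sq_le_one_iff_abs_le_one, abs_le]
    constructor <;> linarith [hf0 t, hf1 t]
  -- One term of the L² norm is at most the whole, so a deterministic start costs a factor `1 / p
  -- s`.
  have h4 : p s * ((act P)^[n] f s - mean p f) ^ 2 ≤
      mean p (fun s => ((act P)^[n] f s - mean p f) ^ 2) :=
    single_le_sum (f := fun s => p s * ((act P)^[n] f s - mean p f) ^ 2)
      (fun t _ => mul_nonneg (h.pos t).le (sq_nonneg _)) (mem_univ s)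
  calc _ ≤ _ := h4
    _ ≤ (1 - γ) ^ n * mean p (fun s => (f s - mean p f) ^ 2) := h2
    _ ≤ (1 - γ) ^ n * 1 := mul_le_mul_of_nonneg_left h3 (pow_nonneg (by linarith) _)
    _ = _ := mul_one _

/-! ### Moments and concentration of additive functionals -/

section Walk

variable {M : Type*} [Add M] {f : S → M}

lemma walkMean_mono (h : IsLazyReversible P p) {φ ψ : M → ℝ} (hφ : ∀ y, φ y ≤ ψ y) (N : ℕ) (s : S)
    (y : M) : walkMean P f φ N s y ≤ walkMean P f ψ N s y := by
  induction N generalizing s y with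
  | zero => exact hφ y
  | succ N ih => exact sum_le_sum fun t _ => mul_le_mul_of_nonneg_left (ih _ _) (h.nonneg s t)

lemma walkMean_const (h : IsLazyReversible P p) (c : ℝ) (N : ℕ) (s : S) (y : M) :
    walkMean P f (fun _ => c) N s y = c := by
  induction N generalizing s y with
  | zero => rfl
  | succ N ih => simp only [walkMean, ih, ← sum_mul, h.row_sum, one_mul]

lemma walkMean_add (φ ψ : M → ℝ) (N : ℕ) (s : S) (y : M) :
    walkMean P f (fun y => φ y + ψ y) N s y = walkMean P f φ N s y + walkMean P f ψ N s y := by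
  induction N generalizing s y with
  | zero => rfl
  | succ N ih => simp only [walkMean, ih, mul_add, sum_add_distrib]

lemma walkMean_const_mul (c : ℝ) (φ : M → ℝ) (N : ℕ) (s : S) (y : M) :
    walkMean P f (fun y => c * φ y) N s y = c * walkMean P f φ N s y := by
  induction N generalizing s y with
  | zero => rfl
  | succ N ih =>
    simp only [walkMean, ih, mul_sum]; exact sum_congr rfl fun t _ => by ring

/-- The conditional mean of `g (X 1) + ⋯ + g (X N)` given the initial state. -/
def sumMean (P : S → S → ℝ) (g : S → ℝ) : ℕ → S → ℝ
  | 0 => fun _ => 0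
  | N + 1 => act P (fun s => g s + sumMean P g N s)

/-- The conditional second moment of `g (X 1) + ⋯ + g (X N)` given the initial state. -/
def sumSqMean (P : S → S → ℝ) (g : S → ℝ) : ℕ → S → ℝ
  | 0 => fun _ => 0
  | N + 1 => act P (fun s => g s ^ 2 + 2 * (g s * sumMean P g N s) + sumSqMean P g N s)

/-- The deviation splits into the deterministic part `ℓ y + N q - K` and a random sum of values of
`g`. The first two conditional moments of that sum then determine the expectation, by conditioning
on the first step. -/
lemma walkMean_sq (h : IsLazyReversible P p) (ℓ : M → ℝ) (g : S → ℝ) (q : ℝ)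
    (hℓ : ∀ y s, ℓ (y + f s) = ℓ y + q + g s) (K : ℝ) (N : ℕ) (s : S) (y : M) :
    walkMean P f (fun y => (ℓ y - K) ^ 2) N s y =
      (ℓ y + N * q - K) ^ 2 + 2 * (ℓ y + N * q - K) * sumMean P g N s + sumSqMean P g N s := by
  induction N generalizing s y with
  | zero => simp [walkMean, sumMean, sumSqMean]
  | succ N ih =>
    simp only [walkMean, ih, hℓ, sumMean, sumSqMean, act]
    set a := ℓ y + ((N + 1 : ℕ) : ℝ) * q - K with ha
    have : ∀ t, ℓ y + q + g t + N * q - K = a + g t := fun t => by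
      rw [ha]; push_cast; ring
    simp only [this]
    have h1 : a ^ 2 = ∑ t, P s t * a ^ 2 := by rw [← sum_mul, h.row_sum, one_mul]
    rw [h1, mul_sum, ← sum_add_distrib, ← sum_add_distrib]
    exact sum_congr rfl fun t _ => by ring

lemma mean_sumMean (h : IsLazyReversible P p) {g : S → ℝ} (hg : mean p g = 0) (N : ℕ) :
    mean p (sumMean P g N) = 0 := by
  induction N with
  | zero => exact mean_const h 0
  | succ N ih => rw [sumMean, mean_act h, mean_add, hg, ih, add_zero]

/-- Each step contracts by `1 - γ`, and Young's inequality with weights `2 / γ` and `γ / 2` absorbs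
the cross term while losing only half of that contraction. The bound is therefore uniform in `N`. -/
lemma mean_sumMean_sq_le (h : IsLazyReversible P p) (hγ : HasGap P p γ) (h0 : 0 < γ) (h1 : γ ≤ 1)
    {g : S → ℝ} (hg : mean p g = 0) (N : ℕ) :
    mean p (fun s => sumMean P g N s ^ 2) ≤ 4 / γ ^ 2 * mean p (fun s => g s ^ 2) := by
  have hG : 0 ≤ mean p (fun s => g s ^ 2) := mean_nonneg h fun s => sq_nonneg _
  induction N with
  | zero =>
    simp only [sumMean]
    rw [mean_const h]; simp only [ne_eq, OfNat.ofNat_ne_zero, not_false_eq_true, zero_pow]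
    positivity
  | succ N ih =>
    set G := mean p (fun s => g s ^ 2)
    set A := mean p (fun s => sumMean P g N s ^ 2) with hA
    have h2 : mean p (fun s => (g s + sumMean P g N s) ^ 2) ≤
        (1 + 2 / γ) * G + (1 + γ / 2) * A := by
      rw [← mean_const_mul, ← mean_const_mul, ← mean_add]
      refine mean_mono h fun s => ?_
      set a := g s
      set b := sumMean P g N s
      have : (1 + 2 / γ) * a ^ 2 + (1 + γ / 2) * b ^ 2 - (a + b) ^ 2 =
          (2 / γ) * (a - γ / 2 * b) ^ 2 := by field_simp; ring
      have : 0 ≤ (2 / γ) * (a - γ / 2 * b) ^ 2 := by positivity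
      linarith
    have h3 := mean_act_sq_le h hγ (f := fun s => g s + sumMean P g N s)
      (by rw [mean_add, hg, mean_sumMean h hg, add_zero])
    calc _ ≤ _ := h3
      _ ≤ (1 - γ) * ((1 + 2 / γ) * G + (1 + γ / 2) * A) :=
          mul_le_mul_of_nonneg_left h2 (by linarith)
      _ ≤ (1 - γ) * ((1 + 2 / γ) * G + (1 + γ / 2) * (4 / γ ^ 2 * G)) := by
          have : 0 ≤ 1 - γ := by linarith
          gcongr
      -- The constant `4 / γ ^ 2` reproduces itself, with slack `(3 + γ) G`.
      _ = 4 / γ ^ 2 * G - (3 + γ) * G := by field_simp; ring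
      _ ≤ _ := by nlinarith

/-- In equilibrium a further step adds `G` and twice a covariance with the remaining sum. Young's
inequality and the previous bound make the covariance term at most `4 G / γ`, and `G ≤ G / γ`,
whence `5 / γ`. -/
lemma mean_sumSqMean_le (h : IsLazyReversible P p) (hγ : HasGap P p γ) (h0 : 0 < γ) (h1 : γ ≤ 1)
    {g : S → ℝ} (hg : mean p g = 0) (N : ℕ) :
    mean p (sumSqMean P g N) ≤ N * (5 / γ * mean p (fun s => g s ^ 2)) := by
  have hG : 0 ≤ mean p (fun s => g s ^ 2) := mean_nonneg h fun s => sq_nonneg _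
  induction N with
  | zero => simp only [sumSqMean, mean_const h]; simp
  | succ N ih =>
    rw [sumSqMean, mean_act h, mean_add, mean_add]
    have hA := mean_sumMean_sq_le h hγ h0 h1 hg N
    have h2 : mean p (fun s => 2 * (g s * sumMean P g N s)) ≤
        2 / γ * mean p (fun s => g s ^ 2) + γ / 2 * mean p (fun s => sumMean P g N s ^ 2) := by
      rw [← mean_const_mul, ← mean_const_mul, ← mean_add]
      refine mean_mono h fun s => ?_
      set a := g s
      set b := sumMean P g N s
      have : 2 / γ * a ^ 2 + γ / 2 * b ^ 2 - 2 * (a * b) = (2 / γ) * (a - γ / 2 * b) ^ 2 := by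
        field_simp; ring
      have : 0 ≤ (2 / γ) * (a - γ / 2 * b) ^ 2 := by positivity
      linarith
    set G := mean p (fun s => g s ^ 2)
    have h3 : γ / 2 * (4 / γ ^ 2 * G) = 2 / γ * G := by field_simp; ring
    have h4 := mul_le_mul_of_nonneg_left hA (by positivity : (0 : ℝ) ≤ γ / 2)
    have h5 : G ≤ 1 / γ * G := le_mul_of_one_le_left hG (by rw [le_div_iff₀ h0]; linarith)
    have h6 : 5 / γ * G = 2 / γ * G + 2 / γ * G + 1 / γ * G := by ring
    push_cast
    linarith

/-- Chebyshev's inequality for additive functionals of the stationary chain. -/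
lemma mean_walkMean_ite_le (h : IsLazyReversible P p) (hγ : HasGap P p γ) (h0 : 0 < γ) (h1 : γ ≤ 1)
    (ℓ : M → ℝ) (F : S → ℝ) (hℓ : ∀ y s, ℓ (y + f s) = ℓ y + F s) (y : M) (hy : ℓ y = 0) (N : ℕ)
    {r : ℝ} (hr : 0 < r) :
    mean p (fun s => walkMean P f (fun y => if |ℓ y - N * mean p F| ≤ r then 0 else 1) N s y) ≤
      N * (5 / γ * mean p (fun s => F s ^ 2)) / r ^ 2 := by
  set q := mean p F with hq
  set g : S → ℝ := fun s => F s - q with hg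
  have hg0 : mean p g = 0 := by
    simp only [hg, sub_eq_add_neg]
    rw [mean_add, mean_const h]; ring
  have hgF : mean p (fun s => g s ^ 2) ≤ mean p (fun s => F s ^ 2) := by
    have : mean p (fun s => F s ^ 2) = mean p (fun s => g s ^ 2) + (2 * q * mean p g + q ^ 2) := by
      rw [← mean_const h (q ^ 2), ← mean_const_mul, ← mean_add, ← mean_add]
      congr 1; funext s; simp only [hg]; ring
    rw [this, hg0]; nlinarith [sq_nonneg q]
  have hsq := walkMean_sq h (f := f) ℓ g q (fun y s => by rw [hℓ]; simp [hg]) (N * q) N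
  have hle : ∀ s, walkMean P f (fun y => if |ℓ y - N * q| ≤ r then (0 : ℝ) else 1) N s y ≤
      (r ^ 2)⁻¹ * sumSqMean P g N s := by
    intro s
    have : sumSqMean P g N s = walkMean P f (fun y => (ℓ y - N * q) ^ 2) N s y := by
      rw [hsq, hy]; ring
    rw [this, ← walkMean_const_mul]
    refine walkMean_mono h (fun z => ?_) N s y
    split_ifs with hz
    · positivity
    · rw [inv_mul_eq_div, le_div_iff₀ (by positivity), one_mul, sq_le_sq, abs_of_pos hr]
      exact (not_le.mp hz).le
  calc _ ≤ mean p (fun s => (r ^ 2)⁻¹ * sumSqMean P g N s) := mean_mono h hle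
    _ = (r ^ 2)⁻¹ * mean p (sumSqMean P g N) := mean_const_mul _ _
    _ ≤ (r ^ 2)⁻¹ * (N * (5 / γ * mean p (fun s => g s ^ 2))) := by
        gcongr; exact mean_sumSqMean_le h hγ h0 h1 hg0 N
    _ ≤ (r ^ 2)⁻¹ * (N * (5 / γ * mean p (fun s => F s ^ 2))) := by gcongr
    _ = _ := by rw [inv_mul_eq_div]

end Walk

end Markov

/-! ### Boundaries of edge sets, the high-temperature expansion and worm states -/

section Parity

variable {V : Type*} [Fintype V]

lemma mem_oddVertices {A : Finset (Sym2 V)} {v : V} :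
    v ∈ oddVertices A ↔ Odd #(univ.filter fun u => s(u, v) ∈ A) := by
  simp [oddVertices]

lemma odd_card_symmDiff {α : Type*} (s t : Finset α) :
    Odd #(s ∆ t) ↔ (Odd #s ↔ ¬ Odd #t) := by
  have h1 : #(s ∆ t) = #(s \ t) + #(t \ s) := by
    rw [symmDiff_def, sup_eq_union, card_union_of_disjoint disjoint_sdiff_sdiff]
  have h2 := card_sdiff_add_card_inter s t
  have h3 := card_sdiff_add_card_inter t s
  rw [inter_comm] at h3
  simp only [Nat.odd_iff]
  omega

/-- Degrees add modulo two, so the boundary map is linear over the field with two elements. -/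
lemma oddVertices_symmDiff (A B : Finset (Sym2 V)) :
    oddVertices (A ∆ B) = oddVertices A ∆ oddVertices B := by
  ext v
  have h : (univ.filter fun u => s(u, v) ∈ A ∆ B) =
      (univ.filter fun u => s(u, v) ∈ A) ∆ (univ.filter fun u => s(u, v) ∈ B) := by
    ext u; simp [mem_symmDiff]
  rw [mem_oddVertices, h, odd_card_symmDiff, mem_symmDiff, mem_oddVertices, mem_oddVertices]
  tauto

lemma oddVertices_empty : oddVertices (∅ : Finset (Sym2 V)) = ∅ := by
  ext v; simp [oddVertices]

lemma oddVertices_singleton {u v : V} (h : u ≠ v) : oddVertices {s(u, v)} = {u, v} := by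
  ext w
  rw [mem_oddVertices]
  by_cases hu : w = u
  · subst hu
    have : (univ.filter fun z => s(z, w) ∈ ({s(w, v)} : Finset (Sym2 V))) = {v} := by
      ext z; simp only [mem_filter, mem_univ, true_and, mem_singleton, Sym2.eq_iff]; tauto
    rw [this]; simp
  · by_cases hv : w = v
    · subst hv
      have : (univ.filter fun z => s(z, w) ∈ ({s(u, w)} : Finset (Sym2 V))) = {u} := by
        ext z; simp only [mem_filter, mem_univ, true_and, mem_singleton, Sym2.eq_iff]; tauto
      rw [this]; simp
    · have : (univ.filter fun z => s(z, w) ∈ ({s(u, v)} : Finset (Sym2 V))) = ∅ := by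
        ext z; simp only [mem_filter, mem_univ, true_and, mem_singleton, Sym2.eq_iff]
        simp; tauto
      rw [this]; simp [hu, hv]

lemma oddVertices_toggle (A : Finset (Sym2 V)) {u v : V} (h : u ≠ v) :
    oddVertices (A ∆ {s(u, v)}) = oddVertices A ∆ {u, v} := by
  rw [oddVertices_symmDiff, oddVertices_singleton h]

/-! ## Products of spins -/

lemma spin_sq {V : Type*} (σ : V → ℤˣ) (v : V) : spin σ v * spin σ v = 1 := by
  rcases Int.units_eq_one_or (σ v) with h | h <;> simp [spin, h]

lemma prod_spin_symmDiff (σ : V → ℤˣ) (S T : Finset V) :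
    ∏ v ∈ S ∆ T, spin σ v = (∏ v ∈ S, spin σ v) * ∏ v ∈ T, spin σ v := by
  have h : ∀ U : Finset V, ∏ v ∈ U, spin σ v = ∏ v, if v ∈ U then spin σ v else 1 := by
    intro U; rw [prod_ite_mem, univ_inter]
  rw [h, h, h, ← prod_mul_distrib]
  refine prod_congr rfl fun v _ => ?_
  by_cases h1 : v ∈ S <;> by_cases h2 : v ∈ T <;> simp [mem_symmDiff, h1, h2, spin_sq]

/-- Each spin occurs as often as its degree in `A`, and squares of spins are one. -/
lemma prod_edge_eq_prod_oddVertices (G : SimpleGraph V) (σ : V → ℤˣ) {A : Finset (Sym2 V)}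
    (hA : A ⊆ G.edgeFinset) :
    ∏ e ∈ A, (e.map (spin σ)).mul = ∏ v ∈ oddVertices A, spin σ v := by
  induction A using Finset.induction_on with
  | empty => simp [oddVertices_empty]
  | insert e A he ih =>
    have hins : insert e A = A ∆ {e} := by
      ext z; simp only [mem_insert, mem_symmDiff, mem_singleton]
      by_cases hz : z = e
      · subst hz; simp [he]
      · simp [hz]
    have heE : e ∈ G.edgeFinset := hA (mem_insert_self _ _)
    rw [prod_insert he, ih ((subset_insert _ _).trans hA), hins]
    induction e using Sym2.ind with
    | _ u v =>
      have huv : u ≠ v := G.ne_of_adj (by simpa using heE)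
      rw [oddVertices_toggle A huv, prod_spin_symmDiff, prod_pair huv, mul_comm]
      simp [Sym2.map_mk, Sym2.mul]

/-- The sum factorises over the vertices, and a vertex of `S` contributes `1 + (-1) = 0`. -/
lemma sum_prod_spin (S : Finset V) :
    ∑ σ : V → ℤˣ, ∏ v ∈ S, spin σ v = if S = ∅ then 2 ^ Fintype.card V else 0 := by
  have h : ∀ σ : V → ℤˣ, ∏ v ∈ S, spin σ v = ∏ v, if v ∈ S then ((σ v : ℤ) : ℝ) else 1 := by
    intro σ; rw [prod_ite_mem, univ_inter]; rfl
  simp only [h]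
  have := (Finset.prod_univ_sum (fun _ : V => (univ : Finset ℤˣ))
    (fun v s => if v ∈ S then ((s : ℤ) : ℝ) else 1)).symm
  rw [Fintype.piFinset_univ] at this
  rw [this]
  split_ifs with hS
  · subst hS; simp
  · obtain ⟨v, hv⟩ := nonempty_iff_ne_empty.mpr hS
    refine prod_eq_zero (mem_univ v) ?_
    simp [hv, UnitsInt.univ]

/-- The sum of `x ^ #A` over the sets of edges `A` with set of odd vertices `S`. -/
def paritySum (G : SimpleGraph V) (x : ℝ) (S : Finset V) : ℝ :=
  ∑ A ∈ G.edgeFinset.powerset.filter (fun A => oddVertices A = S), x ^ #A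

/-- A product of two spins is `±1`, and `exp (±β) = cosh β ± sinh β`. -/
lemma exp_mul_edge {V : Type*} (β : ℝ) (σ : V → ℤˣ) (e : Sym2 V) :
    Real.exp (β * (e.map (spin σ)).mul) =
      Real.cosh β * (1 + Real.tanh β * (e.map (spin σ)).mul) := by
  induction e using Sym2.ind with
  | _ u v =>
    have hc : Real.cosh β ≠ 0 := (Real.cosh_pos β).ne'
    have h : (Sym2.map (spin σ) s(u, v)).mul = 1 ∨ (Sym2.map (spin σ) s(u, v)).mul = -1 := by
      rcases Int.units_eq_one_or (σ u) with hu | hu <;>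
        rcases Int.units_eq_one_or (σ v) with hv | hv <;>
          simp [Sym2.map_mk, Sym2.mul, spin, hu, hv]
    rcases h with h | h <;> rw [h, Real.tanh_eq_sinh_div_cosh] <;> field_simp
    · rw [Real.cosh_add_sinh]
    · rw [← Real.cosh_sub_sinh]; ring

/-- The high-temperature expansion. -/
lemma sum_prod_spin_mul_isingWeight (G : SimpleGraph V) (β : ℝ) (S : Finset V) :
    ∑ σ : V → ℤˣ, (∏ v ∈ S, spin σ v) * isingWeight G β σ =
      Real.cosh β ^ #G.edgeFinset * 2 ^ Fintype.card V * paritySum G (Real.tanh β) S := by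
  set x := Real.tanh β
  have hw : ∀ σ : V → ℤˣ, isingWeight G β σ = Real.cosh β ^ #G.edgeFinset *
      ∑ A ∈ G.edgeFinset.powerset, x ^ #A * ∏ v ∈ oddVertices A, spin σ v := by
    intro σ
    rw [isingWeight, mul_sum, Real.exp_sum]
    simp only [exp_mul_edge, prod_mul_distrib, prod_const]
    -- Expanding the product over edges: a subset `A` records the edges where the factor `x σ_i σ_j`
    -- is taken.
    rw [prod_one_add]
    congr 1
    refine sum_congr rfl fun A hA => ?_
    rw [prod_mul_distrib, prod_const, prod_edge_eq_prod_oddVertices G σ (mem_powerset.mp hA)]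
  calc ∑ σ : V → ℤˣ, (∏ v ∈ S, spin σ v) * isingWeight G β σ
      = Real.cosh β ^ #G.edgeFinset * ∑ A ∈ G.edgeFinset.powerset,
          x ^ #A * ∑ σ : V → ℤˣ, ∏ v ∈ S ∆ oddVertices A, spin σ v := by
        simp only [hw, mul_sum]
        rw [sum_comm]
        refine sum_congr rfl fun A _ => sum_congr rfl fun σ _ => ?_
        rw [prod_spin_symmDiff]; ring
    _ = _ := by
        rw [mul_assoc, paritySum, sum_filter]
        congr 1
        rw [mul_sum]
        refine sum_congr rfl fun A _ => ?_
        rw [sum_prod_spin]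
        have : S ∆ oddVertices A = ∅ ↔ oddVertices A = S := by
          rw [← bot_eq_empty, symmDiff_eq_bot, eq_comm]
        simp only [this, mul_ite, mul_zero]
        split_ifs <;> ring

lemma isingWeight_pos (G : SimpleGraph V) (β : ℝ) (σ : V → ℤˣ) : 0 < isingWeight G β σ :=
  Real.exp_pos _

lemma abs_prod_spin {V : Type*} (σ : V → ℤˣ) (S : Finset V) : |∏ v ∈ S, spin σ v| = 1 := by
  rw [abs_prod]
  refine prod_eq_one fun v _ => ?_
  rcases Int.units_eq_one_or (σ v) with h | h <;> simp [spin, h]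

/-- This is not visible on edge sets. On the spin side it only says that a product of spins is at
most one while the Boltzmann weights are positive. -/
lemma paritySum_le (G : SimpleGraph V) (β : ℝ) (S : Finset V) :
    paritySum G (Real.tanh β) S ≤ paritySum G (Real.tanh β) ∅ := by
  have h1 := sum_prod_spin_mul_isingWeight G β S
  have h2 := sum_prod_spin_mul_isingWeight G β ∅
  have h3 : ∑ σ : V → ℤˣ, (∏ v ∈ S, spin σ v) * isingWeight G β σ ≤
      ∑ σ : V → ℤˣ, (∏ v ∈ (∅ : Finset V), spin σ v) * isingWeight G β σ := by
    refine sum_le_sum fun σ _ => mul_le_mul_of_nonneg_right ?_ (isingWeight_pos G β σ).le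
    rw [prod_empty]
    exact (le_abs_self _).trans_eq (abs_prod_spin σ S)
  rw [h1, h2] at h3
  exact le_of_mul_le_mul_left h3 (by have := Real.cosh_pos β; positivity)

lemma paritySum_empty_pos (G : SimpleGraph V) {x : ℝ} (hx : 0 < x) : 0 < paritySum G x ∅ :=
  sum_pos (fun A _ => pow_pos hx _) ⟨∅, by simp [oddVertices_empty]⟩

lemma correlation_eq (G : SimpleGraph V) (β : ℝ) {u v : V} (h : u ≠ v) :
    correlation G β u v = paritySum G (Real.tanh β) {u, v} / paritySum G (Real.tanh β) ∅ := by
  have h1 := sum_prod_spin_mul_isingWeight G β {u, v}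
  have h2 := sum_prod_spin_mul_isingWeight G β ∅
  simp only [prod_pair h, prod_empty, one_mul] at h1 h2
  rw [correlation, isingZ, h1, h2]
  have := Real.cosh_pos β
  rw [mul_div_mul_left]; positivity

lemma correlation_self (G : SimpleGraph V) (β : ℝ) (u : V) : correlation G β u u = 1 := by
  simp only [correlation, isingZ, spin_sq, one_mul]
  exact div_self (sum_pos (fun σ _ => isingWeight_pos G β σ) univ_nonempty).ne'

/-- `A ↦ A ∆ R` is an involution on sets of edges that shifts the boundary by that of `R`. -/
lemma sum_symmDiff_eq_paritySum (G : SimpleGraph V) (x : ℝ) (S : Finset V) {R : Finset (Sym2 V)}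
    (hR : R ⊆ G.edgeFinset) :
    ∑ A ∈ G.edgeFinset.powerset.filter (fun A => oddVertices A = S), x ^ #(A ∆ R) =
      paritySum G x (S ∆ oddVertices R) := by
  have hsub : ∀ A ⊆ G.edgeFinset, A ∆ R ⊆ G.edgeFinset := fun A hA =>
    symmDiff_le_sup.trans (union_subset hA hR)
  refine sum_nbij' (· ∆ R) (· ∆ R) ?_ ?_ ?_ ?_ ?_
  · intro A hA
    simp only [mem_filter, mem_powerset] at hA ⊢
    exact ⟨hsub A hA.1, by rw [oddVertices_symmDiff, hA.2]⟩
  · intro A hA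
    simp only [mem_filter, mem_powerset] at hA ⊢
    exact ⟨hsub A hA.1, by rw [oddVertices_symmDiff, hA.2, symmDiff_symmDiff_cancel_right]⟩
  · intro A _; exact symmDiff_symmDiff_cancel_right _ _
  · intro A _; exact symmDiff_symmDiff_cancel_right _ _
  · intro A _; rfl

/-- The set consists of the edges traversed an odd number of times. Writing the boundary as `{u} ∆
{v}` covers closed walks as well. -/
lemma exists_edges_of_walk (G : SimpleGraph V) {u v : V} (p : G.Walk u v) :
    ∃ R ⊆ G.edgeFinset, #R ≤ p.length ∧ oddVertices R = {u} ∆ {v} := by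
  induction p with
  | nil => exact ⟨∅, empty_subset _, by simp, by simp [oddVertices_empty]⟩
  | @cons u w v h p ih =>
    obtain ⟨R, hR, hc, ho⟩ := ih
    refine ⟨R ∆ {s(u, w)}, symmDiff_le_sup.trans (union_subset hR (by simpa using h)), ?_, ?_⟩
    · refine (card_le_card symmDiff_le_sup).trans ((card_union_le _ _).trans ?_)
      simpa using hc
    · have huw := G.ne_of_adj h
      have : ({u, w} : Finset V) = {u} ∆ {w} := by
        ext z; simp only [mem_insert, mem_singleton, mem_symmDiff]
        constructor
        · rintro (rfl | rfl)
          · exact Or.inl ⟨rfl, huw⟩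
          · exact Or.inr ⟨rfl, huw.symm⟩
        · tauto
      rw [oddVertices_toggle _ huw, ho, this, symmDiff_comm, symmDiff_assoc, symmDiff_symmDiff_cancel_left]

/-- The correlation of two vertices is at least `x ^ k` if their distance is at most `k`. -/
lemma pow_mul_paritySum_le (G : SimpleGraph V) (hG : G.Connected) {x : ℝ} (hx0 : 0 < x)
    (hx1 : x ≤ 1) {u v : V} (huv : u ≠ v) {k : ℕ} (hk : G.dist u v ≤ k) :
    x ^ k * paritySum G x ∅ ≤ paritySum G x {u, v} := by
  obtain ⟨p, hp⟩ := hG.exists_walk_length_eq_dist u v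
  obtain ⟨R, hR, hc, ho⟩ := exists_edges_of_walk G p
  have hS : ({u, v} : Finset V) = ∅ ∆ oddVertices R := by
    rw [ho, ← bot_eq_empty, bot_symmDiff]
    ext z; simp only [mem_insert, mem_singleton, mem_symmDiff]
    constructor
    · rintro (rfl | rfl)
      · exact Or.inl ⟨rfl, huv⟩
      · exact Or.inr ⟨rfl, huv.symm⟩
    · tauto
  -- Shifting by the edges of a geodesic carries even sets to sets with boundary `{u, v}` and adds
  -- at most `k` edges to each.
  rw [hS, ← sum_symmDiff_eq_paritySum G x ∅ hR, paritySum, mul_sum]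
  refine sum_le_sum fun A _ => ?_
  rw [← pow_add]
  refine pow_le_pow_of_le_one hx0.le hx1 ?_
  refine (card_le_card symmDiff_le_sup).trans ((card_union_le _ _).trans ?_)
  omega

/-! ## The weights of the worm states -/

/-- The condition on the odd vertices of a worm state. -/
def IsWorm (A : Finset (Sym2 V)) : Prop := oddVertices A = ∅ ∨ #(oddVertices A) = 2

/-- The worm states, as a finite set of sets of edges. -/
def wormStates (G : SimpleGraph V) : Finset (Finset (Sym2 V)) :=
  G.edgeFinset.powerset.filter IsWorm

/-- The weight `n` or `2` of a worm state that depends on its odd vertices. -/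
def defectWeight (A : Finset (Sym2 V)) : ℝ :=
  if oddVertices A = ∅ then (Fintype.card V : ℝ) else 2

/-- The unnormalised stationary weights of the worm chain. -/
def wormWeight (x : ℝ) (A : Finset (Sym2 V)) : ℝ := defectWeight A * x ^ #A

lemma mem_wormStates {G : SimpleGraph V} {A : Finset (Sym2 V)} :
    A ∈ wormStates G ↔ A ⊆ G.edgeFinset ∧ IsWorm A := by
  simp [wormStates]

lemma toggle_subset {G : SimpleGraph V} {A : Finset (Sym2 V)} {e : Sym2 V}
    (hA : A ⊆ G.edgeFinset) (he : e ∈ G.edgeFinset) : A ∆ {e} ⊆ G.edgeFinset :=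
  symmDiff_le_sup.trans (union_subset hA (by simpa using he))

lemma defectWeight_pos [Nonempty V] (A : Finset (Sym2 V)) : 0 < defectWeight A := by
  unfold defectWeight
  split_ifs
  · exact_mod_cast Fintype.card_pos
  · norm_num

/-- For each fixed boundary the shifted sum is some `Z_S`, at most `Z_∅`. The empty boundary has
weight `n` and each of the `n (n - 1) / 2` pairs has weight `2`, in total `n²`. With `R = ∅` this
bounds the normalising constant, and with `R` a transition of a canonical path it bounds the
congestion. -/
lemma sum_defectWeight_mul_le (G : SimpleGraph V) (β : ℝ) {R : Finset (Sym2 V)}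
    (hR : R ⊆ G.edgeFinset) :
    ∑ D ∈ wormStates G, defectWeight D * Real.tanh β ^ #(D ∆ R) ≤
      (Fintype.card V : ℝ) ^ 2 * paritySum G (Real.tanh β) ∅ := by
  set x := Real.tanh β
  set n := Fintype.card V with hn
  have hbound : ∀ S : Finset V,
      ∑ A ∈ G.edgeFinset.powerset.filter (fun A => oddVertices A = S), x ^ #(A ∆ R) ≤
        paritySum G x ∅ := fun S => by
    rw [sum_symmDiff_eq_paritySum G x S hR]; exact paritySum_le G β _
  have hsplit : wormStates G = G.edgeFinset.powerset.filter (fun A => oddVertices A = ∅) ∪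
      (powersetCard 2 (univ : Finset V)).biUnion
        (fun S => G.edgeFinset.powerset.filter (fun A => oddVertices A = S)) := by
    ext A
    simp only [wormStates, IsWorm, mem_filter, mem_union, mem_biUnion, mem_powersetCard,
      subset_univ, true_and]
    constructor
    · rintro ⟨h, h1 | h1⟩
      · exact Or.inl ⟨h, h1⟩
      · exact Or.inr ⟨_, h1, h, rfl⟩
    · rintro (⟨h, h1⟩ | ⟨S, hS, h, rfl⟩)
      · exact ⟨h, Or.inl h1⟩
      · exact ⟨h, Or.inr hS⟩
  rw [hsplit, sum_union, sum_biUnion]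
  · have h0 : ∑ A ∈ G.edgeFinset.powerset.filter (fun A => oddVertices A = ∅),
        defectWeight A * x ^ #(A ∆ R) ≤ n * paritySum G x ∅ := by
      calc _ = ∑ A ∈ G.edgeFinset.powerset.filter (fun A => oddVertices A = ∅),
            (n : ℝ) * x ^ #(A ∆ R) := by
            refine sum_congr rfl fun A hA => ?_
            rw [defectWeight, if_pos (mem_filter.mp hA).2]
        _ ≤ _ := by rw [← mul_sum]; gcongr; exact hbound ∅
    have h2 : ∀ S ∈ powersetCard 2 (univ : Finset V),
        ∑ A ∈ G.edgeFinset.powerset.filter (fun A => oddVertices A = S),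
          defectWeight A * x ^ #(A ∆ R) ≤ 2 * paritySum G x ∅ := by
      intro S hS
      have hS2 := (mem_powersetCard.mp hS).2
      calc _ = ∑ A ∈ G.edgeFinset.powerset.filter (fun A => oddVertices A = S),
            (2 : ℝ) * x ^ #(A ∆ R) := by
            refine sum_congr rfl fun A hA => ?_
            rw [defectWeight, if_neg]
            rw [(mem_filter.mp hA).2]
            rintro rfl; simp at hS2
        _ ≤ _ := by rw [← mul_sum]; gcongr; exact hbound S
    have h3 := sum_le_card_nsmul _ _ _ h2
    rw [card_powersetCard, card_univ, ← hn, nsmul_eq_mul, Nat.cast_choose_two] at h3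
    calc _ ≤ n * paritySum G x ∅ + (n : ℝ) * (n - 1) / 2 * (2 * paritySum G x ∅) := add_le_add h0 h3
      _ = _ := by ring
  · intro S _ T _ hST
    refine disjoint_left.mpr fun A hA hA' => hST ?_
    rw [← (mem_filter.mp hA).2, (mem_filter.mp hA').2]
  · rw [disjoint_biUnion_right]
    intro S hS
    have hS2 := (mem_powersetCard.mp hS).2
    refine disjoint_left.mpr fun A hA hA' => ?_
    rw [← (mem_filter.mp hA').2, (mem_filter.mp hA).2] at hS2
    simp at hS2

/-- A worm state can be emptied by removing its edges one at a time within the worm states. -/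
lemma exists_dismantling (G : SimpleGraph V) (D : Finset (Sym2 V)) (hD : D ∈ wormStates G) :
    ∃ rem : Sym2 V → Finset (Sym2 V),
      (∀ e ∈ D, e ∈ rem e ∧ rem e ⊆ D ∧ IsWorm (rem e) ∧ IsWorm (rem e ∆ {e})) ∧
      ∀ g : Finset (Sym2 V) → ℝ, g D - g ∅ = ∑ e ∈ D, (g (rem e) - g (rem e ∆ {e})) := by
  induction hn : #D generalizing D with
  | zero =>
    rw [card_eq_zero] at hn
    subst hn
    exact ⟨fun _ => ∅, by simp, by simp⟩
  | succ n ih =>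
    rw [mem_wormStates] at hD
    -- From an even set any edge may be removed. Otherwise an odd vertex has an incident edge, and
    -- removing it moves this defect or annihilates it with the other one.
    have key : ∃ e ∈ D, IsWorm (D ∆ {e}) := by
      rcases hD.2 with h | h
      · obtain ⟨e, he⟩ := card_pos.mp (by omega : 0 < #D)
        refine ⟨e, he, ?_⟩
        have heE := hD.1 he
        induction e using Sym2.ind with
        | _ u v =>
          have huv : u ≠ v := G.ne_of_adj (by simpa using heE)
          right
          rw [oddVertices_toggle D huv, h, ← bot_eq_empty, bot_symmDiff, card_pair huv]
      · obtain ⟨a, b, hab, hS⟩ := card_eq_two.mp h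
        have ha : a ∈ oddVertices D := by simp [hS]
        rw [mem_oddVertices] at ha
        obtain ⟨c, hc⟩ := card_pos.mp ha.pos
        have hc : s(c, a) ∈ D := by simpa using hc
        have hca : c ≠ a := G.ne_of_adj (by simpa using hD.1 hc)
        refine ⟨s(c, a), hc, ?_⟩
        unfold IsWorm
        rw [oddVertices_toggle D hca, hS]
        by_cases hcb : c = b
        · left; subst hcb; rw [pair_comm, ← bot_eq_empty, symmDiff_self]
        · right
          have : ({a, b} : Finset V) ∆ {c, a} = {b, c} := by
            ext z
            simp only [mem_symmDiff, mem_insert, mem_singleton]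
            constructor
            · tauto
            · rintro (rfl | rfl)
              · left; exact ⟨Or.inr rfl, by tauto⟩
              · right; exact ⟨Or.inl rfl, by tauto⟩
          rw [this, card_pair (Ne.symm hcb)]
    obtain ⟨e, he, hw⟩ := key
    have hDe : D ∆ {e} = D.erase e := by
      ext z; simp only [mem_symmDiff, mem_singleton, mem_erase]
      constructor
      · rintro (⟨h1, h2⟩ | ⟨rfl, h2⟩)
        · exact ⟨h2, h1⟩
        · exact absurd he h2
      · rintro ⟨h1, h2⟩; exact Or.inl ⟨h2, h1⟩
    obtain ⟨rem, hrem, hsum⟩ := ih (D.erase e)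
      (mem_wormStates.mpr ⟨(erase_subset _ _).trans hD.1, hDe ▸ hw⟩)
      (by rw [card_erase_of_mem he]; omega)
    -- `rem z` is what remains just before `z` is removed. The sum over the edges telescopes for
    -- every `g`.
    refine ⟨Function.update rem e D, fun z hz => ?_, fun g => ?_⟩
    · by_cases hze : z = e
      · subst hze
        rw [Function.update_self]
        exact ⟨hz, Subset.rfl, hD.2, hw⟩
      · rw [Function.update_of_ne hze]
        obtain ⟨h1, h2, h3⟩ := hrem z (mem_erase.mpr ⟨hze, hz⟩)
        exact ⟨h1, h2.trans (erase_subset _ _), h3⟩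
    · rw [← add_sum_erase D _ he, Function.update_self, hDe]
      have : ∑ z ∈ D.erase e, (g (Function.update rem e D z) -
          g (Function.update rem e D z ∆ {z})) = g (D.erase e) - g ∅ := by
        rw [hsum g]
        refine sum_congr rfl fun z hz => ?_
        rw [Function.update_of_ne (ne_of_mem_erase hz)]
      rw [this]; ring

end Parity

/-! ### Canonical paths and congestion -/

section Comparison

variable {V : Type*} [Fintype V]

lemma tanh_pos_of_pos {β : ℝ} (hβ : 0 < β) : 0 < Real.tanh β := by
  rw [Real.tanh_eq_sinh_div_cosh]
  exact div_pos (Real.sinh_pos_iff.mpr hβ) (Real.cosh_pos β)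

/-- The left side depends on `X` only through `X \ D`. Changing `X` inside `D` therefore preserves
the combined weight, as happens along a canonical path. -/
lemma card_add_card_symmDiff {α : Type*} [DecidableEq α] (D X : Finset α) :
    #X + #(D ∆ X) = #D + 2 * #(X \ D) := by
  have h1 : #(D ∆ X) = #(D \ X) + #(X \ D) := by
    rw [symmDiff_def, sup_eq_union, card_union_of_disjoint disjoint_sdiff_sdiff]
  have h2 := card_sdiff_add_card_inter D X
  have h3 := card_sdiff_add_card_inter X D
  rw [inter_comm] at h3
  omega

/-- The comparison of the variance with the Dirichlet form by canonical paths. -/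
lemma canonical_paths (G : SimpleGraph V) {β : ℝ} (hβ : 0 < β) (f : Finset (Sym2 V) → ℝ) :
    ∑ I ∈ wormStates G, ∑ F ∈ G.edgeFinset.powerset.filter (fun F => oddVertices F = ∅),
        wormWeight (Real.tanh β) I * Real.tanh β ^ #F * (f I - f F) ^ 2 ≤
      #G.edgeFinset * ((Fintype.card V : ℝ) ^ 2 * paritySum G (Real.tanh β) ∅) *
        ∑ T ∈ wormStates G, ∑ e ∈ G.edgeFinset.filter (fun e => IsWorm (T ∆ {e})),
          Real.tanh β ^ #(T ∪ {e}) * (f T - f (T ∆ {e})) ^ 2 := by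
  set x := Real.tanh β with hx
  have hx0 : 0 < x := tanh_pos_of_pos hβ
  set E := G.edgeFinset with hE
  set C₀ := E.powerset.filter (fun F => oddVertices F = ∅) with hC
  set W := wormStates G with hW
  -- Positivity of the weight `n` needs a vertex. Without vertices there is only one edge set.
  rcases isEmpty_or_nonempty V with hV | hV
  · have : ∀ I : Finset (Sym2 V), ∀ F : Finset (Sym2 V), I = F := fun I F => by
      ext e; induction e using Sym2.ind with | _ u v => exact hV.elim u
    have h0 : ∀ I F, f I - f F = 0 := fun I F => by rw [this I F, sub_self]
    simp only [h0]; simp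
  have hodd : ∀ I F : Finset (Sym2 V), oddVertices F = ∅ → oddVertices (I ∆ F) = oddVertices I := by
    intro I F hF
    rw [oddVertices_symmDiff, hF, ← bot_eq_empty, symmDiff_bot]
  have hsub : ∀ I F : Finset (Sym2 V), I ⊆ E → F ⊆ E → I ∆ F ⊆ E := fun I F hI hF =>
    symmDiff_le_sup.trans (union_subset hI hF)
  have hWF : ∀ I F : Finset (Sym2 V), I ∈ W → F ∈ C₀ → I ∆ F ∈ W := by
    intro I F hI hF
    simp only [hC, mem_filter, mem_powerset] at hF
    rw [mem_wormStates] at hI ⊢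
    refine ⟨hsub I F hI.1 hF.1, ?_⟩
    unfold IsWorm
    rw [hodd I F hF.2]; exact hI.2
  -- The pair `(I, F)` is replaced by `(D, F)` with `D = I ∆ F`. As `F` is even, `D` has the same
  -- boundary, hence the same defect weight, as `I`.
  have hreparam : ∀ F ∈ C₀, ∑ I ∈ W, wormWeight x I * x ^ #F * (f I - f F) ^ 2 =
      ∑ D ∈ W, defectWeight D * x ^ (#F + #(D ∆ F)) * (f (D ∆ F) - f F) ^ 2 := by
    intro F hF
    refine sum_nbij' (· ∆ F) (· ∆ F) (fun I hI => hWF I F hI hF) (fun I hI => hWF I F hI hF)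
      (fun I _ => symmDiff_symmDiff_cancel_right _ _)
      (fun I _ => symmDiff_symmDiff_cancel_right _ _) fun I _ => ?_
    rw [symmDiff_symmDiff_cancel_right, wormWeight, defectWeight, defectWeight,
      hodd I F (mem_filter.mp hF).2, pow_add]
    ring
  rw [sum_comm, sum_congr rfl hreparam, sum_comm]
  have hdis : ∀ D ∈ W, ∃ rem : Sym2 V → Finset (Sym2 V),
      (∀ e ∈ D, e ∈ rem e ∧ rem e ⊆ D ∧ IsWorm (rem e) ∧ IsWorm (rem e ∆ {e})) ∧
      ∀ g : Finset (Sym2 V) → ℝ, g D - g ∅ = ∑ e ∈ D, (g (rem e) - g (rem e ∆ {e})) :=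
    fun D hD => exists_dismantling G D hD
  set H : Finset (Sym2 V) → Finset (Sym2 V) → Sym2 V → ℝ := fun D T e =>
    defectWeight D * x ^ #(D ∆ (T ∪ {e})) * (x ^ #(T ∪ {e}) * (f T - f (T ∆ {e})) ^ 2) with hH
  have hH0 : ∀ D T e, 0 ≤ H D T e := fun D T e => by
    have := (defectWeight_pos D).le
    simp only [hH]; positivity
  have hmain : ∀ D ∈ W,
      ∑ F ∈ C₀, defectWeight D * x ^ (#F + #(D ∆ F)) * (f (D ∆ F) - f F) ^ 2 ≤
      #E * ∑ T ∈ W, ∑ e ∈ E.filter (fun e => IsWorm (T ∆ {e})), H D T e := by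
    intro D hD
    obtain ⟨rem, hrem, hsum⟩ := hdis D hD
    have hDE := (mem_wormStates.mp hD).1
    have hd := (defectWeight_pos D).le
    calc _ ≤ ∑ F ∈ C₀, defectWeight D * x ^ (#F + #(D ∆ F)) *
          (#E * ∑ e ∈ D, (f (rem e ∆ F) - f (rem e ∆ {e} ∆ F)) ^ 2) := by
          refine sum_le_sum fun F _ => mul_le_mul_of_nonneg_left ?_ (by positivity)
          -- Shifted by `F`, the dismantling of `D` becomes a path from `D ∆ F` to `F`.
          -- Cauchy–Schwarz then costs its length, at most the number of edges.
          have h1 := hsum (fun A => f (A ∆ F))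
          simp only [← bot_eq_empty, bot_symmDiff] at h1
          rw [h1]
          refine sq_sum_le_card_mul_sum_sq.trans ?_
          gcongr
      _ = #E * ∑ e ∈ D, ∑ F ∈ C₀, defectWeight D * x ^ (#F + #(D ∆ F)) *
            (f (rem e ∆ F) - f (rem e ∆ {e} ∆ F)) ^ 2 := by
          simp only [mul_sum]
          rw [sum_comm]
          exact sum_congr rfl fun e _ => sum_congr rfl fun F _ => by ring
      _ ≤ #E * ∑ e ∈ D, ∑ T ∈ W.filter (fun T => IsWorm (T ∆ {e})), H D T e := by
          refine mul_le_mul_of_nonneg_left (sum_le_sum fun e he => ?_) (by positivity)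
          obtain ⟨her, hrD, hw1, hw2⟩ := hrem e he
          have hval : ∀ F ∈ C₀, defectWeight D * x ^ (#F + #(D ∆ F)) *
              (f (rem e ∆ F) - f (rem e ∆ {e} ∆ F)) ^ 2 = H D (rem e ∆ F) e := by
            intro F _
            -- `F` and `T ∪ {e}`, with `T = rem e ∆ F`, differ only inside `D`. The weight of the
            -- pair therefore splits into a transition weight and a factor that is summable over
            -- `D`.
            have hcard : #F + #(D ∆ F) =
                #(D ∆ (rem e ∆ F ∪ {e})) + #(rem e ∆ F ∪ {e}) := by
              rw [add_comm #(D ∆ (rem e ∆ F ∪ {e})), card_add_card_symmDiff, card_add_card_symmDiff]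
              congr 3
              ext z
              simp only [mem_sdiff, mem_union, mem_symmDiff, mem_singleton]
              constructor
              · rintro ⟨h1, h2⟩
                exact ⟨Or.inl (Or.inr ⟨h1, fun h => h2 (hrD h)⟩), h2⟩
              · rintro ⟨(⟨h1, -⟩ | ⟨h1, -⟩) | rfl, h2⟩
                · exact absurd (hrD h1) h2
                · exact ⟨h1, h2⟩
                · exact absurd he h2
            simp only [hH]
            rw [hcard, pow_add, symmDiff_right_comm (rem e) {e} F]
            ring
          rw [sum_congr rfl hval]
          -- For fixed `D` and `e`, the state `T` determines `F`, so no transition is counted twice.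
          rw [← sum_image (s := C₀) (g := fun F => rem e ∆ F) (f := fun T => H D T e)
            (fun F _ F' _ h => symmDiff_right_injective _ h)]
          refine sum_le_sum_of_subset_of_nonneg ?_ fun T _ _ => hH0 D T e
          intro T hT
          obtain ⟨F, hF, rfl⟩ := mem_image.mp hT
          have hF' := hF
          simp only [hC, mem_filter, mem_powerset] at hF'
          refine mem_filter.mpr ⟨hWF _ F (mem_wormStates.mpr ⟨hrD.trans hDE, hw1⟩) hF, ?_⟩
          rw [symmDiff_right_comm]
          unfold IsWorm
          rw [hodd _ F hF'.2]; exact hw2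
      _ ≤ #E * ∑ e ∈ E, ∑ T ∈ W.filter (fun T => IsWorm (T ∆ {e})), H D T e := by
          refine mul_le_mul_of_nonneg_left ?_ (by positivity)
          exact sum_le_sum_of_subset_of_nonneg hDE fun e _ _ => sum_nonneg fun T _ => hH0 D T e
      _ = _ := by
          congr 1
          simp only [sum_filter]
          exact sum_comm
  calc _ ≤ ∑ D ∈ W, #E * ∑ T ∈ W, ∑ e ∈ E.filter (fun e => IsWorm (T ∆ {e})), H D T e :=
        sum_le_sum hmain
    _ = #E * ∑ T ∈ W, ∑ e ∈ E.filter (fun e => IsWorm (T ∆ {e})), ∑ D ∈ W, H D T e := by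
        rw [← mul_sum, sum_comm]
        congr 1
        refine sum_congr rfl fun T _ => ?_
        exact sum_comm
    _ ≤ #E * ∑ T ∈ W, ∑ e ∈ E.filter (fun e => IsWorm (T ∆ {e})),
          ((Fintype.card V : ℝ) ^ 2 * paritySum G x ∅) *
            (x ^ #(T ∪ {e}) * (f T - f (T ∆ {e})) ^ 2) := by
        refine mul_le_mul_of_nonneg_left (sum_le_sum fun T hT => sum_le_sum fun e he => ?_)
          (by positivity)
        simp only [hH]
        rw [← sum_mul]
        -- The congestion of a transition: summing over all `D` costs at most `n² Z_∅`.
        refine mul_le_mul_of_nonneg_right (sum_defectWeight_mul_le G β ?_) (by positivity)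
        exact union_subset (mem_wormStates.mp hT).1 (singleton_subset_iff.mpr (mem_filter.mp he).1)
    _ = _ := by simp only [mul_sum]; ring_nf

end Comparison

/-! ### Transition rates as proposals and acceptances -/

section Rates

variable {V : Type*} [Fintype V]

/-- The vertices from which a move may start. -/
def startVertices (A : Finset (Sym2 V)) : Finset V :=
  if oddVertices A = ∅ then univ else oddVertices A

/-- The probability that a proposed move along `vu`, starting at `v`, is accepted. -/
def acceptance (G : SimpleGraph V) (x : ℝ) (A : Finset (Sym2 V)) (v u : V) : ℝ :=
  if oddVertices A = ∅ ∨ oddVertices (A ∆ {s(v, u)}) = ∅ then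
    (if s(v, u) ∈ A then 1 else x)
  else min ((G.degree v : ℝ) / (G.degree u : ℝ) * (if s(v, u) ∈ A then x⁻¹ else x)) 1

/-- The probability of a move along `vu`, starting at `v`. -/
def directedRate (G : SimpleGraph V) (x : ℝ) (A : Finset (Sym2 V)) (v u : V) : ℝ :=
  if v ∈ startVertices A then
    1 / (2 * (#(startVertices A) : ℝ)) * (1 / (G.degree v : ℝ)) * acceptance G x A v u
  else 0

lemma oddVertices_eq_pair {A : Finset (Sym2 V)} {u v : V} (h : u ≠ v)
    (h2 : oddVertices (A ∆ {s(u, v)}) = ∅) : oddVertices A = {u, v} := by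
  rwa [oddVertices_toggle A h, ← bot_eq_empty, symmDiff_eq_bot] at h2

lemma eq_pair_of_mem {V : Type*} {S : Finset V} (hS : #S = 2) {u v : V} (h : u ≠ v) (hu : u ∈ S)
    (hv : v ∈ S) : S = {u, v} :=
  (eq_of_subset_of_card_le (by intro z; simp; rintro (rfl | rfl) <;> assumption)
    (by rw [hS, card_pair h])).symm

/-- An edge can be proposed from either end. If both `A` and its toggle have defects, at most one
end is a legal start, since toggling an edge between the two odd vertices would leave none. -/
lemma edgeRate_eq (G : SimpleGraph V) (x : ℝ) {A : Finset (Sym2 V)} (hA : IsWorm A) {u v : V}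
    (h : u ≠ v) : edgeRate G x A s(u, v) = directedRate G x A u v + directedRate G x A v u := by
  have hT : s(u, v).toFinset = {u, v} := by ext z; simp [Sym2.mem_toFinset]
  have hsw : s(v, u) = s(u, v) := Sym2.eq_swap
  unfold edgeRate directedRate acceptance startVertices
  rw [hsw, hT]
  by_cases h0 : oddVertices A = ∅
  · simp only [h0, if_true, true_or, mem_univ, card_univ, sum_pair h]
    split_ifs <;> ring
  by_cases h1 : oddVertices (A ∆ {s(u, v)}) = ∅
  · have hp := oddVertices_eq_pair h h1
    simp only [h0, if_false, h1, or_true, if_true, sum_pair h]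
    rw [hp, card_pair h]
    simp only [mem_insert, mem_singleton, true_or, or_true, if_true]
    split_ifs <;> push_cast <;> ring
  have h2 : #(oddVertices A) = 2 := hA.resolve_left h0
  have hnot : ¬ (u ∈ oddVertices A ∧ v ∈ oddVertices A) := by
    rintro ⟨hu, hv⟩
    apply h1
    rw [oddVertices_toggle A h, eq_pair_of_mem h2 h hu hv, symmDiff_self]; rfl
  simp only [h0, h1, if_false, or_self]
  rw [h2]
  by_cases hu : u ∈ oddVertices A
  · have hv : v ∉ oddVertices A := fun hv => hnot ⟨hu, hv⟩
    have e1 : ({u, v} : Finset V) ∩ oddVertices A = {u} := by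
      ext z; simp only [mem_inter, mem_insert, mem_singleton]
      constructor
      · rintro ⟨rfl | rfl, hz⟩
        · rfl
        · exact absurd hz hv
      · rintro rfl; exact ⟨Or.inl rfl, hu⟩
    have e2 : ({u, v} : Finset V) \ oddVertices A = {v} := by
      ext z; simp only [mem_sdiff, mem_insert, mem_singleton]
      constructor
      · rintro ⟨rfl | rfl, hz⟩
        · exact absurd hu hz
        · rfl
      · rintro rfl; exact ⟨Or.inr rfl, hv⟩
    rw [e1, e2]
    simp only [sum_singleton, hu, hv, if_true, if_false]
    push_cast; ring
  · by_cases hv : v ∈ oddVertices A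
    · have e1 : ({u, v} : Finset V) ∩ oddVertices A = {v} := by
        ext z; simp only [mem_inter, mem_insert, mem_singleton]
        constructor
        · rintro ⟨rfl | rfl, hz⟩
          · exact absurd hz hu
          · rfl
        · rintro rfl; exact ⟨Or.inr rfl, hv⟩
      have e2 : ({u, v} : Finset V) \ oddVertices A = {u} := by
        ext z; simp only [mem_sdiff, mem_insert, mem_singleton]
        constructor
        · rintro ⟨rfl | rfl, hz⟩
          · rfl
          · exact absurd hv hz
        · rintro rfl; exact ⟨Or.inl rfl, hu⟩
      rw [e1, e2]
      simp only [sum_singleton, hu, hv, if_true, if_false]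
      push_cast; ring
    · have e1 : ({u, v} : Finset V) ∩ oddVertices A = ∅ := by
        ext z; simp only [mem_inter, mem_insert, mem_singleton, notMem_empty, iff_false]
        rintro ⟨rfl | rfl, hz⟩
        · exact hu hz
        · exact hv hz
      rw [e1]
      simp [hu, hv]

/-- A move from an allowed start creates a pair of defects, moves one defect, or annihilates the
pair. -/
lemma isWorm_toggle {A : Finset (Sym2 V)} (hA : IsWorm A) {u v : V} (h : v ≠ u)
    (hv : v ∈ startVertices A) : IsWorm (A ∆ {s(v, u)}) := by
  unfold IsWorm
  rw [oddVertices_toggle A h]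
  by_cases h0 : oddVertices A = ∅
  · right; rw [h0, ← bot_eq_empty, bot_symmDiff, card_pair h]
  · have h2 : #(oddVertices A) = 2 := hA.resolve_left h0
    rw [startVertices, if_neg h0] at hv
    by_cases hu : u ∈ oddVertices A
    · left; rw [eq_pair_of_mem h2 h hv hu, symmDiff_self]; rfl
    · right
      obtain ⟨w, hw⟩ := card_eq_one.mp (by rw [card_erase_of_mem hv, h2] :
        #((oddVertices A).erase v) = 1)
      have hwA : w ∈ (oddVertices A).erase v := by simp [hw]
      have hne := ne_of_mem_erase hwA
      have hwu : w ≠ u := by rintro rfl; exact hu (mem_of_mem_erase hwA)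
      have : oddVertices A ∆ {v, u} = {w, u} := by
        rw [eq_pair_of_mem h2 hne.symm hv (mem_of_mem_erase hwA)]
        ext z
        simp only [mem_symmDiff, mem_insert, mem_singleton]
        constructor
        · tauto
        · rintro (rfl | rfl)
          · left; tauto
          · right; exact ⟨Or.inr rfl, by rintro (h' | h') <;> [exact h h'.symm; exact hwu h'.symm]⟩
      rw [this, card_pair hwu]

lemma acceptance_nonneg (G : SimpleGraph V) {x : ℝ} (hx : 0 ≤ x) (A : Finset (Sym2 V)) (v u : V) :
    0 ≤ acceptance G x A v u := by
  unfold acceptance; split_ifs <;> positivity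

lemma acceptance_le_one (G : SimpleGraph V) {x : ℝ} (hx : x ≤ 1) (A : Finset (Sym2 V)) (v u : V) :
    acceptance G x A v u ≤ 1 := by
  unfold acceptance
  split_ifs
  exacts [le_rfl, hx, min_le_right _ _, min_le_right _ _]

/-- Toggles that leave the state space have rate zero, which is why sums over target states become
sums over all edges. -/
lemma isWorm_of_edgeRate_ne_zero (G : SimpleGraph V) {x : ℝ} {A : Finset (Sym2 V)} (hA : IsWorm A)
    {e : Sym2 V} (he : e ∈ G.edgeFinset) (hr : edgeRate G x A e ≠ 0) : IsWorm (A ∆ {e}) := by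
  induction e using Sym2.ind with
  | _ u v =>
    have huv : u ≠ v := G.ne_of_adj (by simpa using he)
    rw [edgeRate_eq G x hA huv] at hr
    by_cases hu : u ∈ startVertices A
    · exact isWorm_toggle hA huv hu
    · by_cases hv : v ∈ startVertices A
      · rw [Sym2.eq_swap]; exact isWorm_toggle hA huv.symm hv
      · simp [directedRate, hu, hv] at hr

lemma edgeRate_nonneg (G : SimpleGraph V) {x : ℝ} (hx : 0 ≤ x) (A : Finset (Sym2 V))
    (e : Sym2 V) : 0 ≤ edgeRate G x A e := by
  unfold edgeRate
  have h : 0 ≤ ∑ w ∈ e.toFinset, 1 / (G.degree w : ℝ) := sum_nonneg fun _ _ => by positivity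
  split_ifs
  · positivity
  · positivity
  · positivity
  · positivity
  · exact sum_nonneg fun _ _ => sum_nonneg fun _ _ => by positivity
  · exact sum_nonneg fun _ _ => sum_nonneg fun _ _ => by positivity

/-- A sum over ordered pairs of neighbours as a sum over edges. -/
lemma sum_neighbors_eq_sum_edges (G : SimpleGraph V) {R : Type*} [AddCommMonoid R] (h : V → V → R)
    (k : Sym2 V → R) (hk : ∀ u v, G.Adj u v → k s(u, v) = h u v + h v u) :
    ∑ v, ∑ u ∈ G.neighborFinset v, h v u = ∑ e ∈ G.edgeFinset, k e := by
  have h1 : ∑ v, ∑ u ∈ G.neighborFinset v, h v u =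
      ∑ p ∈ (univ : Finset (V × V)).filter (fun p => G.Adj p.1 p.2), h p.1 p.2 := by
    rw [sum_filter, Fintype.sum_prod_type]
    refine sum_congr rfl fun v _ => ?_
    rw [← sum_filter]
    refine sum_congr ?_ fun _ _ => rfl
    ext u; simp
  rw [h1, ← sum_fiberwise_of_maps_to (t := G.edgeFinset) (g := fun p : V × V => s(p.1, p.2))
    (fun p hp => by simpa using hp)]
  refine sum_congr rfl fun e he => ?_
  induction e using Sym2.ind with
  | _ u v =>
    have huv : G.Adj u v := by simpa using he
    have hne := G.ne_of_adj huv
    have : ((univ : Finset (V × V)).filter (fun p => G.Adj p.1 p.2)).filter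
        (fun p => s(p.1, p.2) = s(u, v)) = {(u, v), (v, u)} := by
      ext ⟨a, b⟩
      simp only [mem_filter, mem_univ, true_and, mem_insert, mem_singleton, Prod.mk.injEq,
        Sym2.eq_iff]
      constructor
      · exact fun h => h.2
      · rintro (⟨rfl, rfl⟩ | ⟨rfl, rfl⟩)
        · exact ⟨huv, Or.inl ⟨rfl, rfl⟩⟩
        · exact ⟨huv.symm, Or.inr ⟨rfl, rfl⟩⟩
    rw [this, sum_pair (by simp [hne]), hk u v huv]

lemma sum_edgeRate_mul (G : SimpleGraph V) (x : ℝ) {A : Finset (Sym2 V)} (hA : IsWorm A)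
    (g : Finset (Sym2 V) → ℝ) :
    ∑ e ∈ G.edgeFinset, edgeRate G x A e * g (A ∆ {e}) =
      ∑ v, ∑ u ∈ G.neighborFinset v, directedRate G x A v u * g (A ∆ {s(v, u)}) := by
  symm
  refine sum_neighbors_eq_sum_edges G _ _ fun u v huv => ?_
  rw [edgeRate_eq G x hA (G.ne_of_adj huv), Sym2.eq_swap (a := v)]
  ring

lemma startVertices_nonempty [Nonempty V] (A : Finset (Sym2 V)) : (startVertices A).Nonempty := by
  unfold startVertices
  split_ifs with h
  · exact univ_nonempty
  · exact nonempty_iff_ne_empty.mpr h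

lemma sum_edgeRate_le (G : SimpleGraph V) {x : ℝ} (hx1 : x ≤ 1)
    {A : Finset (Sym2 V)} (hA : IsWorm A) : ∑ e ∈ G.edgeFinset, edgeRate G x A e ≤ 1 / 2 := by
  rcases isEmpty_or_nonempty V with hV | hV
  · have : ∀ F : Finset (Sym2 V), F = ∅ := fun F => by
      ext e; induction e using Sym2.ind with | _ u v => exact hV.elim u
    rw [this G.edgeFinset]; norm_num
  have h := sum_edgeRate_mul G x hA (fun _ => 1)
  simp only [mul_one] at h
  rw [h]
  have hpos : (0 : ℝ) < #(startVertices A) := by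
    exact_mod_cast card_pos.mpr (startVertices_nonempty A)
  calc _ ≤ ∑ v, if v ∈ startVertices A then 1 / (2 * (#(startVertices A) : ℝ)) else 0 := by
        refine sum_le_sum fun v _ => ?_
        unfold directedRate
        split_ifs with hv
        · calc _ ≤ ∑ u ∈ G.neighborFinset v,
                1 / (2 * (#(startVertices A) : ℝ)) * (1 / (G.degree v : ℝ)) := by
                refine sum_le_sum fun u _ => mul_le_of_le_one_right (by positivity)
                  (acceptance_le_one G hx1 A v u)
            _ = 1 / (2 * (#(startVertices A) : ℝ)) * (G.degree v / G.degree v) := by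
                rw [sum_const, nsmul_eq_mul, G.card_neighborFinset_eq_degree]; ring
            -- An isolated start vertex is harmless: its quotient `0 / 0` is zero.
            _ ≤ _ := mul_le_of_le_one_right (by positivity) (div_self_le_one _)
        · simp
    _ = 1 / 2 := by
        rw [sum_ite_mem, univ_inter, sum_const, nsmul_eq_mul]
        field_simp

/-! ## Detailed balance -/

/-- The right side is unchanged when `A` is replaced by `A ∆ {e}`, which is the detailed balance of
creation and annihilation moves. -/
lemma pow_card_mul_ite {V : Type*} {x : ℝ} (A : Finset (Sym2 V)) (e : Sym2 V) :
    x ^ #A * (if e ∈ A then 1 else x) = x ^ #(A ∪ {e}) := by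
  split_ifs with h
  · rw [mul_one, union_eq_left.mpr (by simpa using h)]
  · rw [card_union_of_disjoint (by simpa using h), card_singleton, pow_succ]

lemma pow_card_mul_ite_inv {V : Type*} {x : ℝ} (hx : x ≠ 0) (A : Finset (Sym2 V)) (e : Sym2 V) :
    x ^ #A * (if e ∈ A then x⁻¹ else x) = x ^ #(A ∆ {e}) := by
  split_ifs with h
  · have : A ∆ {e} = A.erase e := by
      ext z; simp only [mem_symmDiff, mem_singleton, mem_erase]
      constructor
      · rintro (⟨h1, h2⟩ | ⟨rfl, h2⟩)
        · exact ⟨h2, h1⟩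
        · exact absurd h h2
      · rintro ⟨h1, h2⟩; exact Or.inl ⟨h2, h1⟩
    rw [this, ← card_erase_add_one h, pow_succ, mul_assoc, mul_inv_cancel₀ hx, mul_one]
  · have : A ∆ {e} = A ∪ {e} := by
      rw [← sup_eq_union, Disjoint.symmDiff_eq_sup (by simpa using h)]
    rw [this, ← pow_card_mul_ite, if_neg h]

/-- The flow through an edge in equilibrium. -/
lemma wormWeight_mul_edgeRate (G : SimpleGraph V) {x : ℝ} (hx : 0 < x) {A : Finset (Sym2 V)}
    (hA : IsWorm A) {u v : V} (huv : G.Adj u v) (hA' : IsWorm (A ∆ {s(u, v)})) :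
    wormWeight x A * edgeRate G x A s(u, v) =
      if oddVertices A = ∅ ∨ oddVertices (A ∆ {s(u, v)}) = ∅ then
        1 / 2 * x ^ #(A ∪ {s(u, v)}) * (1 / (G.degree u : ℝ) + 1 / (G.degree v : ℝ))
      else if u ∈ oddVertices A then
        1 / 2 * min (x ^ #A / (G.degree u : ℝ)) (x ^ #(A ∆ {s(u, v)}) / (G.degree v : ℝ))
      else
        1 / 2 * min (x ^ #A / (G.degree v : ℝ)) (x ^ #(A ∆ {s(u, v)}) / (G.degree u : ℝ)) := by
  have hne := G.ne_of_adj huv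
  have hsw : s(v, u) = s(u, v) := Sym2.eq_swap
  have hdu : (0 : ℝ) < G.degree u := by
    exact_mod_cast (G.degree_pos_iff_exists_adj u).mpr ⟨v, huv⟩
  have hdv : (0 : ℝ) < G.degree v := by
    exact_mod_cast (G.degree_pos_iff_exists_adj v).mpr ⟨u, huv.symm⟩
  have hn : (0 : ℝ) < Fintype.card V := by exact_mod_cast Fintype.card_pos_iff.mpr ⟨u⟩
  rw [edgeRate_eq G x hA hne, ← pow_card_mul_ite, ← pow_card_mul_ite_inv hx.ne']
  unfold wormWeight defectWeight directedRate acceptance startVertices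
  rw [hsw]
  by_cases h0 : oddVertices A = ∅
  · simp only [h0, if_true, true_or, mem_univ, card_univ]
    field_simp
  by_cases h1 : oddVertices (A ∆ {s(u, v)}) = ∅
  · have hp := oddVertices_eq_pair hne h1
    simp only [h0, if_false, h1, or_true, if_true]
    rw [hp, card_pair hne]
    simp only [mem_insert, mem_singleton, true_or, or_true, if_true]
    push_cast; ring
  have h2 : #(oddVertices A) = 2 := hA.resolve_left h0
  have hnot : ¬ (u ∈ oddVertices A ∧ v ∈ oddVertices A) := by
    rintro ⟨hu, hv⟩
    apply h1
    rw [oddVertices_toggle A hne, eq_pair_of_mem h2 hne hu hv, symmDiff_self]; rfl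
  -- With both ends even, toggling would produce four odd vertices.
  have hor : u ∈ oddVertices A ∨ v ∈ oddVertices A := by
    by_contra hcon
    push Not at hcon
    have h3 : #(oddVertices (A ∆ {s(u, v)})) = 2 := hA'.resolve_left h1
    have hdisj : Disjoint (oddVertices A) {u, v} := by
      simp [hcon.1, hcon.2]
    rw [oddVertices_toggle A hne, hdisj.symmDiff_eq_sup, sup_eq_union,
      card_union_of_disjoint hdisj, h2, card_pair hne] at h3
    omega
  simp only [h0, h1, if_false, or_self]
  rw [h2]
  -- The Metropolis identity: multiplying the acceptance by weight and proposal rate makes it a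
  -- minimum of the two opposite flows.
  have key : ∀ a b r : ℝ, 0 < a → 0 < b →
      2 * x ^ #A * (1 / (2 * ((2 : ℕ) : ℝ)) * (1 / a) * min (a / b * r) 1) =
        1 / 2 * min (x ^ #A / a) (x ^ #A * r / b) := by
    intro a b r ha hb
    have hp : 0 ≤ x ^ #A / a := by positivity
    have : min (x ^ #A / a) (x ^ #A * r / b) = x ^ #A / a * min (a / b * r) 1 := by
      rw [mul_min_of_nonneg _ _ hp, min_comm, mul_one]
      congr 1
      field_simp
    rw [this]; push_cast; ring
  by_cases hu : u ∈ oddVertices A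
  · have hv : v ∉ oddVertices A := fun hv => hnot ⟨hu, hv⟩
    simp only [hu, hv, if_true, if_false, add_zero]
    exact key _ _ _ hdu hdv
  · have hv := hor.resolve_left hu
    simp only [hu, hv, if_true, if_false, zero_add]
    exact key _ _ _ hdv hdu

/-- The equilibrium flow is symmetric. For moves of a defect, `u` is odd before the toggle exactly
if it is even after it, so the two arguments of the minimum are exchanged. -/
lemma wormWeight_mul_edgeRate_comm (G : SimpleGraph V) {x : ℝ} (hx : 0 < x) {A : Finset (Sym2 V)}
    (hA : IsWorm A) {e : Sym2 V} (he : e ∈ G.edgeFinset) (hA' : IsWorm (A ∆ {e})) :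
    wormWeight x A * edgeRate G x A e = wormWeight x (A ∆ {e}) * edgeRate G x (A ∆ {e}) e := by
  induction e using Sym2.ind with
  | _ u v =>
    have huv : G.Adj u v := by simpa using he
    have hne := G.ne_of_adj huv
    have hback : A ∆ {s(u, v)} ∆ {s(u, v)} = A := symmDiff_symmDiff_cancel_right _ _
    rw [wormWeight_mul_edgeRate G hx hA huv hA',
      wormWeight_mul_edgeRate G hx hA' huv (by rwa [hback]), hback]
    have hun : A ∆ {s(u, v)} ∪ {s(u, v)} = A ∪ {s(u, v)} := by
      ext z; simp only [mem_union, mem_symmDiff, mem_singleton]; tauto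
    have hmem : u ∈ oddVertices (A ∆ {s(u, v)}) ↔ u ∉ oddVertices A := by
      rw [oddVertices_toggle A hne, mem_symmDiff]; simp
    rw [hun]
    by_cases hc : oddVertices (A ∆ {s(u, v)}) = ∅ ∨ oddVertices A = ∅
    · rw [if_pos hc, if_pos hc.symm]
    · rw [if_neg hc, if_neg (mt Or.symm hc)]
      simp only [hmem]
      by_cases hu : u ∈ oddVertices A
      · simp only [hu, if_true, not_true, if_false]; rw [min_comm]
      · simp only [hu, if_false, not_false_iff, if_true]; rw [min_comm]

/-- Both `A` and its toggle lie in `A ∪ {e}`, so each entry of the minimum is at least `x ^ #(A ∪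
{e}) / Δ`. This converts the transition weights of the canonical paths into terms of the Dirichlet
form. -/
lemma le_wormWeight_mul_edgeRate (G : SimpleGraph V) {x : ℝ} (hx : 0 < x) (hx1 : x ≤ 1)
    {A : Finset (Sym2 V)} (hA : IsWorm A) {e : Sym2 V} (he : e ∈ G.edgeFinset)
    (hA' : IsWorm (A ∆ {e})) :
    x ^ #(A ∪ {e}) ≤ 2 * (G.maxDegree : ℝ) * (wormWeight x A * edgeRate G x A e) := by
  induction e using Sym2.ind with
  | _ u v =>
    have huv : G.Adj u v := by simpa using he
    have hdu : (0 : ℝ) < G.degree u := by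
      exact_mod_cast (G.degree_pos_iff_exists_adj u).mpr ⟨v, huv⟩
    have hdv : (0 : ℝ) < G.degree v := by
      exact_mod_cast (G.degree_pos_iff_exists_adj v).mpr ⟨u, huv.symm⟩
    have hu : (G.degree u : ℝ) ≤ G.maxDegree := by exact_mod_cast G.degree_le_maxDegree u
    have hv : (G.degree v : ℝ) ≤ G.maxDegree := by exact_mod_cast G.degree_le_maxDegree v
    have hΔ : (0 : ℝ) < G.maxDegree := hdu.trans_le hu
    rw [wormWeight_mul_edgeRate G hx hA huv hA']
    set y := x ^ #(A ∪ {s(u, v)})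
    have hy : 0 < y := pow_pos hx _
    have hyA : y ≤ x ^ #A := pow_le_pow_of_le_one hx.le hx1 (card_le_card subset_union_left)
    have hyA' : y ≤ x ^ #(A ∆ {s(u, v)}) :=
      pow_le_pow_of_le_one hx.le hx1 (card_le_card symmDiff_le_sup)
    have hq : ∀ a b : ℝ, 0 < a → a ≤ G.maxDegree → y ≤ b → y / G.maxDegree ≤ b / a :=
      fun a b ha haΔ hb => div_le_div₀ (hy.le.trans hb) hb ha haΔ
    have hmin : ∀ a b : ℝ, y / G.maxDegree ≤ a → y / G.maxDegree ≤ b →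
        y ≤ 2 * (G.maxDegree : ℝ) * (1 / 2 * min a b) := by
      intro a b ha hb
      have := (div_le_iff₀ hΔ).mp (le_min ha hb)
      linarith
    split_ifs
    · have h1 := hq _ _ hdu hu le_rfl
      have h2 := hq _ _ hdv hv le_rfl
      have h3 : y = y / G.maxDegree * G.maxDegree := by field_simp
      have h4 : 2 * (G.maxDegree : ℝ) * (1 / 2 * y * (1 / (G.degree u : ℝ) + 1 / (G.degree v : ℝ)))
          = (y / G.degree u + y / G.degree v) * G.maxDegree := by ring
      rw [h4]
      calc y = y / G.maxDegree * G.maxDegree := h3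
        _ ≤ _ := mul_le_mul_of_nonneg_right
          (h1.trans (le_add_of_nonneg_right (by positivity))) hΔ.le
    · exact hmin _ _ (hq _ _ hdu hu hyA) (hq _ _ hdv hv hyA')
    · exact hmin _ _ (hq _ _ hdv hv hyA) (hq _ _ hdu hu hyA')

end Rates

/-! ### The worm matrix: reversibility and spectral gap -/

section Matrix

variable {V : Type*} [Fintype V]

lemma sum_wormSpace (G : SimpleGraph V) {R : Type*} [AddCommMonoid R] (g : Finset (Sym2 V) → R) :
    ∑ A : WormSpace G, g A.1 = ∑ A ∈ wormStates G, g A :=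
  (Finset.sum_subtype (wormStates G) (p := fun A => A ⊆ G.edgeFinset ∧
    (oddVertices A = ∅ ∨ #(oddVertices A) = 2)) (fun _ => mem_wormStates) g).symm

lemma toggle_ne {V : Type*} (A : Finset (Sym2 V)) (e : Sym2 V) : A ≠ A ∆ {e} := by
  intro h
  have h' : e ∈ A ↔ e ∈ A ∆ {e} := by rw [← h]
  simp only [mem_symmDiff, mem_singleton] at h'
  tauto

lemma moveProb_self (G : SimpleGraph V) (x : ℝ) (A : WormSpace G) : moveProb G x A A = 0 := by
  unfold moveProb
  rw [filter_false_of_mem fun e _ => toggle_ne A.1 e, sum_empty]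

lemma moveProb_nonneg (G : SimpleGraph V) {x : ℝ} (hx : 0 ≤ x) (A B : WormSpace G) :
    0 ≤ moveProb G x A B :=
  sum_nonneg fun _ _ => edgeRate_nonneg G hx _ _

/-- A sum over the possible moves as a sum over edges. -/
lemma sum_moveProb_mul (G : SimpleGraph V) (x : ℝ) (A : WormSpace G)
    (g : Finset (Sym2 V) → ℝ) :
    ∑ B, moveProb G x A B * g B.1 = ∑ e ∈ G.edgeFinset, edgeRate G x A.1 e * g (A.1 ∆ {e}) := by
  unfold moveProb
  simp only [sum_mul, sum_filter]
  rw [sum_comm]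
  refine sum_congr rfl fun e he => ?_
  by_cases hr : edgeRate G x A.1 e = 0
  · simp [hr]
  · have hw := isWorm_of_edgeRate_ne_zero G A.2.2 he hr
    refine (sum_eq_single (⟨A.1 ∆ {e}, toggle_subset A.2.1 he, hw⟩ : WormSpace G) ?_ ?_).trans ?_
    · intro B _ hB
      rw [if_neg fun h => hB (Subtype.ext h)]
      ring
    · exact fun h => absurd (mem_univ _) h
    · rw [if_pos rfl]

lemma sum_wormMatrix_mul (G : SimpleGraph V) (x : ℝ) (A : WormSpace G) (f : WormSpace G → ℝ) :
    ∑ B, wormMatrix G x A B * f B =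
      (1 - ∑ B, moveProb G x A B) * f A + ∑ B, moveProb G x A B * f B := by
  have h0 := moveProb_self G x A
  have h1 : ∑ B ∈ univ.erase A, moveProb G x A B = ∑ B, moveProb G x A B := by
    rw [← add_sum_erase univ _ (mem_univ A), h0, zero_add]
  have h2 : ∑ B ∈ univ.erase A, moveProb G x A B * f B = ∑ B, moveProb G x A B * f B := by
    rw [← add_sum_erase univ (fun B => moveProb G x A B * f B) (mem_univ A), h0, zero_mul, zero_add]
  rw [← add_sum_erase univ _ (mem_univ A), wormMatrix, if_pos rfl, h1, ← h2]
  congr 1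
  refine sum_congr rfl fun B hB => ?_
  rw [wormMatrix, if_neg (ne_of_mem_erase hB).symm]

lemma sum_moveProb_le (G : SimpleGraph V) {x : ℝ} (hx1 : x ≤ 1) (A : WormSpace G) :
    ∑ B, moveProb G x A B ≤ 1 / 2 := by
  have h := sum_moveProb_mul G x A (fun _ => 1)
  simp only [mul_one] at h
  rw [h]
  exact sum_edgeRate_le G hx1 A.2.2

/-- The normalising constant of the stationary weights. -/
def wormZ (G : SimpleGraph V) (x : ℝ) : ℝ := ∑ A ∈ wormStates G, wormWeight x A

/-- The stationary distribution of the worm chain. -/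
def wormDist (G : SimpleGraph V) (x : ℝ) (A : WormSpace G) : ℝ := wormWeight x A.1 / wormZ G x

lemma wormWeight_pos [Nonempty V] {x : ℝ} (hx : 0 < x) (A : Finset (Sym2 V)) :
    0 < wormWeight x A := mul_pos (defectWeight_pos A) (pow_pos hx _)

lemma wormZ_pos [Nonempty V] (G : SimpleGraph V) {x : ℝ} (hx : 0 < x) : 0 < wormZ G x :=
  sum_pos (fun A _ => wormWeight_pos hx A) ⟨∅, mem_wormStates.mpr (emptyState G).2⟩

lemma wormMatrix_comm [Nonempty V] (G : SimpleGraph V) {x : ℝ} (hx : 0 < x) (A B : WormSpace G) :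
    wormDist G x A * wormMatrix G x A B = wormDist G x B * wormMatrix G x B A := by
  by_cases hAB : A = B
  · rw [hAB]
  rw [wormMatrix, if_neg hAB, wormMatrix, if_neg (Ne.symm hAB)]
  unfold wormDist moveProb
  rw [div_mul_eq_mul_div, div_mul_eq_mul_div, mul_sum, mul_sum]
  congr 1
  have hiff : ∀ e : Sym2 V, B.1 = A.1 ∆ {e} ↔ A.1 = B.1 ∆ {e} := fun e =>
    ⟨fun h => by rw [h, symmDiff_symmDiff_cancel_right],
      fun h => by rw [h, symmDiff_symmDiff_cancel_right]⟩
  simp only [hiff]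
  refine sum_congr rfl fun e he => ?_
  obtain ⟨he, hA⟩ := mem_filter.mp he
  have hB := (hiff e).mpr hA
  rw [wormWeight_mul_edgeRate_comm G hx A.2.2 he (hB ▸ B.2.2), ← hB]

lemma wormMatrix_isLazyReversible [Nonempty V] (G : SimpleGraph V) {x : ℝ} (hx : 0 < x)
    (hx1 : x ≤ 1) : IsLazyReversible (wormMatrix G x) (wormDist G x) where
  nonneg A B := by
    unfold wormMatrix
    split_ifs with h
    · have := (sum_le_sum_of_subset_of_nonneg (erase_subset A univ)
        fun B _ _ => moveProb_nonneg G hx.le A B).trans (sum_moveProb_le G hx1 A)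
      linarith
    · exact moveProb_nonneg G hx.le A B
  row_sum A := by
    have := sum_wormMatrix_mul G x A (fun _ => 1)
    simp only [mul_one] at this
    rw [this]; ring
  lazy A := by
    rw [wormMatrix, if_pos rfl]
    have := (sum_le_sum_of_subset_of_nonneg (erase_subset A univ)
      fun B _ _ => moveProb_nonneg G hx.le A B).trans (sum_moveProb_le G hx1 A)
    linarith
  pos A := div_pos (wormWeight_pos hx _) (wormZ_pos G hx)
  total := by
    unfold wormDist
    rw [← sum_div, sum_wormSpace G (wormWeight x)]
    exact div_self (wormZ_pos G hx).ne'
  reversible := wormMatrix_comm G hx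

lemma edgeFinset_card_pos (G : SimpleGraph V) (hE : G.edgeSet.Nonempty) : 0 < #G.edgeFinset := by
  obtain ⟨e, he⟩ := hE
  exact card_pos.mpr ⟨e, by simpa using he⟩

lemma maxDegree_pos (G : SimpleGraph V) (hE : G.edgeSet.Nonempty) : 0 < G.maxDegree := by
  obtain ⟨e, he⟩ := hE
  induction e using Sym2.ind with
  | _ u v =>
    exact ((G.degree_pos_iff_exists_adj u).mpr ⟨v, he⟩).trans_le (G.degree_le_maxDegree u)

lemma two_le_card (G : SimpleGraph V) (hE : G.edgeSet.Nonempty) : 2 ≤ Fintype.card V := by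
  obtain ⟨e, he⟩ := hE
  induction e using Sym2.ind with
  | _ u v => exact Fintype.one_lt_card_iff.mpr ⟨u, v, G.ne_of_adj he⟩

/-- A lower bound for the spectral gap of the worm chain. -/
def gapBound (G : SimpleGraph V) : ℝ :=
  1 / (4 * (G.maxDegree : ℝ) * (#G.edgeFinset : ℝ) * (Fintype.card V : ℝ) ^ 2)

lemma dirichlet_eq (G : SimpleGraph V) (x : ℝ) (f : Finset (Sym2 V) → ℝ) :
    ∑ A : WormSpace G, ∑ B : WormSpace G,
        wormDist G x A * wormMatrix G x A B * (f A.1 - f B.1) ^ 2 =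
      (wormZ G x)⁻¹ * ∑ T ∈ wormStates G, ∑ e ∈ G.edgeFinset,
        wormWeight x T * edgeRate G x T e * (f T - f (T ∆ {e})) ^ 2 := by
  rw [mul_sum, ← sum_wormSpace G (fun T => (wormZ G x)⁻¹ * ∑ e ∈ G.edgeFinset,
        wormWeight x T * edgeRate G x T e * (f T - f (T ∆ {e})) ^ 2)]
  refine sum_congr rfl fun A _ => ?_
  have h1 := sum_wormMatrix_mul G x A (fun B => (f A.1 - f B.1) ^ 2)
  rw [sum_moveProb_mul G x A (fun B => (f A.1 - f B) ^ 2), sub_self, zero_pow two_ne_zero, mul_zero,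
    zero_add] at h1
  simp only [mul_assoc]
  rw [← mul_sum, h1, wormDist, mul_sum, mul_sum]
  exact sum_congr rfl fun e _ => by ring

lemma gap_arith {Δ m K Z B Q : ℝ} (hΔ : 0 < Δ) (hm : 0 < m) (hK : 0 < K) (hZ : 0 < Z)
    (h : B ≤ m * K * (2 * Δ * Q)) : 1 / (4 * Δ * m * K) * (B / Z) ≤ Z⁻¹ * Q / 2 := by
  rw [div_mul_div_comm, one_mul, div_le_iff₀ (by positivity)]
  calc B ≤ _ := h
    _ = _ := by field_simp; ring

/-- Canonical paths bound the variance by `m n² · 2Δ` times the sum of equilibrium flows weighted by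
squared increments. That sum is twice the normalised Dirichlet form, which produces the factor `4`.
-/
lemma hasGap_wormMatrix [Nonempty V] (G : SimpleGraph V) (hE : G.edgeSet.Nonempty) {β : ℝ}
    (hβ : 0 < β) :
    HasGap (wormMatrix G (Real.tanh β)) (wormDist G (Real.tanh β)) (gapBound G) := by
  intro f' hf'
  set x := Real.tanh β with hx
  have hx0 : 0 < x := tanh_pos_of_pos hβ
  have hx1 : x ≤ 1 := (Real.tanh_lt_one β).le
  -- Extension by zero off the state space. The value there is irrelevant, as such moves have rate
  -- zero.
  set f : Finset (Sym2 V) → ℝ := fun A =>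
    if h : A ⊆ G.edgeFinset ∧ (oddVertices A = ∅ ∨ #(oddVertices A) = 2) then f' ⟨A, h⟩ else 0
    with hf
  have hff : ∀ A : WormSpace G, f A.1 = f' A := fun A => by
    simp only [hf]; rw [dif_pos A.2]; rfl
  have hZ := wormZ_pos G hx0
  set l := paritySum G x ∅ with hl
  have hl0 : 0 < l := paritySum_empty_pos G hx0
  have hΔ : (0 : ℝ) < G.maxDegree := by exact_mod_cast maxDegree_pos G hE
  have hm : (0 : ℝ) < #G.edgeFinset := by exact_mod_cast edgeFinset_card_pos G hE
  have hn : (0 : ℝ) < Fintype.card V := by exact_mod_cast Fintype.card_pos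
  set K : ℝ := (Fintype.card V : ℝ) ^ 2 with hK
  have hdir := mean_sq_sub_mean_mul_act (wormMatrix_isLazyReversible G hx0 hx1) f'
  have hD := dirichlet_eq G x f
  simp only [hff] at hD
  rw [hD] at hdir
  set Q := ∑ T ∈ wormStates G, ∑ e ∈ G.edgeFinset,
    wormWeight x T * edgeRate G x T e * (f T - f (T ∆ {e})) ^ 2 with hQ
  have hcan := canonical_paths G hβ f
  rw [← hx, ← hl, ← hK] at hcan
  have hright : ∑ T ∈ wormStates G, ∑ e ∈ G.edgeFinset.filter (fun e => IsWorm (T ∆ {e})),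
      x ^ #(T ∪ {e}) * (f T - f (T ∆ {e})) ^ 2 ≤ 2 * G.maxDegree * Q := by
    rw [hQ, mul_sum]
    refine sum_le_sum fun T hT => ?_
    rw [mul_sum]
    refine (sum_le_sum fun e he => ?_).trans
      (sum_le_sum_of_subset_of_nonneg (filter_subset (fun e => IsWorm (T ∆ {e})) _) fun e _ _ => ?_)
    · obtain ⟨he, hw⟩ := mem_filter.mp he
      rw [← mul_assoc]
      exact mul_le_mul_of_nonneg_right
        (le_wormWeight_mul_edgeRate G hx0 hx1 (mem_wormStates.mp hT).2 he hw) (sq_nonneg _)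
    · have := edgeRate_nonneg G hx0.le T e
      have := (wormWeight_pos hx0 T).le
      positivity
  have hsumw : ∑ I ∈ wormStates G, wormWeight x I * f I = 0 := by
    have : mean (wormDist G x) f' =
        (∑ I ∈ wormStates G, wormWeight x I * f I) / wormZ G x := by
      rw [← sum_wormSpace G (fun I => wormWeight x I * f I), sum_div]
      refine sum_congr rfl fun A _ => ?_
      rw [hff, wormDist]; ring
    rw [this, div_eq_zero_iff] at hf'
    exact hf'.resolve_right hZ.ne'
  have hsq : mean (wormDist G x) (fun s => f' s ^ 2) =
      (∑ I ∈ wormStates G, wormWeight x I * f I ^ 2) / wormZ G x := by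
    rw [← sum_wormSpace G (fun I => wormWeight x I * f I ^ 2), sum_div]
    refine sum_congr rfl fun A _ => ?_
    simp only [hff, wormDist]; ring
  -- Why targets in `C_0` suffice: in the expanded square the cross term contains the mean of `f`,
  -- which vanishes, and the remaining term is nonnegative.
  have hleft : l * ∑ I ∈ wormStates G, wormWeight x I * f I ^ 2 ≤
      ∑ I ∈ wormStates G, ∑ F ∈ G.edgeFinset.powerset.filter (fun F => oddVertices F = ∅),
        wormWeight x I * x ^ #F * (f I - f F) ^ 2 := by
    have hexp : ∑ I ∈ wormStates G, ∑ F ∈ G.edgeFinset.powerset.filter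
          (fun F => oddVertices F = ∅), wormWeight x I * x ^ #F * (f I - f F) ^ 2 =
        l * (∑ I ∈ wormStates G, wormWeight x I * f I ^ 2) -
        2 * (∑ I ∈ wormStates G, wormWeight x I * f I) *
          (∑ F ∈ G.edgeFinset.powerset.filter (fun F => oddVertices F = ∅), x ^ #F * f F) +
        wormZ G x *
          (∑ F ∈ G.edgeFinset.powerset.filter (fun F => oddVertices F = ∅), x ^ #F * f F ^ 2) := by
      rw [mul_comm l, hl, paritySum, wormZ, mul_assoc 2, sum_mul_sum, sum_mul_sum, sum_mul_sum,
        mul_sum, ← sum_sub_distrib, ← sum_add_distrib]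
      refine sum_congr rfl fun I _ => ?_
      rw [mul_sum, ← sum_sub_distrib, ← sum_add_distrib]
      exact sum_congr rfl fun F _ => by ring
    rw [hexp, hsumw]
    have : 0 ≤ wormZ G x *
        (∑ F ∈ G.edgeFinset.powerset.filter (fun F => oddVertices F = ∅), x ^ #F * f F ^ 2) :=
      mul_nonneg hZ.le (sum_nonneg fun F _ => by positivity)
    linarith
  set B := ∑ I ∈ wormStates G, wormWeight x I * f I ^ 2 with hB
  have hfinal : B ≤ #G.edgeFinset * K * (2 * G.maxDegree * Q) := by
    refine le_of_mul_le_mul_left ?_ hl0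
    calc l * B ≤ _ := hleft
      _ ≤ _ := hcan
      _ ≤ #G.edgeFinset * (K * l) * (2 * G.maxDegree * Q) :=
          mul_le_mul_of_nonneg_left hright (by positivity)
      _ = _ := by ring
  have hgap : gapBound G * mean (wormDist G x) (fun s => f' s ^ 2) ≤
      mean (wormDist G x) (fun s => f' s ^ 2) -
        mean (wormDist G x) (fun s => f' s * act (wormMatrix G x) f' s) := by
    have h2 : gapBound G * (B / wormZ G x) ≤ (wormZ G x)⁻¹ * Q / 2 := by
      rw [gapBound, ← hK]
      exact gap_arith hΔ hm (by positivity) hZ hfinal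
    rw [hsq] at hdir ⊢
    linarith
  linarith

end Matrix

/-! ### From the law of a trajectory to iterates of the matrix -/

section Law

variable {V : Type*} [Fintype V]

/-- The probability of the initial segment `a 0, …, a t` of a trajectory. -/
def pathWeight (G : SimpleGraph V) (x : ℝ) (t : ℕ) (a : ℕ → WormSpace G) : ℝ :=
  (if a 0 = emptyState G then 1 else 0) * ∏ i ∈ range t, wormMatrix G x (a i) (a (i + 1))

variable {G : SimpleGraph V} {x : ℝ} {Ω : Type*} [MeasurableSpace Ω] {μ : MeasureTheory.Measure Ω}
  {X : ℕ → Ω → WormSpace G}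

/-- The values of `X t` form a finite measurable partition, so the set `F` itself may be arbitrary.
-/
lemma measure_eq_sum (hX : IsWormChain G x μ X) (t : ℕ) (F : Set Ω) :
    μ F = ∑ s, μ ({ω | X t ω = s} ∩ F) := by
  have h := MeasureTheory.sum_measure_preimage_singleton (μ := μ.restrict F) (f := X t) univ
    (fun s _ => hX.measurable t s)
  rw [coe_univ, Set.preimage_univ, MeasureTheory.Measure.restrict_apply_univ] at h
  rw [← h]
  exact sum_congr rfl fun s _ => MeasureTheory.Measure.restrict_apply (hX.measurable t s)

/-- One backward step of the Markov property. -/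
lemma measure_cylinder_inter (hX : IsWormChain G x μ X)
    (hP : ∀ s t, 0 ≤ wormMatrix G x s t) (t : ℕ) (F : Set Ω) (ψ : WormSpace G → ℝ)
    (hψ : ∀ s, 0 ≤ ψ s) (a : ℕ → WormSpace G)
    (h : ∀ b : ℕ → WormSpace G, (∀ i ≤ t, b i = a i) → μ ({ω | ∀ i ≤ t + 1, X i ω = b i} ∩ F) =
      ENNReal.ofReal (pathWeight G x (t + 1) b * ψ (b (t + 1)))) :
    μ ({ω | ∀ i ≤ t, X i ω = a i} ∩ F) =
      ENNReal.ofReal (pathWeight G x t a * act (wormMatrix G x) ψ (a t)) := by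
  have hw : ∀ t a, 0 ≤ pathWeight G x t a := fun t a =>
    mul_nonneg (by split_ifs <;> norm_num) (prod_nonneg fun i _ => hP _ _)
  rw [measure_eq_sum hX (t + 1)]
  have hs : ∀ s, μ ({ω | X (t + 1) ω = s} ∩ ({ω | ∀ i ≤ t, X i ω = a i} ∩ F)) =
      ENNReal.ofReal (pathWeight G x t a * (wormMatrix G x (a t) s * ψ s)) := by
    intro s
    set b : ℕ → WormSpace G := Function.update a (t + 1) s with hb
    have hbi : ∀ i ≤ t, b i = a i := fun i hi => Function.update_of_ne (by omega) _ _
    have hbt : b (t + 1) = s := Function.update_self _ _ _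
    have hset : {ω | X (t + 1) ω = s} ∩ ({ω | ∀ i ≤ t, X i ω = a i} ∩ F) =
        {ω | ∀ i ≤ t + 1, X i ω = b i} ∩ F := by
      rw [← Set.inter_assoc]
      congr 1
      ext ω
      simp only [Set.mem_inter_iff, Set.mem_ofPred_eq]
      constructor
      · rintro ⟨h1, h2⟩ i hi
        rcases Nat.lt_or_ge t i with hti | hti
        · obtain rfl : i = t + 1 := by omega
          rw [h1, hbt]
        · rw [h2 i hti, hbi i hti]
      · intro h1
        exact ⟨by rw [h1 _ le_rfl, hbt], fun i hi => by rw [h1 i (by omega), hbi i hi]⟩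
    rw [hset, h b hbi, hbt]
    congr 1
    have hpw : pathWeight G x (t + 1) b = pathWeight G x t a * wormMatrix G x (a t) s := by
      unfold pathWeight
      rw [prod_range_succ, hbi 0 (Nat.zero_le _), hbi t le_rfl, hbt, ← mul_assoc]
      congr 2
      refine prod_congr rfl fun i hi => ?_
      have := mem_range.mp hi
      rw [hbi i (by omega), hbi (i + 1) (by omega)]
    rw [hpw]; ring
  simp only [hs]
  rw [← ENNReal.ofReal_sum_of_nonneg fun s _ =>
    mul_nonneg (hw t a) (mul_nonneg (hP _ _) (hψ s)), ← mul_sum]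
  rfl

variable {M : Type*} [AddCommMonoid M]

/-- Summing over the next state extends the cylinder and moves its increment into the accumulator
`y`. For `N = 0` only the law of the initial segment is left. -/
lemma measure_cylinder_inter_walk (hX : IsWormChain G x μ X)
    (hP : ∀ s t, 0 ≤ wormMatrix G x s t) (f : WormSpace G → M) (good : Set M) (N t : ℕ)
    (a : ℕ → WormSpace G) (y : M)
    (hφ : ∀ N s y, 0 ≤ walkMean (wormMatrix G x) f (good.indicator fun _ => (1 : ℝ)) N s y) :
    μ ({ω | ∀ i ≤ t, X i ω = a i} ∩ {ω | y + ∑ i ∈ Icc (t + 1) (t + N), f (X i ω) ∈ good}) =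
      ENNReal.ofReal (pathWeight G x t a *
        walkMean (wormMatrix G x) f (good.indicator fun _ => (1 : ℝ)) N (a t) y) := by
  induction N generalizing t a y with
  | zero =>
    have h0 : Icc (t + 1) t = ∅ := Icc_eq_empty (by omega)
    simp only [add_zero, h0, sum_empty, walkMean]
    by_cases hy : y ∈ good
    · simp only [hy, Set.ofPred_true, Set.inter_univ, Set.indicator_of_mem, mul_one]
      exact hX.path_law t a
    · simp [hy]
  | succ N ih =>
    refine measure_cylinder_inter hX hP t _
      (fun s => walkMean (wormMatrix G x) f (good.indicator fun _ => (1 : ℝ)) N s (y + f s))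
      (fun s => hφ _ _ _) a fun b _ => ?_
    rw [← ih (t + 1) b (y + f (b (t + 1)))]
    refine congrArg μ (Set.ext fun ω => ?_)
    simp only [Set.mem_inter_iff, Set.mem_ofPred_eq]
    refine and_congr_right fun hω => ?_
    have hI : Icc (t + 1) (t + (N + 1)) = insert (t + 1) (Icc (t + 1 + 1) (t + 1 + N)) := by
      ext i; simp only [mem_Icc, mem_insert]; omega
    rw [hI, sum_insert (by simp), hω (t + 1) le_rfl, ← add_assoc y]

/-- The law of an additive functional of the chain after a burn-in time. -/
lemma measure_burnIn_walk (hX : IsWormChain G x μ X)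
    (hP : ∀ s t, 0 ≤ wormMatrix G x s t) (f : WormSpace G → M) (good : Set M) (N τ : ℕ)
    (hφ : ∀ N s y, 0 ≤ walkMean (wormMatrix G x) f (good.indicator fun _ => (1 : ℝ)) N s y) :
    μ {ω | ∑ i ∈ Icc (τ + 1) (τ + N), f (X i ω) ∈ good} =
      ENNReal.ofReal ((act (wormMatrix G x))^[τ]
        (fun s => walkMean (wormMatrix G x) f (good.indicator fun _ => (1 : ℝ)) N s 0)
        (emptyState G)) := by
  set ψ := fun s => walkMean (wormMatrix G x) f (good.indicator fun _ => (1 : ℝ)) N s 0 with hψ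
  set F := {ω | ∑ i ∈ Icc (τ + 1) (τ + N), f (X i ω) ∈ good} with hF
  have hit : ∀ j s, 0 ≤ (act (wormMatrix G x))^[j] ψ s := by
    intro j
    induction j with
    | zero => exact fun s => hφ N s 0
    | succ j ih =>
      intro s
      rw [Function.iterate_succ_apply']
      exact sum_nonneg fun t _ => mul_nonneg (hP _ _) (ih t)
  -- Induction backwards from the burn-in time: `j` counts the transitions still to be averaged
  -- over, each contributing one application of the matrix.
  have key : ∀ j t, t + j = τ → ∀ a : ℕ → WormSpace G, μ ({ω | ∀ i ≤ t, X i ω = a i} ∩ F) =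
      ENNReal.ofReal (pathWeight G x t a * (act (wormMatrix G x))^[j] ψ (a t)) := by
    intro j
    induction j with
    | zero =>
      intro t ht a
      obtain rfl : t = τ := by omega
      have := measure_cylinder_inter_walk hX hP f good N t a 0 hφ
      simp only [zero_add] at this
      exact this
    | succ j ih =>
      intro t ht a
      rw [Function.iterate_succ_apply']
      exact measure_cylinder_inter hX hP t F _ (hit j) a fun b _ => ih (t + 1) (by omega) b
  rw [measure_eq_sum hX 0]
  have hs : ∀ s, μ ({ω | X 0 ω = s} ∩ F) =
      if s = emptyState G then ENNReal.ofReal ((act (wormMatrix G x))^[τ] ψ s) else 0 := by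
    intro s
    have := key τ 0 (by omega) (fun _ => s)
    simp only [Nat.le_zero, forall_eq, pathWeight, range_zero, prod_empty, mul_one] at this
    rw [this]
    split_ifs <;> simp
  simp only [hs, sum_ite_eq', mem_univ, if_true]

end Law

/-! ### Expectations and costs of randomized computations -/

namespace Comp

variable {α γ : Type}

/-- The expectation of `φ` of the output. -/
def ev (c : Comp α) (φ : α → ℝ≥0∞) : ℝ≥0∞ :=
  ∑' r, (DFunLike.coe (F := PMF (α × ℕ)) c r) * φ r.1

lemma tsum_pure_mul {ι : Type*} (a : ι) (g : ι → ℝ≥0∞) : ∑' b, PMF.pure a b * g b = g a := by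
  rw [tsum_eq_single a]
  · simp
  · intro b hb; simp [PMF.pure_apply, hb]

lemma tsum_bind_mul {ι κ : Type*} (p : PMF ι) (f : ι → PMF κ) (g : κ → ℝ≥0∞) :
    ∑' b, p.bind f b * g b = ∑' a, p a * ∑' b, f a b * g b := by
  simp only [PMF.bind_apply, ← ENNReal.tsum_mul_right, ← ENNReal.tsum_mul_left]
  rw [ENNReal.tsum_comm]
  simp only [mul_assoc]

lemma tsum_map_mul {ι κ : Type*} (p : PMF ι) (f : ι → κ) (g : κ → ℝ≥0∞) :
    ∑' b, PMF.map f p b * g b = ∑' a, p a * g (f a) := by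
  rw [PMF.map, tsum_bind_mul]
  simp only [Function.comp, tsum_pure_mul]

lemma ev_pure (a : α) (φ : α → ℝ≥0∞) : ev (pure a : Comp α) φ = φ a :=
  tsum_pure_mul (a, 0) fun r => φ r.1

lemma ev_op (a : α) (φ : α → ℝ≥0∞) : ev (op a) φ = φ a :=
  tsum_pure_mul (a, 1) fun r => φ r.1

lemma ev_tick (t : ℕ) (φ : Unit → ℝ≥0∞) : ev (tick t) φ = φ () :=
  tsum_pure_mul ((), t) fun r => φ r.1

lemma ev_bind (c : Comp α) (f : α → Comp γ) (φ : γ → ℝ≥0∞) :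
    ev (c >>= f) φ = ev c fun a => ev (f a) φ := by
  refine (tsum_bind_mul _ _ fun r : γ × ℕ => φ r.1).trans (tsum_congr fun r => ?_)
  congr 1
  exact tsum_map_mul _ _ fun r : γ × ℕ => φ r.1

lemma ev_coin (p : ℝ) (φ : Bool → ℝ≥0∞) :
    ev (coin p) φ = min (ENNReal.ofReal p) 1 * φ true + (1 - min (ENNReal.ofReal p) 1) * φ false := by
  refine (tsum_map_mul _ _ fun r : Bool × ℕ => φ r.1).trans ?_
  rw [tsum_fintype]
  simp

/-- Clamping the coin at one is what performs the minimum in the Metropolis acceptance. -/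
lemma ev_coin_ofReal {p a b : ℝ} (hp : 0 ≤ p) (ha : 0 ≤ a) (hb : 0 ≤ b) {φ : Bool → ℝ≥0∞}
    (h1 : φ true = ENNReal.ofReal a) (h2 : φ false = ENNReal.ofReal b) :
    ev (coin p) φ = ENNReal.ofReal (min p 1 * a + (1 - min p 1) * b) := by
  have hp0 : 0 ≤ min p 1 := le_min hp zero_le_one
  have hp1 : 0 ≤ 1 - min p 1 := sub_nonneg.mpr (min_le_right _ _)
  rw [ev_coin, ENNReal.ofReal_add (mul_nonneg hp0 ha) (mul_nonneg hp1 hb),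
    ENNReal.ofReal_mul hp0, ENNReal.ofReal_mul hp1, ENNReal.ofReal_sub _ hp0,
    ENNReal.ofReal_one, ENNReal.ofReal_min, ENNReal.ofReal_one, h1, h2]

lemma ev_fair_coin_ofReal {a b : ℝ} (ha : 0 ≤ a) (hb : 0 ≤ b) {φ : Bool → ℝ≥0∞}
    (h1 : φ true = ENNReal.ofReal a) (h2 : φ false = ENNReal.ofReal b) :
    ev (coin (1 / 2)) φ = ENNReal.ofReal (1 / 2 * a + 1 / 2 * b) := by
  rw [ev_coin_ofReal (by norm_num) ha hb h1 h2]
  congr 1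
  rw [min_eq_left (by norm_num : (1 / 2 : ℝ) ≤ 1)]
  ring

lemma ev_uniform_ofReal [Nonempty α] {S : Finset α} (hS : S.Nonempty) {φ : α → ℝ≥0∞} {ψ : α → ℝ}
    (hψ : ∀ a ∈ S, 0 ≤ ψ a) (h : ∀ a ∈ S, φ a = ENNReal.ofReal (ψ a)) :
    ev (uniform S) φ = ENNReal.ofReal (∑ a ∈ S, 1 / (#S : ℝ) * ψ a) := by
  refine (tsum_map_mul _ _ fun r : α × ℕ => φ r.1).trans ?_
  rw [dif_pos hS, tsum_eq_sum (s := S), ENNReal.ofReal_sum_of_nonneg]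
  · refine sum_congr rfl fun a ha => ?_
    have hc : (0 : ℝ) < #S := by exact_mod_cast card_pos.mpr hS
    rw [PMF.uniformOfFinset_apply_of_mem hS ha, h a ha, ENNReal.ofReal_mul (by positivity),
      one_div, ENNReal.ofReal_inv_of_pos hc, ENNReal.ofReal_natCast]
  · intro a ha
    have := hψ a ha
    positivity
  · intro a ha
    rw [PMF.uniformOfFinset_apply_of_notMem hS ha, zero_mul]

lemma prob_eq_ev (c : Comp α) (S : Set α) : c.prob S = ev c (S.indicator fun _ => 1) := by
  refine (PMF.toOuterMeasure_apply _ _).trans (tsum_congr fun r => ?_)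
  by_cases h : r.1 ∈ S <;> simp [Set.indicator, h]

/-! ## Step counts -/

lemma stepsLE_pure (a : α) : (pure a : Comp α).StepsLE 0 := by
  intro r hr
  rw [(PMF.mem_support_pure_iff (a, 0) r).mp hr]
  simp

lemma stepsLE_op (a : α) : (op a).StepsLE 1 := by
  intro r hr
  rw [(PMF.mem_support_pure_iff (a, 1) r).mp hr]
  simp

lemma stepsLE_tick (t : ℕ) : (tick t).StepsLE t := by
  intro r hr
  rw [(PMF.mem_support_pure_iff ((), t) r).mp hr]

lemma stepsLE_coin (p : ℝ) : (coin p).StepsLE 1 := by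
  intro r hr
  obtain ⟨b, -, rfl⟩ := (PMF.mem_support_map_iff _ _ _).mp hr
  simp

lemma stepsLE_uniform [Nonempty α] (S : Finset α) : (uniform S).StepsLE 1 := by
  intro r hr
  obtain ⟨b, -, rfl⟩ := (PMF.mem_support_map_iff _ _ _).mp hr
  simp

lemma StepsLE.mono {c : Comp α} {B B' : ℝ} (h : c.StepsLE B) (hB : B ≤ B') : c.StepsLE B' :=
  fun r hr => (h r hr).trans hB

lemma StepsLE.bind {c : Comp α} {f : α → Comp γ} {B B' : ℝ} (hc : c.StepsLE B)
    (hf : ∀ a, (f a).StepsLE B') : (c >>= f).StepsLE (B + B') := by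
  intro r hr
  obtain ⟨q, hq, hr⟩ := (PMF.mem_support_bind_iff _ _ _).mp hr
  obtain ⟨s, hs, rfl⟩ := (PMF.mem_support_map_iff _ _ _).mp hr
  push_cast
  exact add_le_add (hc q hq) (hf _ s hs)

/-- The continuation is bounded only at the value actually returned. This is needed because the loop
lengths are themselves computed values, with no bound uniform over all of them. -/
lemma StepsLE.op_bind {a : α} {f : α → Comp γ} {B : ℝ} (hf : (f a).StepsLE B) :
    (op a >>= f).StepsLE (1 + B) := by
  intro r hr
  obtain ⟨q, hq, hr⟩ := (PMF.mem_support_bind_iff _ _ _).mp hr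
  obtain ⟨s, hs, rfl⟩ := (PMF.mem_support_map_iff _ _ _).mp hr
  obtain rfl := (PMF.mem_support_pure_iff (a, 1) q).mp hq
  push_cast
  exact add_le_add le_rfl (hf s hs)

lemma StepsLE.ite {P : Prop} [Decidable P] {c c' : Comp α} {B : ℝ} (h : c.StepsLE B)
    (h' : c'.StepsLE B) : (if P then c else c').StepsLE B := by
  split_ifs <;> assumption

end Comp

/-! ### The pair of visit counters -/

section Visits

variable {V : Type*} [Fintype V] {G : SimpleGraph V}

/-- The increments of the two counters. -/
def visits (u v : V) (A : WormSpace G) : ℕ × ℕ :=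
  (if oddVertices A.1 = ∅ then 1 else 0, if oddVertices A.1 = {u, v} then 1 else 0)

lemma walkMean_nonneg {S : Type*} [Fintype S] {P : S → S → ℝ} {p : S → ℝ}
    (h : IsLazyReversible P p) {M : Type*} [Add M]
    {f : S → M} {φ : M → ℝ} (hφ : ∀ y, 0 ≤ φ y) (N : ℕ) (s : S) (y : M) :
    0 ≤ walkMean P f φ N s y := by
  rw [← walkMean_const h (f := f) 0 N s y]
  exact walkMean_mono h hφ N s y

end Visits

/-! ### The program simulates the worm chain -/

section Correctness

variable {V : Type} [Fintype V]

/-- The memory `s` stores the edge set `A`. -/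
def Memory.Represents (s : Memory V) (A : Finset (Sym2 V)) : Prop :=
  s.edges = A ∧
    ((s.defects = none ∧ oddVertices A = ∅) ∨
      ∃ a b, s.defects = some (a, b) ∧ a ≠ b ∧ oddVertices A = {a, b})

/-- The vertices `v`, `w` can be the chosen vertex and the other odd vertex in state `A`. -/
def IsChoice (A : Finset (Sym2 V)) (v : V) (other : Option V) : Prop :=
  (other = none ∧ oddVertices A = ∅) ∨ ∃ w, other = some w ∧ v ≠ w ∧ oddVertices A = {v, w}

/-- The part of a transition after the choice of an edge. -/
def tryMove (G : SimpleGraph V) (x : ℝ) (s : Memory V) (p : V × Option V) (u : V) :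
    Comp (Memory V) := do
  let v := p.1
  let present ← Comp.op (decide (s(v, u) ∈ s.edges))
  let d ← Comp.op (newDefects v u p.2)
  let ratio ← Comp.op (if present then x⁻¹ else x)
  let dv ← Comp.op (G.degree v : ℝ)
  let du ← Comp.op (G.degree u : ℝ)
  let a ← Comp.op (if p.2.isSome ∧ d.isSome then dv / du * ratio else ratio)
  let accept ← Comp.coin a
  if accept then Comp.op ⟨s.edges ∆ {s(v, u)}, d⟩ else pure s

lemma wormStep_eq [Nonempty V] (G : SimpleGraph V) (x : ℝ) (s : Memory V) :
    wormStep G x s = Comp.coin (1 / 2) >>= fun move =>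
      if move then chooseVertex s.defects >>= fun p =>
        Comp.uniform (G.neighborFinset p.1) >>= fun u => tryMove G x s p u
      else pure s := rfl

variable {G : SimpleGraph V} {x : ℝ}

/-- The chosen vertex stops being odd and its neighbour becomes odd, unless the neighbour is the
other defect. From a defect-free state both become odd. The stored pair is thus updated without
inspecting the edge set. -/
lemma newDefects_represents {A : Finset (Sym2 V)} {v u : V} {other : Option V}
    (h : IsChoice A v other) (hvu : v ≠ u) :
    Memory.Represents ⟨A ∆ {s(v, u)}, newDefects v u other⟩ (A ∆ {s(v, u)}) := by
  refine ⟨rfl, ?_⟩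
  rw [oddVertices_toggle A hvu]
  rcases h with ⟨rfl, h0⟩ | ⟨w, rfl, hvw, h2⟩
  · right
    exact ⟨v, u, rfl, hvu, by rw [h0, ← bot_eq_empty, bot_symmDiff]⟩
  · by_cases huw : u = w
    · left
      subst huw
      exact ⟨by simp [newDefects], by rw [h2, symmDiff_self]; rfl⟩
    · right
      refine ⟨u, w, by simp [newDefects, huw], huw, ?_⟩
      rw [h2]
      ext z
      simp only [mem_symmDiff, mem_insert, mem_singleton]
      constructor
      · tauto
      · rintro (rfl | rfl)
        · right; exact ⟨Or.inr rfl, by rintro (h | h) <;> [exact hvu h.symm; exact huw h]⟩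
        · left; exact ⟨Or.inr rfl, by rintro (h | h) <;> [exact hvw h.symm; exact huw h.symm]⟩

/-- When a pair is created or annihilated the ratio is `x` or `x⁻¹` without degrees, and clamping
turns `x⁻¹ ≥ 1` into `1`. Degrees enter exactly when there are defects before and after the move. -/
lemma min_ratio_eq_acceptance (hx0 : 0 < x) (hx1 : x ≤ 1) {A : Finset (Sym2 V)} {v u : V}
    {other : Option V} (h : IsChoice A v other) (hvu : v ≠ u) :
    min (if other.isSome ∧ (newDefects v u other).isSome then
        (G.degree v : ℝ) / (G.degree u : ℝ) * (if s(v, u) ∈ A then x⁻¹ else x)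
      else (if s(v, u) ∈ A then x⁻¹ else x)) 1 = acceptance G x A v u := by
  have hr : min (if s(v, u) ∈ A then x⁻¹ else x) 1 = if s(v, u) ∈ A then 1 else x := by
    split_ifs
    · exact min_eq_right ((one_le_inv₀ hx0).mpr hx1)
    · exact min_eq_left hx1
  unfold acceptance
  rcases h with ⟨rfl, h0⟩ | ⟨w, rfl, hvw, h2⟩
  · rw [if_neg (by simp), if_pos (Or.inl h0), hr]
  · by_cases huw : u = w
    · have : oddVertices (A ∆ {s(v, u)}) = ∅ := by
        rw [oddVertices_toggle A hvu, h2, huw, symmDiff_self]; rfl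
      rw [if_neg (by simp [newDefects, huw]), if_pos (Or.inr this), hr]
    · have h3 : ¬ (oddVertices A = ∅ ∨ oddVertices (A ∆ {s(v, u)}) = ∅) := by
        rintro (h | h)
        · rw [h2] at h; simp at h
        · have h4 := oddVertices_eq_pair hvu h
          have : w ∈ oddVertices A := by simp [h2]
          rw [h4] at this
          simp [hvw.symm, Ne.symm huw] at this
      rw [if_pos (by simp [newDefects, huw]), if_neg h3]

lemma represents_empty : Memory.Represents (V := V) ⟨∅, none⟩ (emptyState G).1 :=
  ⟨rfl, Or.inl ⟨rfl, oddVertices_empty⟩⟩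

lemma ev_tryMove (hx0 : 0 < x) (hx1 : x ≤ 1) {s : Memory V} {A : Finset (Sym2 V)}
    (hs : s.Represents A) {v u : V} {other : Option V} (h : IsChoice A v other) (hvu : G.Adj v u)
    {φ : Memory V → ℝ≥0∞} {ψ : Finset (Sym2 V) → ℝ} (hψ : ∀ B, 0 ≤ ψ B)
    (hφ : ∀ s' B, s'.Represents B → IsWorm B → B ⊆ G.edgeFinset → φ s' = ENNReal.ofReal (ψ B))
    (hA : IsWorm A) (hAE : A ⊆ G.edgeFinset) :
    Comp.ev (tryMove G x s (v, other) u) φ =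
      ENNReal.ofReal (acceptance G x A v u * ψ (A ∆ {s(v, u)}) +
        (1 - acceptance G x A v u) * ψ A) := by
  have hne := G.ne_of_adj hvu
  have hv : v ∈ startVertices A := by
    unfold startVertices
    rcases h with ⟨-, h0⟩ | ⟨w, -, -, h2⟩
    · rw [if_pos h0]; exact mem_univ _
    · rw [if_neg (by rw [h2]; simp), h2]; simp
  have h1 := hφ _ _ (newDefects_represents h hne) (isWorm_toggle hA hne hv)
    (toggle_subset hAE (by simpa using hvu))
  have h2 := hφ _ _ hs hA hAE
  obtain rfl := hs.1
  rw [← min_ratio_eq_acceptance (G := G) hx0 hx1 h hne]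
  unfold tryMove
  simp only [Comp.ev_bind, Comp.ev_op, decide_eq_true_eq]
  exact Comp.ev_coin_ofReal (by split_ifs <;> positivity) (hψ _) (hψ _)
    (by simp [Comp.ev_op, h1]) (by simp [Comp.ev_pure, h2])

/-- It allows evaluation at toggled sets without a proof that they are worm states. -/
lemma exists_extension (ψ : WormSpace G → ℝ) (hψ : ∀ A, 0 ≤ ψ A) :
    ∃ ψ' : Finset (Sym2 V) → ℝ, (∀ A, 0 ≤ ψ' A) ∧ ∀ A : WormSpace G, ψ' A.1 = ψ A := by
  refine ⟨fun A => if h : A ⊆ G.edgeFinset ∧ (oddVertices A = ∅ ∨ #(oddVertices A) = 2) then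
    ψ ⟨A, h⟩ else 0, fun A => ?_, fun A => ?_⟩
  · dsimp only
    split_ifs
    exacts [hψ _, le_rfl]
  · exact dif_pos A.2

variable [Nonempty V]

/-- The transition operator in terms of proposals and acceptances. -/
lemma act_wormMatrix_eq (hdeg : ∀ v, 0 < G.degree v) (A : WormSpace G)
    (ψ : Finset (Sym2 V) → ℝ) :
    act (wormMatrix G x) (fun B => ψ B.1) A =
      1 / 2 * (∑ v ∈ startVertices A.1, 1 / (#(startVertices A.1) : ℝ) *
        ∑ u ∈ G.neighborFinset v, 1 / (#(G.neighborFinset v) : ℝ) *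
          (acceptance G x A.1 v u * ψ (A.1 ∆ {s(v, u)}) + (1 - acceptance G x A.1 v u) * ψ A.1)) +
        1 / 2 * ψ A.1 := by
  have hS : (0 : ℝ) < #(startVertices A.1) := by
    exact_mod_cast card_pos.mpr (startVertices_nonempty A.1)
  have h1 := sum_moveProb_mul G x A (fun _ => 1)
  simp only [mul_one] at h1
  have h2 := sum_edgeRate_mul G x A.2.2 (fun _ => 1)
  simp only [mul_one] at h2
  have e : act (wormMatrix G x) (fun B => ψ B.1) A = ψ A.1 +
      ∑ v, ∑ u ∈ G.neighborFinset v, directedRate G x A.1 v u * (ψ (A.1 ∆ {s(v, u)}) - ψ A.1) := by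
    have h3 := sum_moveProb_mul G x A ψ
    have h4 := sum_edgeRate_mul G x A.2.2 ψ
    rw [act, sum_wormMatrix_mul G x A (fun B => ψ B.1), h3, h4, h1, h2]
    simp only [mul_sub, sum_sub_distrib, ← sum_mul]
    ring
  have e2 : ∑ v, ∑ u ∈ G.neighborFinset v,
      directedRate G x A.1 v u * (ψ (A.1 ∆ {s(v, u)}) - ψ A.1) =
      ∑ v ∈ startVertices A.1, ∑ u ∈ G.neighborFinset v,
        1 / (2 * (#(startVertices A.1) : ℝ)) * (1 / (#(G.neighborFinset v) : ℝ)) *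
          (acceptance G x A.1 v u * (ψ (A.1 ∆ {s(v, u)}) - ψ A.1)) := by
    rw [← univ_inter (startVertices A.1), ← sum_ite_mem]
    refine sum_congr rfl fun v _ => ?_
    simp only [univ_inter]
    split_ifs with hv
    · refine sum_congr rfl fun u _ => ?_
      rw [directedRate, if_pos hv, G.card_neighborFinset_eq_degree]; ring
    · exact sum_eq_zero fun u _ => by rw [directedRate, if_neg hv, zero_mul]
  -- The proposal probabilities sum to one, so rejected proposals can be written as averages of `ψ
  -- A`. Positive degrees are needed here.
  have e3 : ψ A.1 = 1 / 2 * (∑ v ∈ startVertices A.1, 1 / (#(startVertices A.1) : ℝ) *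
        ∑ u ∈ G.neighborFinset v, 1 / (#(G.neighborFinset v) : ℝ) * ψ A.1) + 1 / 2 * ψ A.1 := by
    have : ∀ v ∈ startVertices A.1, 1 / (#(startVertices A.1) : ℝ) *
        ∑ u ∈ G.neighborFinset v, 1 / (#(G.neighborFinset v) : ℝ) * ψ A.1 =
        1 / (#(startVertices A.1) : ℝ) * ψ A.1 := by
      intro v _
      have hd : (0 : ℝ) < #(G.neighborFinset v) := by
        rw [G.card_neighborFinset_eq_degree]; exact_mod_cast hdeg v
      rw [sum_const, nsmul_eq_mul]; field_simp
    rw [sum_congr rfl this, sum_const, nsmul_eq_mul]; field_simp; ring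
  have e4 : 1 / 2 * (∑ v ∈ startVertices A.1, 1 / (#(startVertices A.1) : ℝ) *
        ∑ u ∈ G.neighborFinset v, 1 / (#(G.neighborFinset v) : ℝ) *
          (acceptance G x A.1 v u * ψ (A.1 ∆ {s(v, u)}) + (1 - acceptance G x A.1 v u) * ψ A.1)) =
      1 / 2 * (∑ v ∈ startVertices A.1, 1 / (#(startVertices A.1) : ℝ) *
        ∑ u ∈ G.neighborFinset v, 1 / (#(G.neighborFinset v) : ℝ) * ψ A.1) +
      ∑ v ∈ startVertices A.1, ∑ u ∈ G.neighborFinset v,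
        1 / (2 * (#(startVertices A.1) : ℝ)) * (1 / (#(G.neighborFinset v) : ℝ)) *
          (acceptance G x A.1 v u * (ψ (A.1 ∆ {s(v, u)}) - ψ A.1)) := by
    simp only [mul_sum, ← sum_add_distrib]
    refine sum_congr rfl fun v _ => sum_congr rfl fun u _ => ?_
    ring
  rw [e, e2]
  linarith

/-- One transition of the algorithm has the law given by the worm matrix. -/
lemma ev_wormStep (hx0 : 0 < x) (hx1 : x ≤ 1) (hdeg : ∀ v, 0 < G.degree v) {s : Memory V}
    {A : WormSpace G} (hs : s.Represents A.1) {φ : Memory V → ℝ≥0∞} {ψ : WormSpace G → ℝ}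
    (hψ : ∀ B, 0 ≤ ψ B)
    (hφ : ∀ (s' : Memory V) (B : WormSpace G), s'.Represents B.1 → φ s' = ENNReal.ofReal (ψ B)) :
    Comp.ev (wormStep G x s) φ = ENNReal.ofReal (act (wormMatrix G x) ψ A) := by
  obtain ⟨ψ', hψ', hext⟩ := exists_extension ψ hψ
  obtain rfl : ψ = fun B => ψ' B.1 := funext fun B => (hext B).symm
  rw [act_wormMatrix_eq hdeg]
  set q : V → ℝ := fun v => ∑ u ∈ G.neighborFinset v, 1 / (#(G.neighborFinset v) : ℝ) *
    (acceptance G x A.1 v u * ψ' (A.1 ∆ {s(v, u)}) + (1 - acceptance G x A.1 v u) * ψ' A.1) with hq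
  have hacc0 : ∀ v u, 0 ≤ acceptance G x A.1 v u * ψ' (A.1 ∆ {s(v, u)}) +
      (1 - acceptance G x A.1 v u) * ψ' A.1 := fun v u =>
    add_nonneg (mul_nonneg (acceptance_nonneg G hx0.le _ _ _) (hψ' _))
      (mul_nonneg (sub_nonneg.mpr (acceptance_le_one G hx1 _ _ _)) (hψ' _))
  have hq0 : ∀ v, 0 ≤ q v := fun v => sum_nonneg fun u _ => 
    mul_nonneg (div_nonneg zero_le_one (Nat.cast_nonneg _)) (hacc0 v u)
  have hinner : ∀ v other, IsChoice A.1 v other →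
      Comp.ev (Comp.uniform (G.neighborFinset v)) (fun u => Comp.ev (tryMove G x s (v, other) u) φ) =
        ENNReal.ofReal (q v) := by
    intro v other hc
    refine Comp.ev_uniform_ofReal ?_ (fun u _ => hacc0 v u) fun u hu => ?_
    · rw [← card_pos, G.card_neighborFinset_eq_degree]; exact hdeg v
    · exact ev_tryMove hx0 hx1 hs hc ((G.mem_neighborFinset v u).mp hu) hψ'
        (fun s' B h1 h2 h3 => hφ s' ⟨B, h3, h2⟩ h1) A.2.2 A.2.1
  have hchoose : Comp.ev (chooseVertex s.defects) (fun p =>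
      Comp.ev (Comp.uniform (G.neighborFinset p.1)) (fun u => Comp.ev (tryMove G x s p u) φ)) =
      ENNReal.ofReal (∑ v ∈ startVertices A.1, 1 / (#(startVertices A.1) : ℝ) * q v) := by
    rcases hs.2 with ⟨h1, h0⟩ | ⟨a, b, h1, hab, h2⟩
    · rw [h1, startVertices, if_pos h0]
      simp only [chooseVertex, Comp.ev_bind, Comp.ev_pure]
      exact Comp.ev_uniform_ofReal univ_nonempty (fun v _ => hq0 v)
        fun v _ => hinner v none (Or.inl ⟨rfl, h0⟩)
    · rw [h1, startVertices, if_neg (by rw [h2]; simp), h2, sum_pair hab, card_pair hab]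
      simp only [chooseVertex, Comp.ev_bind, Comp.ev_pure]
      have ha := hinner a (some b) (Or.inr ⟨b, rfl, hab, h2⟩)
      have hb := hinner b (some a) (Or.inr ⟨a, rfl, hab.symm, by rw [h2, pair_comm]⟩)
      rw [Comp.ev_fair_coin_ofReal (hq0 a) (hq0 b) (by simpa using ha) (by simpa using hb)]
      congr 1
  have hself := hφ s A hs
  have hsum0 : 0 ≤ ∑ v ∈ startVertices A.1, 1 / (#(startVertices A.1) : ℝ) * q v :=
    sum_nonneg fun v _ => mul_nonneg (div_nonneg zero_le_one (Nat.cast_nonneg _)) (hq0 v)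
  rw [wormStep_eq, Comp.ev_bind]
  exact Comp.ev_fair_coin_ofReal hsum0 (hψ' A.1)
    (by simp only [if_true, Comp.ev_bind]; exact hchoose)
    (by simp only [Bool.false_eq_true, if_false, Comp.ev_pure]; exact hself)

lemma ev_burn (hx0 : 0 < x) (hx1 : x ≤ 1) (hdeg : ∀ v, 0 < G.degree v)
    {φ : Memory V → ℝ≥0∞} {ψ : WormSpace G → ℝ} (hψ : ∀ B, 0 ≤ ψ B)
    (hφ : ∀ (s' : Memory V) (B : WormSpace G), s'.Represents B.1 → φ s' = ENNReal.ofReal (ψ B))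
    (t : ℕ) {s : Memory V} {A : WormSpace G} (hs : s.Represents A.1) :
    Comp.ev (burn G x t s) φ = ENNReal.ofReal ((act (wormMatrix G x))^[t] ψ A) := by
  have hP := wormMatrix_isLazyReversible G hx0 hx1
  have hit : ∀ j B, 0 ≤ (act (wormMatrix G x))^[j] ψ B := by
    intro j
    induction j with
    | zero => exact hψ
    | succ j ih =>
      intro B
      rw [Function.iterate_succ_apply']
      exact sum_nonneg fun t _ => mul_nonneg (hP.nonneg _ _) (ih t)
  induction t generalizing s A with
  | zero => simpa [burn, Comp.ev_pure] using hφ s A hs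
  | succ t ih =>
    simp only [burn, Comp.ev_bind, Comp.ev_tick]
    rw [Function.iterate_succ_apply']
    exact ev_wormStep hx0 hx1 hdeg hs (hit t) fun s' B hB => ih hB

lemma ev_sample (hx0 : 0 < x) (hx1 : x ≤ 1) (hdeg : ∀ v, 0 < G.degree v) {u v : V} (huv : u ≠ v)
    {g : ℕ × ℕ → ℝ} (hg : ∀ c, 0 ≤ g c) (t : ℕ) {s : Memory V} {A : WormSpace G}
    (hs : s.Represents A.1) (c₀ c₂ : ℕ) :
    Comp.ev (sample G x u v t s c₀ c₂) (fun c => ENNReal.ofReal (g c)) =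
      ENNReal.ofReal (walkMean (wormMatrix G x) (visits u v) g t A (c₀, c₂)) := by
  have hP := wormMatrix_isLazyReversible G hx0 hx1
  induction t generalizing s A c₀ c₂ with
  | zero => simp only [sample, Comp.ev_pure, walkMean]
  | succ t ih =>
    simp only [sample, Comp.ev_bind, Comp.ev_tick, Comp.ev_op]
    refine ev_wormStep hx0 hx1 hdeg hs
      (ψ := fun B => walkMean (wormMatrix G x) (visits u v) g t B ((c₀, c₂) + visits u v B))
      (fun B => walkMean_nonneg hP hg _ _ _) fun s' B hB => ?_
    rw [ih hB]
    congr 2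
    have h0 : s'.defects = none ↔ oddVertices B.1 = ∅ := by
      rcases hB.2 with ⟨h1, h2⟩ | ⟨a, b, h1, hab, h2⟩
      · simp [h1, h2]
      · rw [h1, h2]; simp
    -- The stored pair is ordered and the boundary is not, so both orders are tested.
    have h2 : (s'.defects = some (u, v) ∨ s'.defects = some (v, u)) ↔
        oddVertices B.1 = {u, v} := by
      rcases hB.2 with ⟨h1, h2⟩ | ⟨a, b, h1, hab, h2⟩
      · rw [h1, h2]
        exact iff_of_false (by simp) (insert_ne_empty _ _).symm
      · rw [h1, h2]
        simp only [Option.some.injEq, Prod.mk.injEq]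
        constructor
        · rintro (⟨rfl, rfl⟩ | ⟨rfl, rfl⟩)
          · rfl
          · exact pair_comm _ _
        · intro h
          have ha : a ∈ ({u, v} : Finset V) := by rw [← h]; simp
          have hb : b ∈ ({u, v} : Finset V) := by rw [← h]; simp
          simp only [mem_insert, mem_singleton] at ha hb
          rcases ha with rfl | rfl <;> rcases hb with rfl | rfl <;> simp_all
    simp only [visits, Prod.mk_add_mk, h0, h2]
    congr 1
    · by_cases h : oddVertices B.1 = ∅ <;> simp [h]
    · by_cases h : oddVertices B.1 = {u, v} <;> simp [h]

/-- The law of the output of the worm algorithm. -/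
lemma prob_wormAlgorithm (hdeg : ∀ v, 0 < G.degree v) {β : ℝ} (hβ : 0 < β) (k : ℕ) {u v : V}
    (huv : u ≠ v) (ε δ : ℝ) (S : Set ℝ) :
    (wormAlgorithm G β k u v ε δ).prob S =
      ENNReal.ofReal ((act (wormMatrix G (Real.tanh β)))^[burnIn G (δ / 2)]
        (fun A => walkMean (wormMatrix G (Real.tanh β)) (visits u v)
          ({c : ℕ × ℕ | (Fintype.card V : ℝ) / 2 *
            (((c.2 : ℝ) / sampleSize G (Real.tanh β) k ε δ) /
              ((c.1 : ℝ) / sampleSize G (Real.tanh β) k ε δ)) ∈ S}.indicator fun _ => (1 : ℝ))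
          (sampleSize G (Real.tanh β) k ε δ) A 0) (emptyState G)) := by
  have hx0 := tanh_pos_of_pos hβ
  have hx1 := (Real.tanh_lt_one β).le
  have hP := wormMatrix_isLazyReversible G hx0 hx1
  set good := {c : ℕ × ℕ | (Fintype.card V : ℝ) / 2 *
            (((c.2 : ℝ) / sampleSize G (Real.tanh β) k ε δ) /
              ((c.1 : ℝ) / sampleSize G (Real.tanh β) k ε δ)) ∈ S} with hgood
  have hg : ∀ c, 0 ≤ good.indicator (fun _ => (1 : ℝ)) c :=
    fun c => Set.indicator_nonneg (fun _ _ => zero_le_one) c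
  rw [Comp.prob_eq_ev, wormAlgorithm, if_neg huv]
  simp only [Comp.ev_bind, Comp.ev_tick, Comp.ev_op]
  refine ev_burn hx0 hx1 hdeg (fun B => walkMean_nonneg hP hg _ _ _) (fun s' B hB => ?_) _
    represents_empty
  rw [← Prod.mk_zero_zero, ← ev_sample hx0 hx1 hdeg huv hg _ hB]
  congr 1
  funext c
  by_cases hc : c ∈ good
  · rw [Set.indicator_of_mem hc, Set.indicator_of_mem (by exact hc)]; simp
  · rw [Set.indicator_of_notMem hc, Set.indicator_of_notMem (by exact hc)]; simp

end Correctness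

/-! ### Step counts of the program -/

section Steps

variable {V : Type} [Fintype V]

/-- Six elementary operations, one coin and the possible update. -/
lemma stepsLE_tryMove (G : SimpleGraph V) (x : ℝ) (s : Memory V) (p : V × Option V) (u : V) :
    (tryMove G x s p u).StepsLE 8 := by
  refine ((Comp.stepsLE_op _).bind fun _ => (Comp.stepsLE_op _).bind fun _ =>
    (Comp.stepsLE_op _).bind fun _ => (Comp.stepsLE_op _).bind fun _ =>
    (Comp.stepsLE_op _).bind fun _ => (Comp.stepsLE_op _).bind fun _ =>
    (Comp.stepsLE_coin _).bind fun _ => Comp.StepsLE.ite (B := 1) (Comp.stepsLE_op _)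
      ((Comp.stepsLE_pure _).mono zero_le_one)).mono (by norm_num)

variable [Nonempty V]

lemma stepsLE_chooseVertex (d : Option (V × V)) : (chooseVertex d).StepsLE 1 := by
  rcases d with _ | ⟨a, b⟩
  · exact ((Comp.stepsLE_uniform _).bind fun _ => Comp.stepsLE_pure _).mono (by norm_num)
  · exact ((Comp.stepsLE_coin _).bind fun _ => Comp.stepsLE_pure _).mono (by norm_num)

lemma stepsLE_wormStep (G : SimpleGraph V) (x : ℝ) (s : Memory V) :
    (wormStep G x s).StepsLE 11 := by
  rw [wormStep_eq]
  refine ((Comp.stepsLE_coin _).bind fun _ => Comp.StepsLE.ite (B := 10)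
    (((stepsLE_chooseVertex _).bind fun _ => (Comp.stepsLE_uniform _).bind fun _ =>
      stepsLE_tryMove _ _ _ _ _).mono (by norm_num))
    ((Comp.stepsLE_pure _).mono (by norm_num))).mono (by norm_num)

lemma stepsLE_burn (G : SimpleGraph V) (x : ℝ) (t : ℕ) (s : Memory V) :
    (burn G x t s).StepsLE (12 * t) := by
  induction t generalizing s with
  | zero => exact (Comp.stepsLE_pure s).mono (by simp)
  | succ t ih =>
    refine ((Comp.stepsLE_tick 1).bind fun _ => (stepsLE_wormStep G x s).bind fun s' =>
      ih s').mono ?_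
    push_cast; linarith

/-- Per iteration: one step for the loop, eleven for the transition and four for the counters. -/
lemma stepsLE_sample (G : SimpleGraph V) (x : ℝ) (u v : V) (t : ℕ) (s : Memory V) (c₀ c₂ : ℕ) :
    (sample G x u v t s c₀ c₂).StepsLE (16 * t) := by
  induction t generalizing s c₀ c₂ with
  | zero => exact (Comp.stepsLE_pure (c₀, c₂)).mono (by simp)
  | succ t ih =>
    refine ((Comp.stepsLE_tick 1).bind fun _ => (stepsLE_wormStep G x s).bind fun s' =>
      (Comp.stepsLE_op _).bind fun _ => (Comp.stepsLE_op _).bind fun _ =>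
      (Comp.stepsLE_op _).bind fun _ => (Comp.stepsLE_op _).bind fun _ => ih s' _ _).mono ?_
    push_cast; linarith

lemma stepsLE_wormAlgorithm (G : SimpleGraph V) (β : ℝ) (k : ℕ) (u v : V) (ε δ : ℝ) :
    (wormAlgorithm G β k u v ε δ).StepsLE (Fintype.card V + #G.edgeFinset + k + 6 +
      12 * burnIn G (δ / 2) + 16 * sampleSize G (Real.tanh β) k ε δ) := by
  unfold wormAlgorithm
  refine Comp.StepsLE.ite ((Comp.stepsLE_op _).mono ?_) ?_
  · have : (0 : ℝ) ≤ Fintype.card V + #G.edgeFinset + k +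
      12 * burnIn G (δ / 2) + 16 * sampleSize G (Real.tanh β) k ε δ := by positivity
    linarith
  · refine ((Comp.stepsLE_tick _).bind fun _ => ?_).mono
      (B := ((Fintype.card V + #G.edgeFinset : ℕ) : ℝ) + (k + 6 +
      12 * burnIn G (δ / 2) + 16 * sampleSize G (Real.tanh β) k ε δ)) (by push_cast; linarith)
    refine Comp.StepsLE.mono (B := 1 + (k + (1 + (1 + (12 * burnIn G (δ / 2) +
      (16 * sampleSize G (Real.tanh β) k ε δ + (1 + (1 + 1)))))))) ?_ (by linarith)
    exact .op_bind <| (Comp.stepsLE_tick _).bind fun _ => .op_bind <| .op_bind <|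
      (stepsLE_burn _ _ _ _).bind fun _ => (stepsLE_sample _ _ _ _ _ _ _ _).bind fun _ =>
      .op_bind <| .op_bind <| Comp.stepsLE_op _

end Steps

/-! ### Relative error, sample size and burn-in -/

section Estimates

/-- The tolerance `ζ = ε / (2 + ε)` is the solution of `(1 + ζ) / (1 - ζ) = 1 + ε`. On the lower
side `(1 - ζ) / (1 + ζ) = 1 / (1 + ε) ≥ 1 - ε`. -/
lemma ratio_estimate {ε N p q a b K : ℝ} (hε0 : 0 < ε) (hε1 : ε ≤ 1) (hN : 0 < N) (hp : 0 < p)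
    (hq : 0 < q) (hK : 0 < K) (ha : |a - N * p| ≤ ε / (2 + ε) * (N * p))
    (hb : |b - N * q| ≤ ε / (2 + ε) * (N * q)) :
    |K * ((b / N) / (a / N)) - K * (q / p)| ≤ ε * (K * (q / p)) := by
  set ζ := ε / (2 + ε) with hζ
  have hζ' : ζ * (2 + ε) = ε := by rw [hζ]; field_simp
  have hζ0 : 0 < ζ := by rw [hζ]; positivity
  have hζ1 : ζ < 1 := by nlinarith
  have e1 : (1 + ε) * (1 - ζ) = 1 + ζ := by linarith
  have e2 : (1 - ε) * (1 + ζ) ≤ 1 - ζ := by nlinarith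
  obtain ⟨ha1, ha2⟩ := abs_le.mp ha
  obtain ⟨hb1, hb2⟩ := abs_le.mp hb
  have hNp : 0 < N * p := by positivity
  have hNq : 0 < N * q := by positivity
  have ha0 : 0 < a := by nlinarith
  have hr : 0 < q / p := by positivity
  have hrp : q / p * (N * p) = N * q := by field_simp
  have hup : b ≤ (1 + ε) * (q / p) * a := by
    calc b ≤ (1 + ζ) * (N * q) := by linarith
      _ = (1 + ε) * (q / p) * ((1 - ζ) * (N * p)) := by rw [← e1, ← hrp]; ring
      _ ≤ _ := by gcongr; linarith
  have hlow : (1 - ε) * (q / p) * a ≤ b := by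
    calc (1 - ε) * (q / p) * a ≤ (1 - ε) * (q / p) * ((1 + ζ) * (N * p)) := by
          have : 0 ≤ 1 - ε := by linarith
          gcongr; linarith
      _ = (1 - ε) * (1 + ζ) * (N * q) := by rw [← hrp]; ring
      _ ≤ (1 - ζ) * (N * q) := by gcongr
      _ ≤ b := by linarith
  have hba : (b / N) / (a / N) = b / a := by field_simp
  have h1 : b / a ≤ (1 + ε) * (q / p) := (div_le_iff₀ ha0).mpr hup
  have h2 : (1 - ε) * (q / p) ≤ b / a := (le_div_iff₀ ha0).mpr hlow
  rw [hba, ← mul_sub, abs_mul, abs_of_pos hK, ← mul_assoc, mul_comm ε K, mul_assoc]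
  refine mul_le_mul_of_nonneg_left (abs_le.mpr ⟨?_, ?_⟩) hK.le <;> linarith

variable {V : Type*} [Fintype V] {G : SimpleGraph V} {β : ℝ}

lemma gapBound_pos (hE : G.edgeSet.Nonempty) : 0 < gapBound G := by
  have h1 : (0 : ℝ) < G.maxDegree := by exact_mod_cast maxDegree_pos G hE
  have h2 : (0 : ℝ) < #G.edgeFinset := by exact_mod_cast edgeFinset_card_pos G hE
  have h3 : (2 : ℝ) ≤ Fintype.card V := by exact_mod_cast two_le_card G hE
  unfold gapBound
  positivity

lemma gapBound_le_one (hE : G.edgeSet.Nonempty) : gapBound G ≤ 1 := by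
  have h1 : (1 : ℝ) ≤ G.maxDegree := by exact_mod_cast maxDegree_pos G hE
  have h2 : (1 : ℝ) ≤ #G.edgeFinset := by exact_mod_cast edgeFinset_card_pos G hE
  have h3 : (2 : ℝ) ≤ Fintype.card V := by exact_mod_cast two_le_card G hE
  have h4 : (1 : ℝ) ≤ (Fintype.card V : ℝ) ^ 2 := one_le_pow₀ (by linarith)
  unfold gapBound
  rw [div_le_one (by positivity)]
  exact one_le_mul_of_one_le_of_one_le
    (one_le_mul_of_one_le_of_one_le (by linarith) h2) h4

lemma wormZ_le (G : SimpleGraph V) (β : ℝ) :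
    wormZ G (Real.tanh β) ≤ (Fintype.card V : ℝ) ^ 2 * paritySum G (Real.tanh β) ∅ := by
  have := sum_defectWeight_mul_le G β (empty_subset G.edgeFinset)
  simp only [← bot_eq_empty, symmDiff_bot] at this
  exact this

/-- There are at most `2 ^ m` states, each of weight at most `n`. Since the empty state has weight
`n`, its stationary probability is at least `2 ^ (-m)`. -/
lemma wormZ_le_two_pow (hE : G.edgeSet.Nonempty) {x : ℝ} (hx0 : 0 < x) (hx1 : x ≤ 1) :
    wormZ G x ≤ Fintype.card V * 2 ^ #G.edgeFinset := by
  have h3 : (2 : ℝ) ≤ Fintype.card V := by exact_mod_cast two_le_card G hE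
  have h1 : ∀ A ∈ wormStates G, wormWeight x A ≤ Fintype.card V := by
    intro A _
    refine (mul_le_of_le_one_right ?_ (pow_le_one₀ hx0.le hx1)).trans ?_ <;>
      unfold defectWeight <;> split_ifs <;> linarith
  refine (sum_le_card_nsmul _ _ _ h1).trans ?_
  rw [nsmul_eq_mul, mul_comm]
  have h2 : #(wormStates G) ≤ 2 ^ #G.edgeFinset :=
    (card_filter_le _ _).trans_eq (card_powerset _)
  gcongr
  exact_mod_cast h2

/-- The stationary probability of the states with a given set of odd vertices. -/
lemma mean_indicator (G : SimpleGraph V) (x : ℝ) (W : Finset V) (hW : W = ∅ ∨ #W = 2) :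
    mean (wormDist G x) (fun A => if oddVertices A.1 = W then 1 else 0) =
      (if W = ∅ then (Fintype.card V : ℝ) else 2) * paritySum G x W / wormZ G x := by
  have h1 : mean (wormDist G x) (fun A => if oddVertices A.1 = W then 1 else 0) =
      ∑ A ∈ wormStates G, if oddVertices A = W then wormWeight x A / wormZ G x else 0 := by
    rw [← sum_wormSpace G (fun A => if oddVertices A = W then wormWeight x A / wormZ G x else 0)]
    refine sum_congr rfl fun A _ => ?_
    simp only [wormDist, mul_ite, mul_one, mul_zero]
  rw [h1, ← sum_filter, paritySum, mul_sum, sum_div]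
  refine sum_congr ?_ fun A hA => ?_
  · ext A
    simp only [mem_filter, mem_wormStates, mem_powerset, IsWorm]
    constructor
    · rintro ⟨⟨h, -⟩, h'⟩; exact ⟨h, h'⟩
    · rintro ⟨h, rfl⟩; exact ⟨⟨h, hW⟩, rfl⟩
  · rw [wormWeight, defectWeight, (mem_filter.mp hA).2]

variable [Nonempty V]

/-- Concentration of the sample means in equilibrium. -/
lemma mean_bad_le (hE : G.edgeSet.Nonempty) (hβ : 0 < β) {k : ℕ}
    {ε : ℝ} (hε : ε ∈ Set.Ioc (0 : ℝ) 1) {δ : ℝ} (hδ : δ ∈ Set.Ioc (0 : ℝ) 1)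
    {f : WormSpace G → ℕ × ℕ} (ℓ : ℕ × ℕ → ℝ) (W : Finset V)
    (hℓ : ∀ y A, ℓ (y + f A) = ℓ y + if oddVertices A.1 = W then 1 else 0) (hℓ0 : ℓ 0 = 0)
    (hp : Real.tanh β ^ k / (Fintype.card V : ℝ) ^ 2 ≤
      mean (wormDist G (Real.tanh β)) (fun A => if oddVertices A.1 = W then 1 else 0)) :
    mean (wormDist G (Real.tanh β)) (fun A => walkMean (wormMatrix G (Real.tanh β)) f
      (fun y => if |ℓ y - sampleSize G (Real.tanh β) k ε δ *
          mean (wormDist G (Real.tanh β)) (fun A => if oddVertices A.1 = W then 1 else 0)| ≤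
          ε / (2 + ε) * (sampleSize G (Real.tanh β) k ε δ *
          mean (wormDist G (Real.tanh β)) (fun A => if oddVertices A.1 = W then 1 else 0))
        then 0 else 1) (sampleSize G (Real.tanh β) k ε δ) A 0) ≤ 5 * δ / 16 := by
  set x := Real.tanh β with hx
  have hx0 : 0 < x := tanh_pos_of_pos hβ
  have hx1 : x ≤ 1 := (Real.tanh_lt_one β).le
  set p := mean (wormDist G x) (fun A => if oddVertices A.1 = W then 1 else 0) with hpdef
  set N := sampleSize G x k ε δ with hN
  have hΔ : (0 : ℝ) < G.maxDegree := by exact_mod_cast maxDegree_pos G hE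
  have hm : (0 : ℝ) < #G.edgeFinset := by exact_mod_cast edgeFinset_card_pos G hE
  have hn : (2 : ℝ) ≤ Fintype.card V := by exact_mod_cast two_le_card G hE
  obtain ⟨hε0, hε1⟩ := hε
  obtain ⟨hδ0, hδ1⟩ := hδ
  have hxk : 0 < x ^ k := pow_pos hx0 k
  have hp0 : 0 < p := lt_of_lt_of_le (by positivity) hp
  have hNle : 16 * (ε ^ 2)⁻¹ * (2 + ε) ^ 2 * δ⁻¹ * (G.maxDegree : ℝ) * (#G.edgeFinset : ℝ) *
      (Fintype.card V : ℝ) ^ 6 * (x ^ k)⁻¹ ≤ N := Nat.le_ceil _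
  have hN0 : (0 : ℝ) < N := lt_of_lt_of_le (by positivity) hNle
  have hsq : mean (wormDist G x) (fun A => (if oddVertices A.1 = W then (1 : ℝ) else 0) ^ 2) = p := by
    rw [hpdef]; congr 1; funext A; split_ifs <;> norm_num
  have h := mean_walkMean_ite_le (wormMatrix_isLazyReversible G hx0 hx1) (hasGap_wormMatrix G hE hβ)
    (gapBound_pos hE) (gapBound_le_one hE) ℓ (fun A => if oddVertices A.1 = W then (1 : ℝ) else 0)
    hℓ 0 hℓ0 N (r := ε / (2 + ε) * (N * p)) (by positivity)
  refine h.trans ?_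
  rw [hsq, div_le_iff₀ (by positivity), gapBound]
  set Δ := (G.maxDegree : ℝ)
  set m := (#G.edgeFinset : ℝ)
  set n := (Fintype.card V : ℝ)
  have hn4 : 4 ≤ n ^ 2 := by nlinarith
  have hp' : x ^ k ≤ p * n ^ 2 := (div_le_iff₀ (by positivity)).mp hp
  -- The factor `n⁶` in the sample size pays `n²` for the inverse gap and `n²` for the lower bound
  -- on `p`. The remaining `n² ≥ 4` supplies a spare factor four.
  have key : 64 * Δ * m * n ^ 2 ≤ δ * (ε / (2 + ε)) ^ 2 * N * p := by
    calc 64 * Δ * m * n ^ 2 ≤ 16 * Δ * m * n ^ 4 * (x ^ k * (x ^ k)⁻¹) := by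
          rw [mul_inv_cancel₀ hxk.ne']
          have : n ^ 4 = n ^ 2 * n ^ 2 := by ring
          have h3 : 0 ≤ 16 * Δ * m * n ^ 2 * (n ^ 2 - 4) :=
            mul_nonneg (by positivity) (by linarith)
          nlinarith
      _ ≤ 16 * Δ * m * n ^ 4 * (p * n ^ 2 * (x ^ k)⁻¹) := by gcongr
      _ = δ * (ε / (2 + ε)) ^ 2 * (16 * (ε ^ 2)⁻¹ * (2 + ε) ^ 2 * δ⁻¹ * Δ * m * n ^ 6 * (x ^ k)⁻¹)
            * p := by field_simp
      _ ≤ _ := by gcongr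
  have e1 : (N : ℝ) * (5 / (1 / (4 * Δ * m * n ^ 2)) * p) =
      5 / 16 * (N * p) * (64 * Δ * m * n ^ 2) := by field_simp; ring
  rw [e1]
  calc _ ≤ 5 / 16 * (N * p) * (δ * (ε / (2 + ε)) ^ 2 * N * p) := by gcongr
    _ = _ := by ring

/-- After the burn-in time the chain is close to equilibrium. -/
lemma burnIn_estimate (hE : G.edgeSet.Nonempty) (hβ : 0 < β)
    {δ : ℝ} (hδ : δ ∈ Set.Ioc (0 : ℝ) 1) {ψ : WormSpace G → ℝ} (h0 : ∀ A, 0 ≤ ψ A)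
    (h1 : ∀ A, ψ A ≤ 1) :
    mean (wormDist G (Real.tanh β)) ψ - δ / 4 ≤
      (act (wormMatrix G (Real.tanh β)))^[burnIn G (δ / 2)] ψ (emptyState G) := by
  set x := Real.tanh β with hx
  have hx0 : 0 < x := tanh_pos_of_pos hβ
  have hx1 : x ≤ 1 := (Real.tanh_lt_one β).le
  obtain ⟨hδ0, hδ1⟩ := hδ
  have hmix := sq_iterate_act_sub_mean_le (wormMatrix_isLazyReversible G hx0 hx1)
    (hasGap_wormMatrix G hE hβ) (gapBound_le_one hE) h0 h1 (burnIn G (δ / 2)) (emptyState G)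
  set τ := burnIn G (δ / 2) with hτ
  set d := (act (wormMatrix G x))^[τ] ψ (emptyState G) - mean (wormDist G x) ψ with hd
  have hΔ : (0 : ℝ) < G.maxDegree := by exact_mod_cast maxDegree_pos G hE
  have hm : (0 : ℝ) < #G.edgeFinset := by exact_mod_cast edgeFinset_card_pos G hE
  have hn : (2 : ℝ) ≤ Fintype.card V := by exact_mod_cast two_le_card G hE
  have hpi : ((1 : ℝ) / 2) ^ #G.edgeFinset ≤ wormDist G x (emptyState G) := by
    rw [wormDist, le_div_iff₀ (wormZ_pos G hx0)]
    have : wormWeight x (emptyState G).1 = Fintype.card V := by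
      simp [wormWeight, defectWeight, emptyState, oddVertices_empty]
    rw [this, one_div, inv_pow, inv_mul_le_iff₀ (by positivity), mul_comm]
    exact wormZ_le_two_pow hE hx0 hx1
  have hL : 0 ≤ Real.log (2 * (δ / 2)⁻¹) := Real.log_nonneg (by
    rw [inv_div, mul_div_assoc', le_div_iff₀ hδ0]; linarith)
  have hl2 : 0 ≤ Real.log 2 := Real.log_nonneg (by norm_num)
  have hτle : 4 * (Real.log 2 + Real.log (2 * (δ / 2)⁻¹) / (#G.edgeFinset : ℝ)) *
      (G.maxDegree : ℝ) * (#G.edgeFinset : ℝ) ^ 2 * (Fintype.card V : ℝ) ^ 4 ≤ τ := Nat.le_ceil _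
  -- The burn-in exceeds its natural scale by `n²`. A factor two of this is used to obtain the
  -- square of `δ / 4` that the L² bound requires.
  have hγτ : #G.edgeFinset * Real.log 2 + 2 * Real.log (2 * (δ / 2)⁻¹) ≤ τ * gapBound G := by
    set m := (#G.edgeFinset : ℝ)
    set n := (Fintype.card V : ℝ)
    set Δ := (G.maxDegree : ℝ)
    set L := Real.log (2 * (δ / 2)⁻¹)
    have hn4 : 2 ≤ n ^ 2 := by nlinarith
    calc m * Real.log 2 + 2 * L ≤ 2 * (m * Real.log 2 + L) := by
          have : 0 ≤ m * Real.log 2 := by positivity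
          linarith
      _ ≤ n ^ 2 * (m * Real.log 2 + L) := by gcongr
      _ = (4 * (Real.log 2 + L / m) * Δ * m ^ 2 * n ^ 4) * (1 / (4 * Δ * m * n ^ 2)) := by
          field_simp
      _ ≤ _ := by rw [gapBound]; gcongr
  have hpow : (1 - gapBound G) ^ τ ≤ (1 / 2) ^ #G.edgeFinset * (δ / 4) ^ 2 := by
    have hexp : 1 - gapBound G ≤ Real.exp (-gapBound G) := by
      have := Real.add_one_le_exp (-gapBound G); linarith
    calc (1 - gapBound G) ^ τ ≤ Real.exp (-gapBound G) ^ τ :=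
          pow_le_pow_left₀ (by linarith [gapBound_le_one hE]) hexp _
      _ = Real.exp (-(τ * gapBound G)) := by rw [← Real.exp_nat_mul]; ring_nf
      _ ≤ Real.exp (-(#G.edgeFinset * Real.log 2 + 2 * Real.log (2 * (δ / 2)⁻¹))) := by gcongr
      _ = _ := by
          have e1 : Real.exp (#G.edgeFinset * Real.log 2) = 2 ^ #G.edgeFinset := by
            rw [Real.exp_nat_mul, Real.exp_log (by norm_num)]
          have e2 : Real.exp (2 * Real.log (2 * (δ / 2)⁻¹)) = (2 * (δ / 2)⁻¹) ^ 2 := by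
            have := Real.exp_nat_mul (Real.log (2 * (δ / 2)⁻¹)) 2
            rw [Real.exp_log (by positivity)] at this
            exact_mod_cast this
          rw [Real.exp_neg, Real.exp_add, e1, e2, mul_inv, one_div, inv_pow]
          congr 1
          field_simp
          norm_num
  have hsq : d ^ 2 ≤ (δ / 4) ^ 2 := by
    have h2 : (0 : ℝ) < (1 / 2) ^ #G.edgeFinset := by positivity
    refine le_of_mul_le_mul_left ?_ h2
    exact (mul_le_mul_of_nonneg_right hpi (sq_nonneg d)).trans (hmix.trans hpow)
  have := abs_le_of_sq_le_sq' hsq (by linarith)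
  linarith [this.1]

/-- The numbers of visits for which the estimate is good. -/
def goodCounts (G : SimpleGraph V) (β : ℝ) (k : ℕ) (u v : V) (ε δ : ℝ) : Set (ℕ × ℕ) :=
  {c : ℕ × ℕ | (Fintype.card V : ℝ) / 2 * (((c.2 : ℝ) / sampleSize G (Real.tanh β) k ε δ) /
      ((c.1 : ℝ) / sampleSize G (Real.tanh β) k ε δ)) ∈
    {z : ℝ | |z - correlation G β u v| ≤ ε * correlation G β u v}}

/-- The success probability of the worm estimator. -/
lemma one_sub_le_success (hG : G.Connected) (hE : G.edgeSet.Nonempty) (hβ : 0 < β) {k : ℕ}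
    {u v : V} (huv : u ≠ v) (hk : G.dist u v ≤ k)
    {ε : ℝ} (hε : ε ∈ Set.Ioc (0 : ℝ) 1) {δ : ℝ} (hδ : δ ∈ Set.Ioc (0 : ℝ) 1) :
    1 - δ ≤ (act (wormMatrix G (Real.tanh β)))^[burnIn G (δ / 2)]
        (fun A => walkMean (wormMatrix G (Real.tanh β)) (visits u v)
          ((goodCounts G β k u v ε δ).indicator fun _ => (1 : ℝ))
          (sampleSize G (Real.tanh β) k ε δ) A 0) (emptyState G) := by
  have hx0 : 0 < Real.tanh β := tanh_pos_of_pos hβ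
  have hx1 : Real.tanh β ≤ 1 := (Real.tanh_lt_one β).le
  have hP := wormMatrix_isLazyReversible G hx0 hx1
  have hn : (2 : ℝ) ≤ Fintype.card V := by exact_mod_cast two_le_card G hE
  have hZ := wormZ_pos G hx0
  have hZle := wormZ_le G β
  have hl := pow_mul_paritySum_le G hG hx0 hx1 huv hk
  have hcorr := correlation_eq G β huv
  have hp0 := mean_indicator G (Real.tanh β) ∅ (Or.inl rfl)
  have hp2 := mean_indicator G (Real.tanh β) {u, v} (Or.inr (card_pair huv))
  rw [if_pos rfl] at hp0
  rw [if_neg (insert_ne_empty _ _)] at hp2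
  have hl0 : 0 < paritySum G (Real.tanh β) ∅ := paritySum_empty_pos G hx0
  have hxk : 0 < Real.tanh β ^ k := pow_pos hx0 k
  have hxk1 : Real.tanh β ^ k ≤ 1 := pow_le_one₀ hx0.le hx1
  -- The even states have probability at least `1 / n`, more than is needed here.
  have hb0 : Real.tanh β ^ k / (Fintype.card V : ℝ) ^ 2 ≤
      mean (wormDist G (Real.tanh β)) (fun A => if oddVertices A.1 = ∅ then 1 else 0) := by
    rw [hp0, div_le_div_iff₀ (by positivity) hZ]
    have h1 : Real.tanh β ^ k * wormZ G (Real.tanh β) ≤ 1 * wormZ G (Real.tanh β) :=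
      mul_le_mul_of_nonneg_right hxk1 hZ.le
    have h2 : 1 * ((Fintype.card V : ℝ) ^ 2 * paritySum G (Real.tanh β) ∅) ≤
        Fintype.card V * ((Fintype.card V : ℝ) ^ 2 * paritySum G (Real.tanh β) ∅) := by
      gcongr; linarith
    linarith
  have hb2 : Real.tanh β ^ k / (Fintype.card V : ℝ) ^ 2 ≤
      mean (wormDist G (Real.tanh β)) (fun A => if oddVertices A.1 = {u, v} then 1 else 0) := by
    rw [hp2, div_le_div_iff₀ (by positivity) hZ]
    have h1 := mul_le_mul_of_nonneg_left hZle hxk.le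
    have h2 := mul_le_mul_of_nonneg_right hl (by positivity : (0 : ℝ) ≤ (Fintype.card V : ℝ) ^ 2)
    have h3 : 0 ≤ Real.tanh β ^ k * paritySum G (Real.tanh β) ∅ * (Fintype.card V : ℝ) ^ 2 := by
      positivity
    linarith
  have hbad0 := mean_bad_le hE hβ hε hδ (f := visits u v) (fun c => (c.1 : ℝ)) ∅
    (fun y A => by simp [visits]) (by simp) hb0
  have hbad2 := mean_bad_le hE hβ hε hδ (f := visits u v) (fun c => (c.2 : ℝ)) {u, v}
    (fun y A => by simp [visits]) (by simp) hb2
  set p := mean (wormDist G (Real.tanh β)) (fun A => if oddVertices A.1 = ∅ then 1 else 0)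
  set q := mean (wormDist G (Real.tanh β)) (fun A => if oddVertices A.1 = {u, v} then 1 else 0)
  set N := sampleSize G (Real.tanh β) k ε δ with hN
  set P := wormMatrix G (Real.tanh β)
  have hppos : 0 < p := lt_of_lt_of_le (by positivity) hb0
  have hqpos : 0 < q := lt_of_lt_of_le (by positivity) hb2
  -- The defect weights `2` and `n` give `q / p = (2 / n) Z_uv / Z_∅`, which explains the prefactor
  -- of the estimator.
  have hcorr' : correlation G β u v = (Fintype.card V : ℝ) / 2 * (q / p) := by
    rw [hcorr, hp0, hp2]; field_simp
  have hN0 : (0 : ℝ) < N := by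
    have hΔ : (0 : ℝ) < G.maxDegree := by exact_mod_cast maxDegree_pos G hE
    have hm : (0 : ℝ) < #G.edgeFinset := by exact_mod_cast edgeFinset_card_pos G hE
    have := hε.1
    have := hδ.1
    refine lt_of_lt_of_le ?_ (Nat.le_ceil _)
    positivity
  set φ₀ : ℕ × ℕ → ℝ := fun c => if |(c.1 : ℝ) - N * p| ≤ ε / (2 + ε) * (N * p) then 0 else 1
    with hφ₀
  set φ₂ : ℕ × ℕ → ℝ := fun c => if |(c.2 : ℝ) - N * q| ≤ ε / (2 + ε) * (N * q) then 0 else 1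
    with hφ₂
  set good := goodCounts G β k u v ε δ with hgood
  -- The union bound as a pointwise inequality: a pair of counts is good, or one of the counts
  -- deviates.
  have hind : ∀ c, 1 ≤ good.indicator (fun _ => (1 : ℝ)) c + (φ₀ c + φ₂ c) := by
    intro c
    have hi : 0 ≤ good.indicator (fun _ => (1 : ℝ)) c :=
      Set.indicator_nonneg (fun _ _ => zero_le_one) c
    by_cases h0 : |(c.1 : ℝ) - N * p| ≤ ε / (2 + ε) * (N * p)
    · by_cases h2 : |(c.2 : ℝ) - N * q| ≤ ε / (2 + ε) * (N * q)
      · have hc : c ∈ good := by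
          simp only [hgood, goodCounts, Set.mem_ofPred_eq]
          rw [hcorr']
          exact ratio_estimate hε.1 hε.2 hN0 hppos hqpos (by positivity) h0 h2
        simp [hφ₀, hφ₂, h0, h2, hc]
      · simp only [hφ₀, hφ₂, h0, h2, if_true, if_false]; linarith
    · have : 0 ≤ φ₂ c := by simp only [hφ₂]; split_ifs <;> norm_num
      simp only [hφ₀, h0, if_false]; linarith
  have hstat : 1 - 5 * δ / 8 ≤ mean (wormDist G (Real.tanh β))
      (fun A => walkMean P (visits u v) (good.indicator fun _ => (1 : ℝ)) N A 0) := by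
    have h1 : ∀ A : WormSpace G, 1 ≤
        walkMean P (visits u v) (good.indicator fun _ => (1 : ℝ)) N A 0 +
          (walkMean P (visits u v) φ₀ N A 0 + walkMean P (visits u v) φ₂ N A 0) := by
      intro A
      rw [← walkMean_add, ← walkMean_add]
      exact (walkMean_const hP 1 N A 0).symm.trans_le (walkMean_mono hP hind N A 0)
    have h2 := mean_mono hP h1
    rw [mean_const hP, mean_add, mean_add] at h2
    linarith
  have hburn := burnIn_estimate hE hβ hδ
    (ψ := fun A => walkMean P (visits u v) (good.indicator fun _ => (1 : ℝ)) N A 0)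
    (fun A => walkMean_nonneg hP (fun c => Set.indicator_nonneg (fun _ _ => zero_le_one) c) _ _ _)
    (fun A => (walkMean_mono hP (fun c => Set.indicator_le_self' (fun _ _ => zero_le_one) c) N A
      0).trans_eq (walkMean_const hP 1 N A 0))
  have := hδ.1
  linarith

/-- Both counts are carried as one functional with values in `ℕ × ℕ`, so they come from the same
trajectory and no independence is used. -/
lemma measure_estimator (hG : G.Connected) (hE : G.edgeSet.Nonempty) (hβ : 0 < β) {k : ℕ}
    {u v : V} (huv : u ≠ v) (hk : G.dist u v ≤ k)
    {ε : ℝ} (hε : ε ∈ Set.Ioc (0 : ℝ) 1) {δ : ℝ} (hδ : δ ∈ Set.Ioc (0 : ℝ) 1)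
    {Ω : Type*} [MeasurableSpace Ω] {μ : MeasureTheory.Measure Ω} {X : ℕ → Ω → WormSpace G}
    (hX : IsWormChain G (Real.tanh β) μ X) :
    ENNReal.ofReal (1 - δ) ≤
      μ {ω | |correlationEstimator (burnIn G (δ / 2)) (sampleSize G (Real.tanh β) k ε δ)
        (fun t => X t ω) u v - correlation G β u v| ≤ ε * correlation G β u v} := by
  have hP := wormMatrix_isLazyReversible G (tanh_pos_of_pos hβ) (Real.tanh_lt_one β).le
  have hlaw := measure_burnIn_walk hX hP.nonneg (visits u v) (goodCounts G β k u v ε δ)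
    (sampleSize G (Real.tanh β) k ε δ) (burnIn G (δ / 2))
    (fun N s y => walkMean_nonneg hP (fun c => Set.indicator_nonneg (fun _ _ => zero_le_one) c) _ _ _)
  refine (ENNReal.ofReal_le_ofReal (one_sub_le_success hG hE hβ huv hk hε hδ)).trans ?_
  rw [← hlaw]
  refine le_of_eq (congrArg μ (Set.ext fun ω => ?_))
  simp only [goodCounts, Set.mem_ofPred_eq, correlationEstimator, visitFraction, Prod.fst_sum,
    Prod.snd_sum, visits, Nat.cast_sum, Nat.cast_ite, Nat.cast_one, Nat.cast_zero, one_div,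
    inv_mul_eq_div]

end Estimates

/-! ### Sizes of the sample and of the burn-in -/

section Scale

variable {V : Type*} [Fintype V] {G : SimpleGraph V} {x ε δ : ℝ}

/-- The order of magnitude of the number of steps. -/
def stepScale (G : SimpleGraph V) (x : ℝ) (k : ℕ) (ε δ : ℝ) : ℝ :=
  (ε ^ 2)⁻¹ * δ⁻¹ * (G.maxDegree : ℝ) * (#G.edgeFinset : ℝ) * (Fintype.card V : ℝ) ^ 6 * (x ^ k)⁻¹

lemma edgeFinset_card_le_sq (G : SimpleGraph V) :
    (#G.edgeFinset : ℝ) ≤ (Fintype.card V : ℝ) ^ 2 := by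
  have h := G.card_edgeFinset_le_card_choose_two
  have h2 : (Fintype.card V).choose 2 ≤ Fintype.card V ^ 2 := Nat.choose_le_pow _ _
  exact_mod_cast h.trans h2

lemma le_stepScale (hx0 : 0 < x) (hx1 : x ≤ 1) (k : ℕ)
    (hε : ε ∈ Set.Ioc (0 : ℝ) 1) (hδ : δ ∈ Set.Ioc (0 : ℝ) 1) :
    δ⁻¹ * (G.maxDegree : ℝ) * (#G.edgeFinset : ℝ) * (Fintype.card V : ℝ) ^ 6 ≤
      stepScale G x k ε δ := by
  have h1 : 1 ≤ (ε ^ 2)⁻¹ := (one_le_inv₀ (pow_pos hε.1 2)).mpr (pow_le_one₀ hε.1.le hε.2)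
  have h2 : 1 ≤ (x ^ k)⁻¹ := (one_le_inv₀ (pow_pos hx0 k)).mpr (pow_le_one₀ hx0.le hx1)
  have h3 := hδ.1
  set B := δ⁻¹ * (G.maxDegree : ℝ) * (#G.edgeFinset : ℝ) * (Fintype.card V : ℝ) ^ 6 with hB
  have hB0 : 0 ≤ B := by positivity
  calc B = 1 * B * 1 := by ring
    _ ≤ (ε ^ 2)⁻¹ * B * (x ^ k)⁻¹ := by gcongr
    _ = _ := by rw [stepScale, hB]; ring

lemma card_and_edges_le_stepScale (hE : G.edgeSet.Nonempty) (hx0 : 0 < x) (hx1 : x ≤ 1) (k : ℕ)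
    (hε : ε ∈ Set.Ioc (0 : ℝ) 1) (hδ : δ ∈ Set.Ioc (0 : ℝ) 1) :
    1 ≤ stepScale G x k ε δ ∧ (Fintype.card V : ℝ) ≤ stepScale G x k ε δ ∧
      (#G.edgeFinset : ℝ) ≤ stepScale G x k ε δ := by
  have h := le_stepScale (G := G) hx0 hx1 k hε hδ
  have h1 : (1 : ℝ) ≤ G.maxDegree := by exact_mod_cast maxDegree_pos G hE
  have h2 : (1 : ℝ) ≤ #G.edgeFinset := by exact_mod_cast edgeFinset_card_pos G hE
  have h3 : (1 : ℝ) ≤ Fintype.card V := by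
    exact_mod_cast (Nat.le_of_succ_le (two_le_card G hE))
  have h4 : 1 ≤ δ⁻¹ := (one_le_inv₀ hδ.1).mpr hδ.2
  have h5 : (Fintype.card V : ℝ) ≤ (Fintype.card V : ℝ) ^ 6 := le_self_pow₀ h3 (by norm_num)
  have h6 : 1 ≤ δ⁻¹ * (G.maxDegree : ℝ) := one_le_mul_of_one_le_of_one_le h4 h1
  have h7 : (#G.edgeFinset : ℝ) ≤ δ⁻¹ * (G.maxDegree : ℝ) * (#G.edgeFinset : ℝ) :=
    le_mul_of_one_le_left (by linarith) h6
  have h8 : (#G.edgeFinset : ℝ) ≤ stepScale G x k ε δ :=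
    (h7.trans (le_mul_of_one_le_right (by linarith) (h3.trans h5))).trans h
  exact ⟨h2.trans h8, (h5.trans (le_mul_of_one_le_left (by linarith) (h2.trans h7))).trans h, h8⟩

/-- `16 (2 + ε)² ≤ 144`, and one more for rounding up. -/
lemma sampleSize_le (hE : G.edgeSet.Nonempty) (hx0 : 0 < x) (hx1 : x ≤ 1) (k : ℕ)
    (hε : ε ∈ Set.Ioc (0 : ℝ) 1) (hδ : δ ∈ Set.Ioc (0 : ℝ) 1) :
    (sampleSize G x k ε δ : ℝ) ≤ 145 * stepScale G x k ε δ := by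
  have h1 := (card_and_edges_le_stepScale hE hx0 hx1 k hε hδ).1
  have h0 : 0 ≤ stepScale G x k ε δ := zero_le_one.trans h1
  have he : 16 * (ε ^ 2)⁻¹ * (2 + ε) ^ 2 * δ⁻¹ * (G.maxDegree : ℝ) * (#G.edgeFinset : ℝ) *
      (Fintype.card V : ℝ) ^ 6 * (x ^ k)⁻¹ = 16 * (2 + ε) ^ 2 * stepScale G x k ε δ := by
    rw [stepScale]; ring
  have h9 : (2 + ε) ^ 2 ≤ 9 := by nlinarith [hε.1, hε.2]
  have h2 : 16 * (2 + ε) ^ 2 * stepScale G x k ε δ ≤ 16 * 9 * stepScale G x k ε δ := by gcongr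
  rw [sampleSize, he]
  have := (Nat.ceil_lt_add_one (by positivity : 0 ≤ 16 * (2 + ε) ^ 2 * stepScale G x k ε δ)).le
  linarith

lemma burnIn_le (hE : G.edgeSet.Nonempty) (hx0 : 0 < x) (hx1 : x ≤ 1) (k : ℕ)
    (hε : ε ∈ Set.Ioc (0 : ℝ) 1) (hδ : δ ∈ Set.Ioc (0 : ℝ) 1) :
    (burnIn G (δ / 2) : ℝ) ≤ 21 * stepScale G x k ε δ := by
  have h1 := (card_and_edges_le_stepScale hE hx0 hx1 k hε hδ).1
  have h := le_stepScale (G := G) hx0 hx1 k hε hδ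
  have hm : (1 : ℝ) ≤ #G.edgeFinset := by exact_mod_cast edgeFinset_card_pos G hE
  have hδ0 := hδ.1
  have hmn := edgeFinset_card_le_sq G
  have hd1 : 1 ≤ δ⁻¹ := (one_le_inv₀ hδ.1).mpr hδ.2
  have hLe : 2 * (δ / 2)⁻¹ = 4 * δ⁻¹ := by field_simp; norm_num
  have hL0 : 0 ≤ Real.log (2 * (δ / 2)⁻¹) := Real.log_nonneg (by rw [hLe]; linarith)
  have hL : Real.log (2 * (δ / 2)⁻¹) / (#G.edgeFinset : ℝ) ≤ 4 * δ⁻¹ := by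
    refine (div_le_self hL0 hm).trans ?_
    rw [hLe]
    exact (Real.log_le_self (by positivity))
  have hl2 : Real.log 2 ≤ 1 := (Real.log_le_sub_one_of_pos (by norm_num)).trans (by norm_num)
  have hl20 : 0 ≤ Real.log 2 := Real.log_nonneg (by norm_num)
  rw [burnIn]
  set m := (#G.edgeFinset : ℝ)
  set n := (Fintype.card V : ℝ)
  set Δ := (G.maxDegree : ℝ)
  set L := Real.log (2 * (δ / 2)⁻¹)
  have hn0 : 0 ≤ n := Nat.cast_nonneg _
  have hΔ0 : 0 ≤ Δ := Nat.cast_nonneg _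
  -- One factor `m ≤ n²` trades `m² n⁴` for `m n⁶`, and `log 2 + L / m ≤ 1 + 4 / δ ≤ 5 / δ`.
  have hb : 4 * (Real.log 2 + L / m) * Δ * m ^ 2 * n ^ 4 ≤ 20 * (δ⁻¹ * Δ * m * n ^ 6) := by
    calc 4 * (Real.log 2 + L / m) * Δ * m ^ 2 * n ^ 4
        = 4 * (Real.log 2 + L / m) * Δ * (m * m) * n ^ 4 := by ring
      _ ≤ 4 * (5 * δ⁻¹) * Δ * (m * n ^ 2) * n ^ 4 := by
          gcongr
          linarith
      _ = _ := by ring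
  have := (Nat.ceil_lt_add_one
    (by positivity : 0 ≤ 4 * (Real.log 2 + L / m) * Δ * m ^ 2 * n ^ 4)).le
  linarith

end Scale

/-! ### Total cost and the approximation scheme -/

section Main

lemma stepsLE_wormAlgorithm_scale {V : Type} [Fintype V] [Nonempty V] {G : SimpleGraph V}
    (hE : G.edgeSet.Nonempty) {β : ℝ} (hβ : 0 < β) (k : ℕ) (u v : V) {ε δ : ℝ}
    (hε : ε ∈ Set.Ioc (0 : ℝ) 1) (hδ : δ ∈ Set.Ioc (0 : ℝ) 1) :
    (wormAlgorithm G β k u v ε δ).StepsLE ((2580 + k) * stepScale G (Real.tanh β) k ε δ) := by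
  have hx0 := tanh_pos_of_pos hβ
  have hx1 := (Real.tanh_lt_one β).le
  refine (stepsLE_wormAlgorithm G β k u v ε δ).mono ?_
  obtain ⟨h1, h2, h3⟩ := card_and_edges_le_stepScale hE hx0 hx1 k hε hδ
  have h4 := sampleSize_le hE hx0 hx1 k hε hδ
  have h5 := burnIn_le hE hx0 hx1 k hε hδ
  have h6 : (k : ℝ) ≤ k * stepScale G (Real.tanh β) k ε δ :=
    le_mul_of_one_le_right (Nat.cast_nonneg _) h1
  -- The constant is `1 + 1 + 6 + 12 · 21 + 16 · 145 = 2580`, plus `k` for the power of `x`.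
  linarith

lemma tanh_mono {a b : ℝ} (h : a ≤ b) : Real.tanh a ≤ Real.tanh b := by
  have ha := Real.cosh_pos a
  have hb := Real.cosh_pos b
  rw [Real.tanh_eq_sinh_div_cosh, Real.tanh_eq_sinh_div_cosh, div_le_div_iff₀ ha hb]
  have := Real.sinh_nonneg_iff.mpr (sub_nonneg.mpr h)
  rw [Real.sinh_sub] at this
  linarith

lemma approximates_wormAlgorithm {V : Type} [Fintype V] [Nonempty V] {G : SimpleGraph V}
    (hG : G.Connected) (hE : G.edgeSet.Nonempty) {β : ℝ} (hβ : 0 < β) {k : ℕ} {u v : V}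
    (hk : G.dist u v ≤ k) {ε δ : ℝ} (hε : ε ∈ Set.Ioc (0 : ℝ) 1) (hδ : δ ∈ Set.Ioc (0 : ℝ) 1) :
    (wormAlgorithm G β k u v ε δ).Approximates (correlation G β u v) ε δ := by
  unfold Comp.Approximates
  by_cases huv : u = v
  · subst huv
    rw [wormAlgorithm, if_pos rfl, Comp.prob_eq_ev, Comp.ev_op, correlation_self,
      Set.indicator_of_mem (by simp [hε.1.le])]
    exact (ENNReal.ofReal_le_ofReal (by linarith [hδ.1] : 1 - δ ≤ 1)).trans_eq ENNReal.ofReal_one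
  -- In a connected graph with two vertices every vertex has a neighbour, so the neighbour choice is
  -- always a genuine uniform one.
  · have hnt : Nontrivial V := ⟨u, v, huv⟩
    have hdeg : ∀ w, 0 < G.degree w := fun w => hG.preconnected.degree_pos_of_nontrivial w
    rw [prob_wormAlgorithm hdeg hβ k huv ε δ]
    exact ENNReal.ofReal_le_ofReal (one_sub_le_success hG hE hβ huv hk hε hδ)

lemma isFPRAS_worm (k : ℕ) (β₀ : ℝ) (hβ₀ : 0 < β₀) :
    IsFPRAS (fun i : CorrelationInstance k β₀ => i.n) (fun i => i.value)
      (fun i ε δ => i.run ε δ) := by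
  refine ⟨fun i ε hε δ hδ => ?_, ?_⟩
  · have : Nonempty (Fin i.n) := i.connected.nonempty
    exact approximates_wormAlgorithm i.connected i.edge_nonempty (hβ₀.trans_le i.le_β) i.pair.2 hε hδ
  -- The exponent nine comes from `Δ ≤ n`, `m ≤ n²` and `n⁶`. The bound `β ≥ β₀` makes the factor `x
  -- ^ (-k)` a constant.
  · refine ⟨MvPolynomial.C ((2580 + k) * (Real.tanh β₀ ^ k)⁻¹) * MvPolynomial.X 1 ^ 2 *
      MvPolynomial.X 2 * MvPolynomial.X 0 ^ 9, fun i ε hε δ hδ => ?_⟩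
    have : Nonempty (Fin i.n) := i.connected.nonempty
    have hβ : 0 < i.β := hβ₀.trans_le i.le_β
    refine (stepsLE_wormAlgorithm_scale i.edge_nonempty hβ k i.pair.1.1 i.pair.1.2 hε hδ).mono ?_
    have hΔ : (i.graph.maxDegree : ℝ) ≤ i.n := by
      have := i.graph.maxDegree_lt_card_verts
      rw [Fintype.card_fin] at this
      exact_mod_cast this.le
    have hm := edgeFinset_card_le_sq i.graph
    rw [Fintype.card_fin] at hm
    have hx : (Real.tanh i.β ^ k)⁻¹ ≤ (Real.tanh β₀ ^ k)⁻¹ := by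
      have h0 := tanh_pos_of_pos hβ₀
      exact inv_anti₀ (pow_pos h0 k) (pow_le_pow_left₀ h0.le (tanh_mono i.le_β) k)
    have hε0 := hε.1
    have hδ0 := hδ.1
    simp only [map_mul, map_pow, MvPolynomial.eval_C, MvPolynomial.eval_X, Matrix.cons_val_zero,
      Matrix.cons_val_one, Matrix.cons_val]
    rw [stepScale, Fintype.card_fin]
    have hx0 := tanh_pos_of_pos hβ
    calc _ ≤ (2580 + (k : ℝ)) * ((ε ^ 2)⁻¹ * δ⁻¹ * (i.n : ℝ) * (i.n : ℝ) ^ 2 * (i.n : ℝ) ^ 6 *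
          (Real.tanh β₀ ^ k)⁻¹) := by gcongr
      _ = _ := by rw [inv_pow]; ring

end Main

end Worm

end WormProof

theorem mainTheorem6 :
    -- the estimator from samples of the worm chain is an (ε, δ)-approximation
    (∀ (k : ℕ) {V : Type*} [Fintype V] (G : SimpleGraph V) (_ : G.Connected)
        (_ : G.edgeSet.Nonempty) (β : ℝ) (_ : 0 < β) (u v : V) (_ : u ≠ v) (_ : G.dist u v ≤ k)
        (ε : ℝ) (_ : ε ∈ Set.Ioc (0 : ℝ) 1) (δ : ℝ) (_ : δ ∈ Set.Ioc (0 : ℝ) 1)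
        {Ω : Type*} [MeasurableSpace Ω] (μ : MeasureTheory.Measure Ω)
        [MeasureTheory.IsProbabilityMeasure μ] (X : ℕ → Ω → Worm.WormSpace G)
        (_ : Worm.IsWormChain G (Real.tanh β) μ X),
      ENNReal.ofReal (1 - δ) ≤
        μ {ω | |Worm.correlationEstimator (Worm.burnIn G (δ / 2))
                  (Worm.sampleSize G (Real.tanh β) k ε δ) (fun t => X t ω) u v
                - Worm.correlation G β u v| ≤ ε * Worm.correlation G β u v}) ∧
    -- the number of transitions, with an absolute constant
    (∃ C : ℝ, ∀ (k : ℕ) {V : Type*} [Fintype V] (G : SimpleGraph V) [DecidableRel G.Adj]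
        (_ : G.Connected) (_ : G.edgeSet.Nonempty) (β : ℝ) (_ : 0 < β)
        (ε : ℝ) (_ : ε ∈ Set.Ioc (0 : ℝ) 1) (δ : ℝ) (_ : δ ∈ Set.Ioc (0 : ℝ) 1),
      ((Worm.sampleSize G (Real.tanh β) k ε δ + Worm.burnIn G (δ / 2) : ℕ) : ℝ) ≤
        C * (ε ^ 2)⁻¹ * δ⁻¹ * (G.maxDegree : ℝ) * (G.edgeFinset.card : ℝ) *
          (Fintype.card V : ℝ) ^ 6 * (Real.tanh β ^ k)⁻¹) ∧
    -- the number of elementary steps of the algorithm, with a constant depending on `k` only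
    (∀ k : ℕ, ∃ C : ℝ, ∀ {V : Type} [Fintype V] [Nonempty V] (G : SimpleGraph V)
        [DecidableRel G.Adj] (_ : G.Connected) (_ : G.edgeSet.Nonempty) (β : ℝ) (_ : 0 < β)
        (u v : V) (_ : G.dist u v ≤ k)
        (ε : ℝ) (_ : ε ∈ Set.Ioc (0 : ℝ) 1) (δ : ℝ) (_ : δ ∈ Set.Ioc (0 : ℝ) 1),
      (Worm.wormAlgorithm G β k u v ε δ).StepsLE
        (C * (ε ^ 2)⁻¹ * δ⁻¹ * (G.maxDegree : ℝ) * (G.edgeFinset.card : ℝ) *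
          (Fintype.card V : ℝ) ^ 6 * (Real.tanh β ^ k)⁻¹)) ∧
    -- the algorithm is a fully-polynomial randomized approximation scheme
    (∀ (k : ℕ) (β₀ : ℝ) (_ : 0 < β₀),
      Worm.IsFPRAS (fun i : Worm.CorrelationInstance k β₀ => i.n)
        (fun i => i.value) (fun i ε δ => i.run ε δ)) := by
  refine ⟨?_, ?_, ?_, Worm.isFPRAS_worm⟩
  · intro k V _ G hG hE β hβ u v huv hk ε hε δ hδ Ω _ μ _ X hX
    have : Nonempty V := ⟨u⟩
    exact Worm.measure_estimator hG hE hβ huv hk hε hδ hX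
  -- `166 = 145 + 21`, the sample plus the burn-in.
  · refine ⟨166, fun k V _ G _ hG hE β hβ ε hε δ hδ => ?_⟩
    have hx0 := Worm.tanh_pos_of_pos hβ
    have hx1 := (Real.tanh_lt_one β).le
    have h1 := Worm.sampleSize_le hE hx0 hx1 k hε hδ
    have h2 := Worm.burnIn_le hE hx0 hx1 k hε hδ
    push_cast
    refine (add_le_add h1 h2).trans (le_of_eq ?_)
    rw [Worm.stepScale, ← add_mul]
    norm_num
    simp only [mul_assoc]
    congr!
  · refine fun k => ⟨2580 + k, fun {V} _ _ G _ hG hE β hβ u v hk ε hε δ hδ => ?_⟩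
    refine (Worm.stepsLE_wormAlgorithm_scale hE hβ k u v hε hδ).mono (le_of_eq ?_)
    rw [Worm.stepScale]
    simp only [mul_assoc]
    congr!
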